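/- Let $q,d\in\mathbb C^\times$ be generic, i.e. $q^ad^b=1$ for rational $a,b$ (with fixed logarithms of $q,d$) only if $a=b=0$; equivalently $q^md^n=1$ with $m,n\in\mathbb Z$ only if $m=n=0$. Put $q_1=q^{-1}d$, $q_2=q^2$, $q_3=q^{-1}d^{-1}$, $g_{i,i}(z,w)=z-q_2w$, and $g_{i,j}(z,w)=(z-q_1w)(z-q_3w)$ for $i\ne j$, where $i,j\in\mathbb Z/2\mathbb Z$. Let $\mathcal E$ be the quantum toroidal algebra of type $\mathfrak{gl}_2$: the unital associative $\mathbb C$-algebra generated by $E_{i,k},F_{i,k}$ $(k\in\mathbb Z)$, $H_{i,r}$ $(r\in\mathbb Z\setminus\{0\})$, $K_i^{\pm1}$ $(i\in\mathbb Z/2\mathbb Z)$ and an invertible central element $\mathsf t$, with the following relations between the series $E_i(z)=\sum_kE_{i,k}z^{-k}$, $F_i(z)=\sum_kF_{i,k}z^{-k}$, $K_i^\pm(z)=K_i^{\pm1}\exp\bigl(\pm(q-q^{-1})\sum_{r>0}H_{i,\pm r}z^{\mp r}\bigr)$: all coefficients of all $K_i^\pm(z)$ commute with each other, and $$(-1)^{i+j}g_{i,j}(z,w)K_i^\pm(z)E_j(w)+g_{j,i}(w,z)E_j(w)K_i^\pm(z)=0,$$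 $$(-1)^{i+j}g_{j,i}(w,z)K_i^\pm(z)F_j(w)+g_{i,j}(z,w)F_j(w)K_i^\pm(z)=0,$$ $$[E_i(z),F_j(w)]=\frac{\delta_{i,j}}{q-q^{-1}}\,\delta(z/w)\,(K_i^+(w)-K_i^-(z)),\qquad \delta(z)=\sum_{k\in\mathbb Z}z^k,$$ $$(-1)^{i+j}g_{i,j}(z,w)E_i(z)E_j(w)+g_{j,i}(w,z)E_j(w)E_i(z)=0,$$ $$(-1)^{i+j}g_{j,i}(w,z)F_i(z)F_j(w)+g_{i,j}(z,w)F_j(w)F_i(z)=0,$$ $$\mathrm{Sym}_{z_1,z_2,z_3}[X_i(z_1),[X_i(z_2),[X_i(z_3),X_{i+1}(w)]_{q^2}]]_{q^{-2}}=0\quad(X=E,F),$$ where $[A,B]_p=AB-pBA$. Identify a partition $\lambda_1\ge\lambda_2\ge\cdots$ with the finite set of boxes $(x,0,z)$, $x,z\in\mathbb Z_{\ge0}$, $x<\lambda_{z+1}$. The box $\Box=(x,0,z)$ has color $c(\Box)=x+z$ mod $2$ and position $p(\Box)=q_1^{-x}q_3^{-z}$; boxes are ordered lexicographically, first by $z$,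 then by $x$. Let $CC_i(\lambda)$ (resp. $CV_i(\lambda)$) be the set of boxes of color $i$ which can be added to (resp. removed from) $\lambda$ so that the result $\lambda\sqcup\Box$ (resp. $\lambda\setminus\Box$) is a partition. Let $$\Psi=0_{q^{-1}}=\Bigl(\frac{qz-q^{-1}}{z-1},\,1\Bigr),$$ let $A_{i,a}(z)$ be the pair of rational functions whose $i$-th component is $\frac{q_2z-a}{z-q_2a}$ and whose other component is $\frac{(q_1z-a)(q_3z-a)}{(z-q_1a)(z-q_3a)}$, and put $$\phi_\lambda=\Psi\prod_{\Box\in\lambda}A^{-1}_{c(\Box),p(\Box)},\quad \phi_{\lambda,<\Box}=\Psi\prod_{\Box'\in\lambda,\,\Box'<\Box}A^{-1}_{c(\Box'),p(\Box')},\quad \phi_{\lambda,>\Box}=\prod_{\Box'\in\lambda,\,\Box'>\Box}A^{-1}_{c(\Box'),p(\Box')}.$$ **Proposition.** Let $\mathcal F_0$ be the vector space with basis $|\lambda\rangle$ labelled by all partitions, and let $\tau\in\mathbb C^\times$. The formulas $$K_i^\pm(z)|\lambda\rangle=\phi^i_\lambda(z)|\lambda\rangle,\qquad \mathsf t\,|\lambda\rangle=\tau|\lambda\rangle,$$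 $$F_i(z)|\lambda\rangle=\sum_{\Box\in CC_i(\lambda)}\phi^i_{\lambda,>\Box}(p(\Box))\,\delta(z/p(\Box))\,|\lambda\sqcup\Box\rangle,$$ $$E_i(z)|\lambda\rangle=\sum_{\Box\in CV_i(\lambda)}\frac{1}{q-q^{-1}}\Bigl(\mathop{\mathrm{res}}_{z'=p(\Box)}\phi^i_{\lambda,<\Box}(z')\frac{dz'}{z'}\Bigr)\delta(z/p(\Box))\,|\lambda\setminus\Box\rangle$$ (where $\phi^i_\lambda(z)$ is expanded at $z=\infty$ for $K_i^+$ and at $z=0$ for $K_i^-$) define an $\mathcal E$-module structure on $\mathcal F_0$. This module is irreducible; it is tame, i.e. it has a basis of $\ell$-weight vectors with distinct $\ell$-weights (a vector $v$ has $\ell$-weight $(\phi^0,\phi^1)$ if $K_i^\pm(z)v=\phi^i(z)v$ for $i=0,1$); it is a highest $\ell$-weight module of highest $\ell$-weight $\Psi$, i.e. it is generated by a vector $v$ of $\ell$-weight $\Psi$ with $E_0(z)v=E_1(z)v=0$; and it has level $q$, i.e. $K_0K_1$ acts as the scalar $q$. -/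

import Mathlib

namespace QTor

noncomputable section

/-! ### The quantum toroidal algebra of type `gl₂` (parallel realization) -/

/-- `q₁ = q⁻¹ d`. -/
def q1 (q d : ℂ) : ℂ := q⁻¹ * d

/-- `q₂ = q²`. -/
def q2 (q : ℂ) : ℂ := q ^ 2

/-- `q₃ = q⁻¹ d⁻¹`. -/
def q3 (q d : ℂ) : ℂ := q⁻¹ * d⁻¹

/-- The upper index `±`. -/
inductive PM
  | plus
  | minus

/-- Generators: the modes `E_{i,k}`, `F_{i,k}` (`k ∈ ℤ`), `H_{i,r}` (`r ∈ ℤ ∖ {0}`), the elements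
`K_i`, `K_i⁻¹`, and the split (in particular invertible) central element `t`. -/
inductive Gen
  | E (i : ZMod 2) (k : ℤ)
  | F (i : ZMod 2) (k : ℤ)
  | H (i : ZMod 2) (r : {r : ℤ // r ≠ 0})
  | K (i : ZMod 2)
  | Kinv (i : ZMod 2)
  | t
  | tinv

/-- The free algebra on the generators. -/
abbrev Free : Type := FreeAlgebra ℂ Gen

/-- A generator as an element of the free algebra. -/
abbrev gen (x : Gen) : Free := FreeAlgebra.ι ℂ x

/-- For `h(u) = ∑_{r > 0} h_r u^r` with `h_r` in a (not necessarily commutative) algebra,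
the coefficient of `u^n` in `exp (h(u)) = ∑_m h(u)^m / m!`; since `h(u)` has no constant term, only
`m ≤ n` contributes. The value `h 0` is ignored. -/
def expCoeff {A : Type*} [Ring A] [Algebra ℂ A] (h : ℕ → A) (n : ℕ) : A :=
  ∑ m ∈ Finset.range (n + 1), ((m.factorial : ℂ)⁻¹) •
    PowerSeries.coeff n ((PowerSeries.mk fun r => if r = 0 then 0 else h r) ^ m)

/-- `H_{i,r}` for `r ≠ 0` (and `0` for `r = 0`). -/
def freeH (i : ZMod 2) (r : ℤ) : Free := if h : r ≠ 0 then gen (Gen.H i ⟨r, h⟩) else 0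

/-- The coefficient of `z^{-k}` in
`K_i^±(z) = K_i^{±1} exp (± (q - q⁻¹) ∑_{r > 0} H_{i,±r} z^{∓r})`. -/
def freeCartan (q : ℂ) : PM → ZMod 2 → ℤ → Free
  | PM.plus, i, k =>
      if 0 ≤ k then
        gen (Gen.K i) * expCoeff (fun r => (q - q⁻¹) • freeH i (r : ℤ)) k.toNat
      else 0
  | PM.minus, i, k =>
      if k ≤ 0 then
        gen (Gen.Kinv i) * expCoeff (fun r => (-(q - q⁻¹)) • freeH i (-(r : ℤ))) (-k).toNat
      else 0

/-- `E_i(z) = ∑ E_{i,k} z^{-k}`. -/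
def freeE (i : ZMod 2) (k : ℤ) : Free := gen (Gen.E i k)

/-- `F_i(z) = ∑ F_{i,k} z^{-k}`. -/
def freeF (i : ZMod 2) (k : ℤ) : Free := gen (Gen.F i k)

/-- `(-1)^{i+j}` for `i, j ∈ ℤ/2`. -/
def parity (i j : ZMod 2) : ℂ := if i = j then 1 else -1

section series

variable {A : Type*} [Ring A] [Algebra ℂ A]

/- A formal series `∑ f_{k,l} z^{-k} w^{-l}`, infinite in both directions, is the function
`f : ℤ → ℤ → A`. -/

/-- `(z - a w) f(z,w)`. -/
def mulZW (a : ℂ) (f : ℤ → ℤ → A) (k l : ℤ) : A := f (k + 1) l - a • f k (l + 1)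

/-- `(w - a z) f(z,w)`. -/
def mulWZ (a : ℂ) (f : ℤ → ℤ → A) (k l : ℤ) : A := f k (l + 1) - a • f (k + 1) l

/-- `g_{i,j}(z,w) f(z,w)`. -/
def mulGzw (q d : ℂ) (i j : ZMod 2) (f : ℤ → ℤ → A) : ℤ → ℤ → A :=
  if i = j then mulZW (q2 q) f else mulZW (q1 q d) (mulZW (q3 q d) f)

/-- `g_{i,j}(w,z) f(z,w)`. -/
def mulGwz (q d : ℂ) (i j : ZMod 2) (f : ℤ → ℤ → A) : ℤ → ℤ → A :=
  if i = j then mulWZ (q2 q) f else mulWZ (q1 q d) (mulWZ (q3 q d) f)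

/-- For currents `X(z)` (of color `i`) and `Y(w)` (of color `j`), the coefficient of `z^{-k} w^{-l}`
in `(-1)^{i+j} g_{i,j}(z,w) X(z) Y(w) + g_{j,i}(w,z) Y(w) X(z)`. -/
def exchangeE (q d : ℂ) (i j : ZMod 2) (X Y : ℤ → A) (k l : ℤ) : A :=
  parity i j • mulGzw q d i j (fun k l => X k * Y l) k l +
    mulGwz q d j i (fun k l => Y l * X k) k l

/-- For currents `X(z)` (of color `i`) and `Y(w)` (of color `j`), the coefficient of `z^{-k} w^{-l}`
in `(-1)^{i+j} g_{j,i}(w,z) X(z) Y(w) + g_{i,j}(z,w) Y(w) X(z)`. -/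
def exchangeF (q d : ℂ) (i j : ZMod 2) (X Y : ℤ → A) (k l : ℤ) : A :=
  parity i j • mulGwz q d j i (fun k l => X k * Y l) k l +
    mulGzw q d i j (fun k l => Y l * X k) k l

/-- `[a, b]_p = a b - p b a`. -/
def qComm (p : ℂ) (a b : A) : A := a * b - p • (b * a)

/-- The coefficient of `z₁^{-k 0} z₂^{-k 1} z₃^{-k 2} w^{-l}` in
`Sym_{z₁,z₂,z₃} [X(z₁), [X(z₂), [X(z₃), Y(w)]_{q²}]]_{q⁻²}`. -/
def serre (q : ℂ) (X Y : ℤ → A) (k : Fin 3 → ℤ) (l : ℤ) : A :=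
  ((Nat.factorial 3 : ℂ)⁻¹) • ∑ s : Equiv.Perm (Fin 3),
    qComm (q ^ (-2 : ℤ)) (X (k (s 0)))
      (qComm 1 (X (k (s 1))) (qComm (q ^ 2) (X (k (s 2))) (Y l)))

end series

/-- The defining relations of the quantum toroidal algebra, coefficient by coefficient. -/
inductive Rel (q d : ℂ) : Free → Free → Prop
  | K_Kinv (i : ZMod 2) : Rel q d (gen (Gen.K i) * gen (Gen.Kinv i)) 1
  | Kinv_K (i : ZMod 2) : Rel q d (gen (Gen.Kinv i) * gen (Gen.K i)) 1
  | t_tinv : Rel q d (gen Gen.t * gen Gen.tinv) 1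
  | tinv_t : Rel q d (gen Gen.tinv * gen Gen.t) 1
  | t_central (x : Gen) : Rel q d (gen Gen.t * gen x) (gen x * gen Gen.t)
  | KK (e e' : PM) (i j : ZMod 2) (k l : ℤ) :
      Rel q d (freeCartan q e i k * freeCartan q e' j l)
        (freeCartan q e' j l * freeCartan q e i k)
  | KE (e : PM) (i j : ZMod 2) (k l : ℤ) :
      Rel q d (exchangeE q d i j (freeCartan q e i) (freeE j) k l) 0
  | KF (e : PM) (i j : ZMod 2) (k l : ℤ) :
      Rel q d (exchangeF q d i j (freeCartan q e i) (freeF j) k l) 0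
  /- the coefficient of `z^{-k} w^{-l}` in `δ(z/w) K^+(w)` and in `δ(z/w) K^-(z)` is `K^±_{k+l}` -/
  | EF (i j : ZMod 2) (k l : ℤ) :
      Rel q d (freeE i k * freeF j l - freeF j l * freeE i k)
        (if i = j then
          (q - q⁻¹)⁻¹ • (freeCartan q PM.plus i (k + l) - freeCartan q PM.minus i (k + l))
        else 0)
  | EE (i j : ZMod 2) (k l : ℤ) : Rel q d (exchangeE q d i j (freeE i) (freeE j) k l) 0
  | FF (i j : ZMod 2) (k l : ℤ) : Rel q d (exchangeF q d i j (freeF i) (freeF j) k l) 0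
  | serreE (i : ZMod 2) (k : Fin 3 → ℤ) (l : ℤ) :
      Rel q d (serre q (freeE i) (freeE (i + 1)) k l) 0
  | serreF (i : ZMod 2) (k : Fin 3 → ℤ) (l : ℤ) :
      Rel q d (serre q (freeF i) (freeF (i + 1)) k l) 0

/-- The quantum toroidal algebra of type `gl₂`. -/
abbrev Toroidal (q d : ℂ) : Type := RingQuot (Rel q d)

/-- The projection from the free algebra. -/
def proj (q d : ℂ) : Free →ₐ[ℂ] Toroidal q d := RingQuot.mkAlgHom ℂ (Rel q d)

/-- `E_{i,k}`. -/
def E (q d : ℂ) (i : ZMod 2) (k : ℤ) : Toroidal q d := proj q d (freeE i k)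

/-- `F_{i,k}`. -/
def F (q d : ℂ) (i : ZMod 2) (k : ℤ) : Toroidal q d := proj q d (freeF i k)

/-- `K_i`. -/
def K (q d : ℂ) (i : ZMod 2) : Toroidal q d := proj q d (gen (Gen.K i))

/-- The central element `t`. -/
def t (q d : ℂ) : Toroidal q d := proj q d (gen Gen.t)

/-- The coefficient of `z^{-k}` in the Cartan current `K_i^±(z)`. -/
def cartan (q d : ℂ) (e : PM) (i : ZMod 2) (k : ℤ) : Toroidal q d := proj q d (freeCartan q e i k)

/-! ### Rational functions -/

/-- The Laurent series `f(a)` in a formal variable `u`, for a rational function `f` and a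
non-constant Laurent series `a` in `u`. -/
def expand (a : LaurentSeries ℂ) (f : RatFunc ℂ) : LaurentSeries ℂ :=
  f.eval (HahnSeries.C : ℂ →+* LaurentSeries ℂ) a

/-- The coefficient of `z^{-k}` in the expansion of `f(z)` at `z = ∞` (for `plus`),
respectively at `z = 0` (for `minus`). -/
def expansionCoeff : PM → RatFunc ℂ → ℤ → ℂ
  | PM.plus, f, k => (expand (HahnSeries.single (-1) 1) f).coeff k
  | PM.minus, f, k => (expand (HahnSeries.single 1 1) f).coeff (-k)

/-- `res_{z = p} f(z) dz / z`: the coefficient of `u⁻¹` of `f(z) / z` at `z = p + u`. -/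
def resLog (p : ℂ) (f : RatFunc ℂ) : ℂ :=
  (expand (HahnSeries.C p + HahnSeries.single 1 1) (f / RatFunc.X)).coeff (-1)

/-- The value of `f` at the point `p`, where `f` is regular at `p`. -/
def value (p : ℂ) (f : RatFunc ℂ) : ℂ := f.eval (RingHom.id ℂ) p

/-- The pairs `0_a` and `1_a` (for `i = 0, 1`): the `i`-th component is `(q z - a) / (z - a q)`,
the other one is `1`. -/
def fundamental (q : ℂ) (i : ZMod 2) (a : ℂ) (j : ZMod 2) : RatFunc ℂ :=
  if j = i then
    (RatFunc.C q * RatFunc.X - RatFunc.C a) / (RatFunc.X - RatFunc.C (a * q))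
  else 1

/-- The pairs `A_{i,a}(z)`: the `i`-th component is `(q₂ z - a) / (z - q₂ a)`, the other one is
`(q₁ z - a) (q₃ z - a) / ((z - q₁ a) (z - q₃ a))`. -/
def affineRoot (q d : ℂ) (i : ZMod 2) (a : ℂ) (j : ZMod 2) : RatFunc ℂ :=
  if j = i then
    (RatFunc.C (q2 q) * RatFunc.X - RatFunc.C a) / (RatFunc.X - RatFunc.C (q2 q * a))
  else
    ((RatFunc.C (q1 q d) * RatFunc.X - RatFunc.C a) *
        (RatFunc.C (q3 q d) * RatFunc.X - RatFunc.C a)) /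
      ((RatFunc.X - RatFunc.C (q1 q d * a)) * (RatFunc.X - RatFunc.C (q3 q d * a)))

/-! ### Modules -/

section modules

variable {q d : ℂ} {W : Type} [AddCommGroup W] [Module ℂ W]

/-- `v` is a vector of `ℓ`-weight `φ`: `K_i^±(z) v = φ^i(z) v`, where `φ^i` is expanded at `∞` for
`K_i^+` and at `0` for `K_i^-`. -/
def HasLWeight (ρ : Toroidal q d →ₐ[ℂ] Module.End ℂ W) (v : W) (φ : ZMod 2 → RatFunc ℂ) : Prop :=
  ∀ (e : PM) (i : ZMod 2) (k : ℤ), ρ (cartan q d e i k) v = expansionCoeff e (φ i) k • v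

/-- The module is tame: there is a basis of `ℓ`-weight vectors with distinct `ℓ`-weights. -/
def IsTame (ρ : Toroidal q d →ₐ[ℂ] Module.End ℂ W) : Prop :=
  ∃ (ι : Type) (b : Module.Basis ι ℂ W) (φ : ι → ZMod 2 → RatFunc ℂ),
    Function.Injective φ ∧ ∀ s, HasLWeight ρ (b s) (φ s)

/-- The module is irreducible. -/
def IsIrreducible (ρ : Toroidal q d →ₐ[ℂ] Module.End ℂ W) : Prop :=
  Nontrivial W ∧
    ∀ U : Submodule ℂ W, (∀ x, ∀ u ∈ U, ρ x u ∈ U) → U = ⊥ ∨ U = ⊤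

/-- The module is a highest `ℓ`-weight module of highest `ℓ`-weight `φ`. -/
def IsHighestLWeight (ρ : Toroidal q d →ₐ[ℂ] Module.End ℂ W) (φ : ZMod 2 → RatFunc ℂ) : Prop :=
  ∃ v : W, HasLWeight ρ v φ ∧ (∀ i k, ρ (E q d i k) v = 0) ∧ ∀ w : W, ∃ x, ρ x v = w

/-- The module has level `κ`: the element `K_0 K_1` acts as the scalar `κ`. -/
def HasLevel (ρ : Toroidal q d →ₐ[ℂ] Module.End ℂ W) (κ : ℂ) : Prop :=
  ∀ v : W, ρ (K q d 0 * K q d 1) v = κ • v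

end modules

/-! ### The Fock module

Partitions are Young diagrams; the box with coordinates `(x, 0, z)` is the pair `(z, x)`
(row `z`, column `x`, so that row `z` consists of the boxes `(0,0,z), …, (λ_{z+1} - 1, 0, z)`).
All boxes are positive. -/

/-- A box `(x, 0, z)`, written as `(z, x)`. -/
abbrev Box : Type := ℕ × ℕ

/-- The color of the box `(x, 0, z)`: `x + z` modulo `2`. -/
def color (b : Box) : ZMod 2 := ((b.2 + b.1 : ℕ) : ZMod 2)

/-- The position of the box `(x, 0, z)`: `q₁^{-x} q₃^{-z}`. -/
def pos (q d : ℂ) (b : Box) : ℂ := q1 q d ^ (-(b.2 : ℤ)) * q3 q d ^ (-(b.1 : ℤ))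

/-- The ordering of boxes: lexicographic, first by `z`, then by `x`. -/
def Before (b b' : Box) : Prop := b.1 < b'.1 ∨ (b.1 = b'.1 ∧ b.2 < b'.2)

instance : DecidableRel Before := fun b b' =>
  inferInstanceAs (Decidable (b.1 < b'.1 ∨ (b.1 = b'.1 ∧ b.2 < b'.2)))

/-- The highest `ℓ`-weight `Ψ = 0_{q⁻¹}`. -/
def Psi (q : ℂ) : ZMod 2 → RatFunc ℂ := fundamental q 0 q⁻¹

/-- The `ℓ`-weight `φ_lam` of the state `lam`. -/
def phi (q d : ℂ) (lam : YoungDiagram) (i : ZMod 2) : RatFunc ℂ :=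
  Psi q i * ∏ b ∈ lam.cells, (affineRoot q d (color b) (pos q d b) i)⁻¹

/-- `φ_{lam, < b}`. -/
def phiBefore (q d : ℂ) (lam : YoungDiagram) (b : Box) (i : ZMod 2) : RatFunc ℂ :=
  Psi q i * ∏ b' ∈ lam.cells with Before b' b, (affineRoot q d (color b') (pos q d b') i)⁻¹

/-- `φ_{lam, > b}`. -/
def phiAfter (q d : ℂ) (lam : YoungDiagram) (b : Box) (i : ZMod 2) : RatFunc ℂ :=
  ∏ b' ∈ lam.cells with Before b b', (affineRoot q d (color b') (pos q d b') i)⁻¹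

/-- The concave boxes of color `i`: those that can be added to the partition. -/
def concaveSet (i : ZMod 2) (lam : YoungDiagram) : Set Box :=
  {b | color b = i ∧ b ∉ lam.cells ∧ ∃ mu : YoungDiagram, mu.cells = insert b lam.cells}

/-- The convex boxes of color `i`: those that can be removed from the partition. -/
def convexSet (i : ZMod 2) (lam : YoungDiagram) : Set Box :=
  {b | color b = i ∧ b ∈ lam.cells ∧ ∃ mu : YoungDiagram, mu.cells = lam.cells.erase b}

theorem concaveSet_finite (i : ZMod 2) (lam : YoungDiagram) : (concaveSet i lam).Finite := by
  refine Set.Finite.subset (Finset.finite_toSet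
    (Finset.range (lam.colLen 0 + 1) ×ˢ Finset.range (lam.rowLen 0 + 1))) ?_
  rintro ⟨r, c⟩ ⟨-, -, mu, hmu⟩
  have hb : (r, c) ∈ mu.cells := by rw [hmu]; exact Finset.mem_insert_self _ _
  have key : ∀ r' c', r' ≤ r → c' ≤ c → (r', c') ≠ (r, c) → (r', c') ∈ lam := by
    intro r' c' hr hc hne
    have h : (r', c') ∈ mu.cells := mu.isLowerSet (show (r', c') ≤ (r, c) from ⟨hr, hc⟩) hb
    rw [hmu, Finset.mem_insert] at h
    exact h.resolve_left hne
  simp only [Finset.coe_product, Finset.coe_range, Set.mem_prod, Set.mem_Iio]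
  constructor
  · rcases r with _ | r
    · omega
    · have := YoungDiagram.mem_iff_lt_colLen.1 (key r 0 (by omega) (by omega) (by simp))
      omega
  · rcases c with _ | c
    · omega
    · have := YoungDiagram.mem_iff_lt_rowLen.1 (key 0 c (by omega) (by omega) (by simp))
      omega

theorem convexSet_finite (i : ZMod 2) (lam : YoungDiagram) : (convexSet i lam).Finite :=
  lam.cells.finite_toSet.subset fun _ hb => hb.2.1

/-- `CC_i(lam)`. -/
def concaveBoxes (i : ZMod 2) (lam : YoungDiagram) : Finset Box := (concaveSet_finite i lam).toFinset

/-- `CV_i(lam)`. -/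
def convexBoxes (i : ZMod 2) (lam : YoungDiagram) : Finset Box := (convexSet_finite i lam).toFinset

open Classical in
/-- The partition `lam ⊔ b` (used only when `b` is concave for `lam`). -/
def addBox (lam : YoungDiagram) (b : Box) : YoungDiagram :=
  if h : ∃ mu : YoungDiagram, mu.cells = insert b lam.cells then h.choose else lam

open Classical in
/-- The partition `lam ∖ b` (used only when `b` is convex for `lam`). -/
def removeBox (lam : YoungDiagram) (b : Box) : YoungDiagram :=
  if h : ∃ mu : YoungDiagram, mu.cells = lam.cells.erase b then h.choose else lam

/-- The coefficient `a_{lam,b}^i = φ_{lam,>b}^i(p(b))`. -/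
def coeffA (q d : ℂ) (i : ZMod 2) (lam : YoungDiagram) (b : Box) : ℂ :=
  value (pos q d b) (phiAfter q d lam b i)

/-- The coefficient `b_{lam,b}^i = (q - q⁻¹)⁻¹ res_{z = p(b)} φ_{lam,<b}^i(z) dz / z`. -/
def coeffB (q d : ℂ) (i : ZMod 2) (lam : YoungDiagram) (b : Box) : ℂ :=
  (q - q⁻¹)⁻¹ * resLog (pos q d b) (phiBefore q d lam b i)

/-- The vector space with basis `|lam⟩` labelled by partitions. -/
abbrev FockSpace : Type := YoungDiagram →₀ ℂ

/-- The basis vector `|lam⟩`. -/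
def ket (lam : YoungDiagram) : FockSpace := Finsupp.single lam 1

/-- The generators act by the explicit formulas
`K_i^±(z) |lam⟩ = φ_lam^i(z) |lam⟩`,
`F_i(z) |lam⟩ = ∑_{b ∈ CC_i(lam)} a_{lam,b}^i δ(z / p(b)) |lam ⊔ b⟩`,
`E_i(z) |lam⟩ = ∑_{b ∈ CV_i(lam)} b_{lam,b}^i δ(z / p(b)) |lam ∖ b⟩`,
and `t` acts as `τ`. The coefficient of `z^{-k}` in `δ(z / p)` is `p^k`. -/
structure IsFockAction (q d τ : ℂ) (ρ : Toroidal q d →ₐ[ℂ] Module.End ℂ FockSpace) : Prop where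
  cartan_ket (lam : YoungDiagram) : HasLWeight ρ (ket lam) (phi q d lam)
  F_ket (i : ZMod 2) (k : ℤ) (lam : YoungDiagram) :
    ρ (F q d i k) (ket lam) =
      ∑ b ∈ concaveBoxes i lam, (coeffA q d i lam b * pos q d b ^ k) • ket (addBox lam b)
  E_ket (i : ZMod 2) (k : ℤ) (lam : YoungDiagram) :
    ρ (E q d i k) (ket lam) =
      ∑ b ∈ convexBoxes i lam, (coeffB q d i lam b * pos q d b ^ k) • ket (removeBox lam b)
  t_ket (v : FockSpace) : ρ (t q d) v = τ • v

end

end QTor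

/-! The algebra is a quotient of a free algebra, so a module is an action of the free algebra which
respects every relation. By genericity the positions `q^(z+x) d^(z-x)` are pairwise distinct on the
whole lattice `ℤ × ℤ` (`Generic.lpos_injective`). All zeros and poles of the weights lie at lattice
positions, and `g_{i,j}` at the positions of two boxes of these colors vanishes only if the boxes
are adjacent or diagonal neighbors (`gBox_eq_zero_iff`). Thus analytic questions become
combinatorics of Young diagrams.

The currents `E_i(z)` and `F_i(z)` are locally finite sums of delta functions times operators `eOp`,
`fOp` which remove or add one fixed box. On a delta function a polynomial acts by its value, so a
quadratic relation between currents reduces to one between two box operators. The matrix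
coefficients of these are products of two-box factors `eta`. The exchange relations say that
interchanging two boxes costs exactly one such factor; if only one order of the boxes is possible,
the structure function kills it. Operators removing `c` and adding `b ≠ c` commute because `eta b c
* eta c b = 1`.

The commutator of `eOp b` and `fOp b` is diagonal, and its entry is the residue of the weight at the
position of `b` up to the factor `(q - q⁻¹)⁻¹`. The weight is bounded at infinity and has at most
simple poles, which lie at the corners of the diagram (`phiMult_cases`), so by partial fractions its
expansions at infinity and at zero differ by the sum of these residues times delta functions. This
is the relation between `E` and `F`. The modes `H_{i,r}` act by the coefficients of the logarithms
of the expansions, normalized by the eigenvalue of `K_i`.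

For the Serre relation take three boxes of one color and one of the other. If two of equal color are
diagonal neighbors, every word in the four operators vanishes: it would produce a skew shape, which
must contain both boxes in between, and only one box of the other color is available. Otherwise the
exchange relations bring all words to one ordered word, and its total coefficient vanishes by an
identity of rational functions or a degenerate form of it (`SerreData.serreSum_eq_zero`).

Distinct diagrams have distinct weights (`phi_injective`), so a submodule contains every basis
vector occurring in one of its elements. All matrix coefficients are nonzero, hence from any diagram
one descends to the empty one and climbs to every other. This gives irreducibility and generation by
the vacuum. -/

namespace QTor
noncomputable section

/-! ### Expansions of rational functions -/

/-- `a` is transcendental over the constants. -/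
def NonAlg (a : LaurentSeries ℂ) : Prop :=
  ∀ P : Polynomial ℂ, P ≠ 0 → P.eval₂ (HahnSeries.C : ℂ →+* LaurentSeries ℂ) a ≠ 0

theorem nonAlg_zero : NonAlg (HahnSeries.single 1 1) := by
  intro P hP h
  apply hP
  have h1 := Polynomial.hom_eval₂ P (PowerSeries.C (R := ℂ)) (HahnSeries.ofPowerSeries ℤ ℂ)
    PowerSeries.X
  have h2 : (HahnSeries.ofPowerSeries ℤ ℂ).comp PowerSeries.C = HahnSeries.C := by
    ext1 c
    simp [HahnSeries.ofPowerSeries_C]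
  rw [h2, HahnSeries.ofPowerSeries_X, h, Polynomial.eval₂_C_X_eq_coe] at h1
  exact Polynomial.coe_eq_zero_iff.1
    (HahnSeries.ofPowerSeries_injective (h1.trans (map_zero _).symm))

theorem NonAlg.add_C {a : LaurentSeries ℂ} (ha : NonAlg a) (p : ℂ) :
    NonAlg (HahnSeries.C p + a) := by
  intro P hP h
  refine ha (P.comp (Polynomial.C p + Polynomial.X)) ?_ ?_
  · intro h0
    apply hP
    have := congrArg (fun Q => Q.comp (Polynomial.X - Polynomial.C p)) h0
    simpa [Polynomial.comp_assoc] using this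
  · rw [Polynomial.eval₂_comp]; simpa using h

/-- A polynomial relation for `a⁻¹` becomes one for `a` by reversing the coefficients. -/
theorem NonAlg.inv {a : LaurentSeries ℂ} (ha : NonAlg a) : NonAlg a⁻¹ := by
  intro P hP h
  have h0 : a ≠ 0 := fun h0 => ha Polynomial.X Polynomial.X_ne_zero (by simpa using h0)
  let _ := invertibleOfNonzero (inv_ne_zero h0)
  have := Polynomial.eval₂_reverse_mul_pow (HahnSeries.C : ℂ →+* LaurentSeries ℂ) a⁻¹ P
  rw [h, invOf_eq_inv, inv_inv] at this
  exact ha P.reverse (by simpa using hP)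
    ((mul_eq_zero.1 this).resolve_right (pow_ne_zero _ (inv_ne_zero h0)))

theorem nonAlg_infty : NonAlg (HahnSeries.single (-1) 1) := by
  have := nonAlg_zero.inv
  rwa [HahnSeries.inv_single, inv_one] at this

theorem nonAlg_point (p : ℂ) : NonAlg (HahnSeries.C p + HahnSeries.single 1 1) :=
  nonAlg_zero.add_C p

/-- Expansion in powers of a transcendental Laurent series, as a ring homomorphism. -/
def expandHom (a : LaurentSeries ℂ) (ha : NonAlg a) : RatFunc ℂ →+* LaurentSeries ℂ :=
  RatFunc.liftRingHom (Polynomial.eval₂RingHom (HahnSeries.C : ℂ →+* LaurentSeries ℂ) a)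
    (fun P hP => by
      have : P ≠ 0 := nonZeroDivisors.ne_zero hP
      simpa using ha P this)

/-- `RatFunc.eval` divides the values of numerator and denominator, with junk value `0` if the
latter vanishes. Transcendence excludes this, so that expansion is multiplicative and additive. -/
theorem expand_eq {a : LaurentSeries ℂ} (ha : NonAlg a) (f : RatFunc ℂ) :
    expand a f = expandHom a ha f := by
  simp [expand, RatFunc.eval, expandHom, RatFunc.liftRingHom_apply]

theorem expandHom_C {a : LaurentSeries ℂ} (ha : NonAlg a) (c : ℂ) :
    expandHom a ha (RatFunc.C c) = HahnSeries.C c := by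
  rw [← expand_eq]; simp [expand]

theorem expandHom_X {a : LaurentSeries ℂ} (ha : NonAlg a) : expandHom a ha RatFunc.X = a := by
  rw [← expand_eq]; simp [expand]

theorem expansionCoeff_add (e : PM) (f g : RatFunc ℂ) (k : ℤ) :
    expansionCoeff e (f + g) k = expansionCoeff e f k + expansionCoeff e g k := by
  cases e
  · simp [expansionCoeff, expand_eq nonAlg_infty]
  · simp [expansionCoeff, expand_eq nonAlg_zero]

theorem expansionCoeff_C_mul (e : PM) (c : ℂ) (f : RatFunc ℂ) (k : ℤ) :
    expansionCoeff e (RatFunc.C c * f) k = c * expansionCoeff e f k := by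
  cases e
  · simp [expansionCoeff, expand_eq nonAlg_infty, expandHom_C]
  · simp [expansionCoeff, expand_eq nonAlg_zero, expandHom_C]

theorem expansionCoeff_X_mul (e : PM) (f : RatFunc ℂ) (k : ℤ) :
    expansionCoeff e (RatFunc.X * f) k = expansionCoeff e f (k + 1) := by
  cases e
  · simp only [expansionCoeff, expand_eq nonAlg_infty, map_mul, expandHom_X]
    have := HahnSeries.coeff_single_mul_add (r := (1:ℂ))
      (x := expandHom _ nonAlg_infty f) (a := k + 1) (b := -1)
    simpa using this
  · simp only [expansionCoeff, expand_eq nonAlg_zero, map_mul, expandHom_X]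
    have := HahnSeries.coeff_single_mul_add (r := (1:ℂ))
      (x := expandHom _ nonAlg_zero f) (a := -(k + 1)) (b := 1)
    simpa using this

/-- Expansion is a homomorphism from a field, hence injective. -/
theorem expansionCoeff_ext {f g : RatFunc ℂ}
    (h : ∀ k, expansionCoeff PM.plus f k = expansionCoeff PM.plus g k) : f = g := by
  apply (expandHom _ nonAlg_infty).injective
  ext k
  simpa [expansionCoeff, expand_eq nonAlg_infty] using h k

/-! ### Regularity and leading coefficients -/

/-- The expansion of `f` in powers of `a` is a power series with constant term `c`. -/
def HasLead (a : LaurentSeries ℂ) (f : RatFunc ℂ) (c : ℂ) : Prop :=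
  ∃ s : PowerSeries ℂ, expand a f = HahnSeries.ofPowerSeries ℤ ℂ s ∧
    PowerSeries.constantCoeff s = c

section lead

variable {a : LaurentSeries ℂ} {f g : RatFunc ℂ} {c c' : ℂ}

theorem HasLead.unique (h : HasLead a f c) (h' : HasLead a f c') : c = c' := by
  obtain ⟨s, hs, rfl⟩ := h
  obtain ⟨t, ht, rfl⟩ := h'
  rw [HahnSeries.ofPowerSeries_injective (hs.symm.trans ht)]

theorem HasLead.mul (ha : NonAlg a) (h : HasLead a f c) (h' : HasLead a g c') :
    HasLead a (f * g) (c * c') := by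
  obtain ⟨s, hs, rfl⟩ := h
  obtain ⟨t, ht, rfl⟩ := h'
  refine ⟨s * t, ?_, by simp⟩
  rw [expand_eq ha] at *
  simp [hs, ht]

theorem HasLead.inv (ha : NonAlg a) (h : HasLead a f c) (hc : c ≠ 0) :
    HasLead a f⁻¹ c⁻¹ := by
  obtain ⟨s, hs, rfl⟩ := h
  refine ⟨s⁻¹, ?_, by simp⟩
  rw [expand_eq ha] at *
  rw [map_inv₀, hs]
  refine inv_eq_of_mul_eq_one_right ?_
  rw [← map_mul, PowerSeries.mul_inv_cancel _ hc, map_one]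

theorem HasLead.div (ha : NonAlg a) (h : HasLead a f c) (h' : HasLead a g c') (hc : c' ≠ 0) :
    HasLead a (f / g) (c / c') := by
  rw [div_eq_mul_inv, div_eq_mul_inv]
  exact h.mul ha (h'.inv ha hc)

theorem hasLead_C (ha : NonAlg a) (c : ℂ) : HasLead a (RatFunc.C c) c := by
  refine ⟨PowerSeries.C c, ?_, by simp⟩
  rw [expand_eq ha, expandHom_C, HahnSeries.ofPowerSeries_C]

theorem hasLead_one (ha : NonAlg a) : HasLead a 1 1 := by
  simpa using hasLead_C ha 1

theorem HasLead.prod (ha : NonAlg a) {ι : Type*} (s : Finset ι) {F : ι → RatFunc ℂ} {v : ι → ℂ}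
    (h : ∀ b ∈ s, HasLead a (F b) (v b)) : HasLead a (∏ b ∈ s, F b) (∏ b ∈ s, v b) := by
  classical
  induction s using Finset.induction_on with
  | empty => simpa using hasLead_one ha
  | insert b s hb ih =>
    rw [Finset.prod_insert hb, Finset.prod_insert hb]
    exact (h b (by simp)).mul ha (ih fun x hx => h x (by simp [hx]))

end lead

theorem hasLead_infty_div {α β γ δ : ℂ} (hγ : γ ≠ 0) :
    HasLead (HahnSeries.single (-1) 1)
      ((RatFunc.C α * RatFunc.X - RatFunc.C β) / (RatFunc.C γ * RatFunc.X - RatFunc.C δ))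
      (α / γ) := by
  have key : ∀ α β : ℂ, HasLead (HahnSeries.single (-1) 1)
      ((RatFunc.C α * RatFunc.X - RatFunc.C β) / RatFunc.X) α := by
    intro α β
    refine ⟨PowerSeries.C α - PowerSeries.C β * PowerSeries.X, ?_, by simp⟩
    rw [expand_eq nonAlg_infty, map_div₀, map_sub, map_mul, expandHom_X, expandHom_C, expandHom_C,
      div_eq_iff (by simp), map_sub, map_mul, HahnSeries.ofPowerSeries_X,
      HahnSeries.ofPowerSeries_C, HahnSeries.ofPowerSeries_C, sub_mul, mul_assoc,
      HahnSeries.single_mul_single]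
    simp
  have h := (key α β).div nonAlg_infty (key γ δ) hγ
  rwa [div_div_div_cancel_right₀ RatFunc.X_ne_zero] at h

theorem hasLead_X_sub (p a : ℂ) :
    HasLead (HahnSeries.C p + HahnSeries.single 1 1) (RatFunc.X - RatFunc.C a) (p - a) := by
  refine ⟨PowerSeries.C (p - a) + PowerSeries.X, ?_, by simp⟩
  rw [expand_eq (nonAlg_point p), map_sub, expandHom_X, expandHom_C]
  simp [HahnSeries.ofPowerSeries_X, HahnSeries.ofPowerSeries_C]
  ring

theorem hasLead_lin (p α β : ℂ) :
    HasLead (HahnSeries.C p + HahnSeries.single 1 1) (RatFunc.C α * RatFunc.X - RatFunc.C β)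
      (α * p - β) := by
  refine ⟨PowerSeries.C (α * p - β) + PowerSeries.C α * PowerSeries.X, ?_, by simp⟩
  rw [expand_eq (nonAlg_point p), map_sub, map_mul, expandHom_X, expandHom_C, expandHom_C,
    map_add, map_mul, HahnSeries.ofPowerSeries_X, HahnSeries.ofPowerSeries_C,
    HahnSeries.ofPowerSeries_C, map_sub, map_mul]
  ring

theorem hasLead_zero_div {α β γ δ : ℂ} (hδ : δ ≠ 0) :
    HasLead (HahnSeries.single 1 1)
      ((RatFunc.C α * RatFunc.X - RatFunc.C β) / (RatFunc.C γ * RatFunc.X - RatFunc.C δ))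
      (β / δ) := by
  have h := (hasLead_lin 0 α β).div (nonAlg_point 0) (hasLead_lin 0 γ δ) (by simpa using hδ)
  simpa using h

theorem hasLead_poly (p : ℂ) (P : Polynomial ℂ) :
    HasLead (HahnSeries.C p + HahnSeries.single 1 1) (algebraMap _ _ P) (P.eval p) := by
  induction P using Polynomial.induction_on' with
  | add P Q hP hQ =>
    obtain ⟨s, hs, hs'⟩ := hP
    obtain ⟨t, ht, ht'⟩ := hQ
    refine ⟨s + t, ?_, by simp [hs', ht']⟩
    rw [expand_eq (nonAlg_point p)] at *
    rw [map_add, map_add, map_add, hs, ht]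
  | monomial n c =>
    rw [← Polynomial.C_mul_X_pow_eq_monomial, map_mul, map_pow, RatFunc.algebraMap_C,
      RatFunc.algebraMap_X]
    have hX : HasLead (HahnSeries.C p + HahnSeries.single 1 1) RatFunc.X p := by
      simpa using hasLead_X_sub p 0
    have := HasLead.prod (nonAlg_point p) (Finset.range n) (F := fun _ => RatFunc.X)
      (v := fun _ => p) (fun _ _ => hX)
    simpa using (hasLead_C (nonAlg_point p) c).mul (nonAlg_point p) this

theorem value_eq {p : ℂ} {f : RatFunc ℂ} {v : ℂ}
    (h : HasLead (HahnSeries.C p + HahnSeries.single 1 1) f v) : value p f = v := by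
  have h1 := h.mul (nonAlg_point p) (hasLead_poly p f.denom)
  have h2 : f * algebraMap _ _ f.denom = algebraMap _ _ f.num := by
    exact (eq_div_iff (by simpa using f.denom_ne_zero)).1 f.num_div_denom.symm
  rw [h2] at h1
  have h3 := h1.unique (hasLead_poly p f.num)
  -- Regularity at `p` excludes a zero of the denominator: it would be a zero of the numerator too,
  -- against coprimality.
  have hd : f.denom.eval p ≠ 0 := by
    intro h0
    rw [h0, mul_zero] at h3
    obtain ⟨A, B, hAB⟩ := f.isCoprime_num_denom
    have := congrArg (Polynomial.eval p) hAB
    simp [h0, ← h3] at this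
  simp only [value, RatFunc.eval, Polynomial.eval₂_id]
  rw [← h3, mul_div_cancel_right₀ _ hd]

/-- With `z = p + u`, the series `f(z)/z` times `u` is a power series with constant term `v / p`,
and that term is the coefficient of `u⁻¹` before multiplying. -/
theorem resLog_eq {p : ℂ} (hp : p ≠ 0) {f : RatFunc ℂ} {v : ℂ}
    (h : HasLead (HahnSeries.C p + HahnSeries.single 1 1) (f * (RatFunc.X - RatFunc.C p)) v) :
    resLog p f = v / p := by
  have hX : HasLead (HahnSeries.C p + HahnSeries.single 1 1) RatFunc.X p := by
    simpa using hasLead_X_sub p 0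
  obtain ⟨s, hs, hs'⟩ := h.div (nonAlg_point p) hX hp
  rw [← hs']
  rw [expand_eq (nonAlg_point p)] at hs
  rw [resLog, expand_eq (nonAlg_point p)]
  have h1 : expandHom _ (nonAlg_point p) (f / RatFunc.X) * HahnSeries.single 1 1 =
      HahnSeries.ofPowerSeries ℤ ℂ s := by
    rw [← hs, mul_div_right_comm, map_mul, map_sub, expandHom_X, expandHom_C]
    simp
  have h2 := congrArg (fun x => HahnSeries.coeff x 0) h1
  have h3 := HahnSeries.coeff_mul_single_add (r := (1:ℂ))
      (x := expandHom _ (nonAlg_point p) (f / RatFunc.X)) (a := -1) (b := 1)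
  simp only [neg_add_cancel, mul_one] at h3
  rw [← h3]
  refine h2.trans ?_
  have := HahnSeries.ofPowerSeries_apply_coeff (Γ := ℤ) s 0
  simpa using this

theorem expansionCoeff_plus_of_hasLead {f : RatFunc ℂ} {c : ℂ}
    (h : HasLead (HahnSeries.single (-1) 1) f c) :
    expansionCoeff PM.plus f 0 = c ∧ ∀ k < 0, expansionCoeff PM.plus f k = 0 := by
  obtain ⟨s, hs, rfl⟩ := h
  simp only [expansionCoeff, hs, PowerSeries.coeff_coe]
  exact ⟨by simp, fun k hk => if_pos (by omega)⟩

theorem expansionCoeff_minus_of_hasLead {f : RatFunc ℂ} {c : ℂ}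
    (h : HasLead (HahnSeries.single 1 1) f c) :
    expansionCoeff PM.minus f 0 = c ∧ ∀ k > 0, expansionCoeff PM.minus f k = 0 := by
  obtain ⟨s, hs, rfl⟩ := h
  simp only [expansionCoeff, hs, PowerSeries.coeff_coe]
  exact ⟨by simp, fun k hk => if_pos (by omega)⟩

theorem HasLead.add {a : LaurentSeries ℂ} {f g : RatFunc ℂ} {c c' : ℂ} (ha : NonAlg a)
    (h : HasLead a f c) (h' : HasLead a g c') : HasLead a (f + g) (c + c') := by
  obtain ⟨s, hs, rfl⟩ := h
  obtain ⟨t, ht, rfl⟩ := h'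
  refine ⟨s + t, ?_, by simp⟩
  rw [expand_eq ha] at *
  rw [map_add, map_add, hs, ht]

theorem HasLead.sum {a : LaurentSeries ℂ} (ha : NonAlg a) {ι : Type*} (s : Finset ι)
    {F : ι → RatFunc ℂ} {v : ι → ℂ} (h : ∀ b ∈ s, HasLead a (F b) (v b)) :
    HasLead a (∑ b ∈ s, F b) (∑ b ∈ s, v b) := by
  classical
  induction s using Finset.induction_on with
  | empty => simpa using hasLead_C ha 0
  | insert b s hb ih =>
    rw [Finset.sum_insert hb, Finset.sum_insert hb]
    exact (h b (by simp)).add ha (ih fun x hx => h x (by simp [hx]))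

/-! ### Partial fractions and delta functions -/

theorem expansionCoeff_C (e : PM) (c : ℂ) (k : ℤ) :
    expansionCoeff e (RatFunc.C c) k = if k = 0 then c else 0 := by
  cases e
  · simp [expansionCoeff, expand_eq nonAlg_infty, expandHom_C, HahnSeries.coeff_single]
  · simp [expansionCoeff, expand_eq nonAlg_zero, expandHom_C, HahnSeries.coeff_single]

theorem expansionCoeff_sum {ι : Type*} (e : PM) (s : Finset ι) (F : ι → RatFunc ℂ) (k : ℤ) :
    expansionCoeff e (∑ b ∈ s, F b) k = ∑ b ∈ s, expansionCoeff e (F b) k := by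
  classical
  induction s using Finset.induction_on with
  | empty => simpa using expansionCoeff_C e 0 k
  | insert b s hb ih => rw [Finset.sum_insert hb, Finset.sum_insert hb, expansionCoeff_add, ih]

theorem expansionCoeff_plus_inv (p : ℂ) :
    expansionCoeff PM.plus (RatFunc.X - RatFunc.C p)⁻¹ 0 = 0 := by
  have h := hasLead_infty_div (α := 0) (β := -1) (γ := 1) (δ := p) one_ne_zero
  have := (expansionCoeff_plus_of_hasLead h).1
  simpa using this

theorem expansionCoeff_minus_inv {p : ℂ} (hp : p ≠ 0) :
    expansionCoeff PM.minus (RatFunc.X - RatFunc.C p)⁻¹ 1 = 0 := by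
  have h := hasLead_zero_div (α := 0) (β := -1) (γ := 1) (δ := p) hp
  have := (expansionCoeff_minus_of_hasLead h).2 1 one_pos
  simpa using this

theorem X_sub_C_ne_zero (p : ℂ) : (RatFunc.X - RatFunc.C p : RatFunc ℂ) ≠ 0 := by
  have := Polynomial.X_sub_C_ne_zero p
  rw [← RatFunc.algebraMap_X, ← RatFunc.algebraMap_C, ← map_sub]
  exact RatFunc.algebraMap_ne_zero this

theorem expansionCoeff_inv_succ (e : PM) (p : ℂ) (k : ℤ) :
    expansionCoeff e (RatFunc.X - RatFunc.C p)⁻¹ (k + 1) =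
      p * expansionCoeff e (RatFunc.X - RatFunc.C p)⁻¹ k + if k = 0 then 1 else 0 := by
  rw [← expansionCoeff_X_mul, ← expansionCoeff_C_mul, ← expansionCoeff_C, ← expansionCoeff_add]
  congr 1
  field_simp [X_sub_C_ne_zero p]
  simp

/-- Both expansions of `1/(z - p)` satisfy the same inhomogeneous recursion, so their difference is
geometric with ratio `p`. It is normalized at `k = 1`, where the expansion at zero does not
contribute. The result is the delta function `p⁻¹ δ(z/p)`. -/
theorem expansionCoeff_inv_sub {p : ℂ} (hp : p ≠ 0) (k : ℤ) :
    expansionCoeff PM.plus (RatFunc.X - RatFunc.C p)⁻¹ k -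
      expansionCoeff PM.minus (RatFunc.X - RatFunc.C p)⁻¹ k = p ^ (k - 1) := by
  set D : ℤ → ℂ := fun k => expansionCoeff PM.plus (RatFunc.X - RatFunc.C p)⁻¹ k -
      expansionCoeff PM.minus (RatFunc.X - RatFunc.C p)⁻¹ k with hD
  have hs : ∀ k, D (k + 1) = p * D k := by
    intro k
    simp only [hD, expansionCoeff_inv_succ]
    ring
  have h1 : D 1 = 1 := by
    simp only [hD]
    rw [expansionCoeff_minus_inv hp, ← zero_add (1 : ℤ), expansionCoeff_inv_succ,
      expansionCoeff_plus_inv]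
    simp
  change D k = _
  induction k using Int.inductionOn' (b := 1) with
  | zero => simpa using h1
  | succ k _ ih => rw [hs, ih, ← zpow_one_add₀ hp]; congr 1; ring
  | pred k _ ih =>
    have := hs (k - 1)
    rw [sub_add_cancel, ih, ← mul_right_inj' (inv_ne_zero hp), inv_mul_cancel_left₀ hp] at this
    rw [← this, ← zpow_neg_one, ← zpow_add₀ hp]; congr 1; ring

/-- The difference of the two expansions of a sum of simple fractions. -/
theorem expansionCoeff_sub_eq_sum_resLog {ι : Type*} (S : Finset ι) (P : ι → ℂ)
    (hP : ∀ b ∈ S, P b ≠ 0) (hinj : Set.InjOn P S) (c : ℂ) (r : ι → ℂ) {f : RatFunc ℂ}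
    (hf : f = RatFunc.C c + ∑ b ∈ S, RatFunc.C (r b) * (RatFunc.X - RatFunc.C (P b))⁻¹) (n : ℤ) :
    expansionCoeff PM.plus f n - expansionCoeff PM.minus f n =
      ∑ b ∈ S, resLog (P b) f * P b ^ n := by
  classical
  have hres : ∀ b ∈ S, resLog (P b) f = r b / P b := by
    intro b hb
    apply resLog_eq (hP b hb)
    have h0 := nonAlg_point (P b)
    -- The other poles differ from `P b` by injectivity, so the remaining fractions are regular
    -- there and do not affect the residue.
    have hrest : HasLead (HahnSeries.C (P b) + HahnSeries.single 1 1)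
        (RatFunc.C c + ∑ b' ∈ S.erase b, RatFunc.C (r b') * (RatFunc.X - RatFunc.C (P b'))⁻¹)
        (c + ∑ b' ∈ S.erase b, r b' * (P b - P b')⁻¹) := by
      refine (hasLead_C h0 c).add h0 (HasLead.sum h0 _ fun b' hb' => ?_)
      rw [Finset.mem_erase] at hb'
      refine (hasLead_C h0 _).mul h0 ((hasLead_X_sub _ _).inv h0 ?_)
      exact sub_ne_zero.2 fun h => hb'.1 (hinj hb'.2 hb h.symm)
    have h1 := (hasLead_C h0 (r b)).add h0 (hrest.mul h0 (hasLead_X_sub (P b) (P b)))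
    rw [sub_self, mul_zero, add_zero] at h1
    convert h1 using 1
    rw [hf, ← Finset.add_sum_erase S _ hb]
    have := X_sub_C_ne_zero (P b)
    field_simp
    ring
  rw [Finset.sum_congr rfl fun b hb => by rw [hres b hb], hf]
  simp only [expansionCoeff_add, expansionCoeff_sum, expansionCoeff_C, expansionCoeff_C_mul]
  rw [add_sub_add_left_eq_sub, ← Finset.sum_sub_distrib]
  refine Finset.sum_congr rfl fun b hb => ?_
  rw [← mul_sub, expansionCoeff_inv_sub (hP b hb), zpow_sub_one₀ (hP b hb)]
  ring

theorem expansionCoeff_plus_polynomial (N : Polynomial ℂ) (n : ℕ) :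
    expansionCoeff PM.plus (algebraMap _ _ N) (-n) = N.coeff n := by
  have hX : ∀ (m : ℕ) (f : RatFunc ℂ) (k : ℤ),
      expansionCoeff PM.plus (RatFunc.X ^ m * f) k = expansionCoeff PM.plus f (k + m) := by
    intro m
    induction m with
    | zero => simp
    | succ m ih =>
      intro f k
      rw [pow_succ, mul_assoc, ih, expansionCoeff_X_mul]
      push_cast
      ring_nf
  induction N using Polynomial.induction_on' with
  | add P Q hP hQ => rw [map_add, expansionCoeff_add, hP, hQ, Polynomial.coeff_add]
  | monomial m c =>
    rw [← Polynomial.C_mul_X_pow_eq_monomial, map_mul, map_pow, RatFunc.algebraMap_C,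
      RatFunc.algebraMap_X, mul_comm, hX, expansionCoeff_C, Polynomial.coeff_C_mul_X_pow]
    congr 1
    simp only [eq_iff_iff]
    omega

/-- A rational function with simple poles which is bounded at infinity is a sum of simple
fractions. -/
theorem exists_partialFractions {ι : Type*} [DecidableEq ι] (S : Finset ι) (P : ι → ℂ)
    (hinj : Set.InjOn P S) {f : RatFunc ℂ} {N : Polynomial ℂ}
    (hN : f * ∏ b ∈ S, (RatFunc.X - RatFunc.C (P b)) = algebraMap _ _ N) {c₀ : ℂ}
    (hlead : HasLead (HahnSeries.single (-1) 1) f c₀) :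
    ∃ (c : ℂ) (r : ι → ℂ),
      f = RatFunc.C c + ∑ b ∈ S, RatFunc.C (r b) * (RatFunc.X - RatFunc.C (P b))⁻¹ := by
  obtain ⟨Q, R, hR, h⟩ := Polynomial.div_prod_eq_quo_add_sum_rem_div (K := RatFunc ℂ) N
    (g := fun b => Polynomial.X - Polynomial.C (P b)) (s := S)
    (fun b _ => Polynomial.monic_X_sub_C _)
    (fun a ha b hb hab => Polynomial.isCoprime_X_sub_C_of_isUnit_sub
      (sub_ne_zero.2 fun h => hab (hinj ha hb h)).isUnit)
  have hRC : ∀ b ∈ S, R b = Polynomial.C ((R b).coeff 0) := by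
    intro b hb
    apply Polynomial.eq_C_of_degree_le_zero
    have := hR b hb
    rw [Polynomial.degree_X_sub_C] at this
    exact Order.le_of_lt_succ this
  have hf : f = algebraMap _ _ Q +
      ∑ b ∈ S, RatFunc.C ((R b).coeff 0) * (RatFunc.X - RatFunc.C (P b))⁻¹ := by
    have h0 : ∏ b ∈ S, (RatFunc.X - RatFunc.C (P b) : RatFunc ℂ) ≠ 0 :=
      Finset.prod_ne_zero_iff.2 fun b _ => X_sub_C_ne_zero _
    rw [(eq_div_iff h0).2 hN]
    have h1 : algebraMap (Polynomial ℂ) (RatFunc ℂ) N / ∏ b ∈ S, (RatFunc.X - RatFunc.C (P b)) =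
      algebraMap (Polynomial ℂ) (RatFunc ℂ) Q + ∑ b ∈ S, algebraMap _ _ (R b) /
        (RatFunc.X - RatFunc.C (P b)) := by
      simpa using h
    rw [h1]
    congr 1
    refine Finset.sum_congr rfl fun b hb => ?_
    rw [div_eq_mul_inv]
    congr 1
    rw [hRC b hb]
    simp
  refine ⟨Q.coeff 0, fun b => (R b).coeff 0, ?_⟩
  rw [hf]
  congr 1
  -- A positive power of `z` in the polynomial part would survive in the expansion at infinity,
  -- which is a power series in `z⁻¹`.
  have hQ : Q = Polynomial.C (Q.coeff 0) := by
    ext n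
    rcases Nat.eq_zero_or_pos n with rfl | hn
    · simp
    rw [Polynomial.coeff_C, if_neg hn.ne']
    have h2 := (expansionCoeff_plus_of_hasLead hlead).2 (-n) (by omega)
    rw [hf, expansionCoeff_add, expansionCoeff_plus_polynomial, expansionCoeff_sum] at h2
    rw [Finset.sum_eq_zero, add_zero] at h2
    · exact h2
    intro b _
    rw [expansionCoeff_C_mul]
    have h3 := hasLead_infty_div (α := 0) (β := -1) (γ := 1) (δ := P b) one_ne_zero
    have := (expansionCoeff_plus_of_hasLead h3).2 (-n) (by omega)
    simp only [map_zero, zero_mul, map_neg, map_one, sub_neg_eq_add, zero_add, one_mul,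
      one_div] at this
    rw [this, mul_zero]
  rw [hQ, RatFunc.algebraMap_C]
  simp

/-! ### Exponentials and logarithms of series -/

theorem expCoeff_map {A B : Type*} [Ring A] [Algebra ℂ A] [Ring B] [Algebra ℂ B] (φ : A →ₐ[ℂ] B)
    (h : ℕ → A) (n : ℕ) : φ (expCoeff h n) = expCoeff (fun r => φ (h r)) n := by
  simp only [expCoeff, map_sum, map_smul]
  refine Finset.sum_congr rfl fun m _ => ?_
  congr 1
  have h1 := PowerSeries.coeff_map (φ : A →+* B) n
    ((PowerSeries.mk fun r => if r = 0 then 0 else h r) ^ m)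
  have h2 : PowerSeries.map (φ : A →+* B) (PowerSeries.mk fun r => if r = 0 then 0 else h r) =
      PowerSeries.mk fun r => if r = 0 then 0 else φ (h r) := by
    ext r
    simp [apply_ite φ]
  rw [map_pow, h2] at h1
  exact h1.symm

theorem expCoeff_zero {A : Type*} [Ring A] [Algebra ℂ A] (h : ℕ → A) : expCoeff h 0 = 1 := by
  simp [expCoeff]

/-- The part of `expCoeff h n` which does not involve `h n`. -/
def expTail (h : ℕ → ℂ) (n : ℕ) : ℂ :=
  ∑ m ∈ (Finset.range (n + 1)).erase 1, ((m.factorial : ℂ)⁻¹) •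
    PowerSeries.coeff n ((PowerSeries.mk fun r => if r = 0 then 0 else h r) ^ m)

theorem expCoeff_eq_add_expTail (h : ℕ → ℂ) {n : ℕ} (hn : n ≠ 0) :
    expCoeff h n = h n + expTail h n := by
  rw [expCoeff, expTail, ← Finset.add_sum_erase _ _ (a := 1) (by simp; omega)]
  simp [hn]

/-- The exponential is triangular: as `h(u)` is divisible by `u`, the coefficient of `u^n` in a
power `h(u)^m` with `m ≥ 2` involves only `h k` with `k < n`. Therefore the logarithm can be solved
for recursively. -/
theorem expTail_congr {h h' : ℕ → ℂ} {n : ℕ} (hh : ∀ k < n, h k = h' k) :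
    expTail h n = expTail h' n := by
  refine Finset.sum_congr rfl fun m hm => ?_
  congr 1
  rw [Finset.mem_erase] at hm
  rcases m with _ | _ | m
  · simp
  · exact absurd rfl hm.1
  set a : PowerSeries ℂ := PowerSeries.mk fun r => if r = 0 then 0 else h r
  set b : PowerSeries ℂ := PowerSeries.mk fun r => if r = 0 then 0 else h' r
  have ha : PowerSeries.X ∣ a := by rw [PowerSeries.X_dvd_iff]; simp [a]
  have hb : PowerSeries.X ∣ b := by rw [PowerSeries.X_dvd_iff]; simp [b]
  have hab : PowerSeries.X ^ n ∣ a - b := by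
    rw [PowerSeries.X_pow_dvd_iff]
    intro k hk
    simp [a, b, hh k hk]
  -- In the geometric factorization the factor `a - b` supplies `n` powers of the variable, and
  -- every term of the cofactor supplies one more.
  have h1 : PowerSeries.X ^ (n + 1) ∣ a ^ (m + 2) - b ^ (m + 2) := by
    rw [← Commute.geom_sum₂_mul (Commute.all a b), pow_succ']
    refine mul_dvd_mul (Finset.dvd_sum fun i _ => ?_) hab
    rcases i with _ | i
    · exact Dvd.dvd.mul_left (dvd_pow hb (by omega)) _
    · exact Dvd.dvd.mul_right (dvd_pow ha (by omega)) _
  have h2 := PowerSeries.X_pow_dvd_iff.1 h1 n (Nat.lt_succ_self n)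
  rw [map_sub] at h2
  exact sub_eq_zero.1 h2

/-- The logarithm of the series `∑ g n u ^ n`. -/
def logSeq (g : ℕ → ℂ) (n : ℕ) : ℂ :=
  g n - expTail (fun k => if _ : k < n then logSeq g k else 0) n
termination_by n

theorem expCoeff_logSeq (g : ℕ → ℂ) (hg : g 0 = 1) (n : ℕ) : expCoeff (logSeq g) n = g n := by
  rcases eq_or_ne n 0 with rfl | hn
  · rw [expCoeff_zero, hg]
  rw [expCoeff_eq_add_expTail _ hn]
  conv_lhs => rw [logSeq]
  rw [expTail_congr (h' := logSeq g) (fun k hk => by simp [hk]), sub_add_cancel]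

/-! ### Generic parameters and the lattice of positions -/

/-- The parameters `q, d` are nonzero and generic. -/
structure Generic (q d : ℂ) : Prop where
  q_ne : q ≠ 0
  d_ne : d ≠ 0
  eq_one : ∀ m n : ℤ, q ^ m * d ^ n = 1 → m = 0 ∧ n = 0

/-- The position of a point of the lattice `ℤ × ℤ` which contains the boxes. -/
def lpos (q d : ℂ) (n : ℤ × ℤ) : ℂ := q1 q d ^ (-n.2) * q3 q d ^ (-n.1)

/-- A box as a point of the lattice. -/
def toLat (b : Box) : ℤ × ℤ := (b.1, b.2)

theorem toLat_injective : Function.Injective toLat := by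
  rintro ⟨a, b⟩ ⟨c, e⟩ h
  simpa [toLat] using h

theorem pos_eq_lpos (q d : ℂ) (b : Box) : pos q d b = lpos q d (toLat b) := rfl

section generic

variable {q d : ℂ}

theorem Generic.q1_ne (h : Generic q d) : q1 q d ≠ 0 := mul_ne_zero (inv_ne_zero h.q_ne) h.d_ne

theorem Generic.q2_ne (h : Generic q d) : q2 q ≠ 0 := pow_ne_zero _ h.q_ne

theorem Generic.q3_ne (h : Generic q d) : q3 q d ≠ 0 :=
  mul_ne_zero (inv_ne_zero h.q_ne) (inv_ne_zero h.d_ne)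

theorem Generic.q1_mul_q3 (h : Generic q d) : q1 q d * q3 q d = (q2 q)⁻¹ := by
  have := h.q_ne
  have := h.d_ne
  simp only [q1, q2, q3]
  field_simp

theorem Generic.q2_ne_one (h : Generic q d) : q2 q ≠ 1 := by
  intro h1
  have := (h.eq_one 2 0 (by simpa [q2] using h1)).1
  omega

theorem Generic.q_sub_inv_ne (h : Generic q d) : q - q⁻¹ ≠ 0 := by
  intro h1
  apply h.q2_ne_one
  have := h.q_ne
  field_simp at h1
  rw [q2]
  linear_combination h1

theorem Generic.lpos_ne (h : Generic q d) (n : ℤ × ℤ) : lpos q d n ≠ 0 :=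
  mul_ne_zero (zpow_ne_zero _ h.q1_ne) (zpow_ne_zero _ h.q3_ne)

theorem Generic.pos_ne (h : Generic q d) (b : Box) : pos q d b ≠ 0 := h.lpos_ne (toLat b)

/-- The exponents of `q` and `d` are the sum and the difference of the coordinates; by genericity
the position determines both. -/
theorem Generic.lpos_injective (h : Generic q d) : Function.Injective (lpos q d) := by
  have key : ∀ n : ℤ × ℤ, lpos q d n = q ^ (n.1 + n.2) * d ^ (n.1 - n.2) := by
    intro n
    have := h.q_ne
    have := h.d_ne
    simp only [lpos, q1, q3, mul_zpow, inv_zpow', neg_neg]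
    rw [zpow_add₀ h.q_ne, sub_eq_add_neg, zpow_add₀ h.d_ne]
    ring
  intro n m hnm
  rw [key, key] at hnm
  have h1 : q ^ (n.1 + n.2 - (m.1 + m.2)) * d ^ (n.1 - n.2 - (m.1 - m.2)) = 1 := by
    rw [zpow_sub₀ h.q_ne, zpow_sub₀ h.d_ne, div_mul_div_comm, hnm]
    exact div_self (mul_ne_zero (zpow_ne_zero _ h.q_ne) (zpow_ne_zero _ h.d_ne))
  have := h.eq_one _ _ h1
  ext <;> omega

theorem Generic.pos_injective (h : Generic q d) : Function.Injective (pos q d) :=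
  h.lpos_injective.comp toLat_injective

theorem Generic.q1_mul_lpos (h : Generic q d) (n : ℤ × ℤ) :
    q1 q d * lpos q d n = lpos q d (n.1, n.2 - 1) := by
  simp only [lpos]
  rw [neg_sub, sub_eq_add_neg, zpow_add₀ h.q1_ne, zpow_one]
  ring

theorem Generic.q3_mul_lpos (h : Generic q d) (n : ℤ × ℤ) :
    q3 q d * lpos q d n = lpos q d (n.1 - 1, n.2) := by
  simp only [lpos]
  rw [neg_sub, sub_eq_add_neg, zpow_add₀ h.q3_ne, zpow_one]
  ring

theorem Generic.q2_mul_lpos (h : Generic q d) (n : ℤ × ℤ) :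
    q2 q * lpos q d n = lpos q d (n.1 + 1, n.2 + 1) := by
  have h1 := h.q1_mul_lpos (n.1 + 1, n.2 + 1)
  have h3 := h.q3_mul_lpos (n.1 + 1, n.2)
  simp only [add_sub_cancel_right] at h1 h3
  rw [← h3, ← h1]
  have := h.q1_mul_q3
  have h2 := h.q2_ne
  field_simp at this
  linear_combination lpos q d (n.1 + 1, n.2 + 1) * this

theorem color_eq_iff (b b' : Box) :
    color b = color b' ↔ (b.1 + b.2) % 2 = (b'.1 + b'.2) % 2 := by
  rw [color, color, ZMod.natCast_eq_natCast_iff']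
  omega

/-- `g_{i,j}(z,w)` at the positions of two boxes with colors `i` and `j`. -/
def gBox (q d : ℂ) (b b' : Box) : ℂ :=
  if color b = color b' then pos q d b - q2 q * pos q d b'
  else (pos q d b - q1 q d * pos q d b') * (pos q d b - q3 q d * pos q d b')

/-- `(-1)^{i+j+1}` for the colors `i, j` of two boxes. -/
def sgn (b b' : Box) : ℂ := if color b = color b' then -1 else 1

theorem sgn_comm (b b' : Box) : sgn b b' = sgn b' b := by
  simp only [sgn, eq_comm]

theorem sgn_mul_self (b b' : Box) : sgn b b' * sgn b b' = 1 := by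
  unfold sgn
  split_ifs <;> simp

/-- Multiplication by `q1`, `q2`, `q3` is a lattice translation, so each linear factor vanishes at
one relative position. Parity selects the diagonal neighbor for equal colors and the two adjacent
boxes for different ones. -/
theorem gBox_eq_zero_iff (h : Generic q d) (b b' : Box) : gBox q d b b' = 0 ↔
    (b.1 = b'.1 + 1 ∧ b.2 = b'.2 + 1) ∨ (b.1 = b'.1 ∧ b.2 + 1 = b'.2) ∨
      (b.1 + 1 = b'.1 ∧ b.2 = b'.2) := by
  have hc := color_eq_iff b b'
  unfold gBox
  rw [pos_eq_lpos, pos_eq_lpos, h.q1_mul_lpos, h.q2_mul_lpos, h.q3_mul_lpos]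
  split_ifs with h0
  · rw [sub_eq_zero, h.lpos_injective.eq_iff]
    rw [hc] at h0
    simp only [toLat, Prod.ext_iff]
    omega
  · rw [mul_eq_zero, sub_eq_zero, sub_eq_zero, h.lpos_injective.eq_iff, h.lpos_injective.eq_iff]
    rw [hc] at h0
    simp only [toLat, Prod.ext_iff]
    omega

/-- The value of `A_{b}^{-1}` at the position of `b'`. -/
def eta (q d : ℂ) (b b' : Box) : ℂ := sgn b b' * gBox q d b' b / gBox q d b b'

theorem eta_mul_eta {b b' : Box} (h : gBox q d b b' ≠ 0) (h' : gBox q d b' b ≠ 0) :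
    eta q d b b' * eta q d b' b = 1 := by
  have := sgn_mul_self b b'
  rw [eta, eta, sgn_comm b' b]
  field_simp
  linear_combination this

theorem eta_ne_zero {b b' : Box} (h : gBox q d b b' ≠ 0) (h' : gBox q d b' b ≠ 0) :
    eta q d b b' ≠ 0 := left_ne_zero_of_mul_eq_one (eta_mul_eta h h')

theorem hasLead_affineRoot_inv {b b' : Box} (h : gBox q d b b' ≠ 0) :
    HasLead (HahnSeries.C (pos q d b') + HahnSeries.single 1 1)
      (affineRoot q d (color b) (pos q d b) (color b'))⁻¹ (eta q d b b') := by
  have hp := nonAlg_point (pos q d b')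
  unfold affineRoot eta sgn
  unfold gBox at h ⊢
  by_cases h0 : color b = color b'
  · rw [if_pos h0.symm, inv_div, if_pos h0, if_pos h0.symm, if_pos h0]
    rw [if_pos h0] at h
    have := (hasLead_X_sub (pos q d b') (q2 q * pos q d b)).div hp
      (hasLead_lin (pos q d b') (q2 q) (pos q d b)) (by contrapose! h; linear_combination -h)
    convert this using 1
    rw [← neg_sub (pos q d b), div_neg, neg_one_mul, neg_div]
  · rw [if_neg (Ne.symm h0), inv_div, if_neg h0, if_neg (Ne.symm h0), if_neg h0]
    rw [if_neg h0, mul_ne_zero_iff] at h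
    have := ((hasLead_X_sub (pos q d b') (q1 q d * pos q d b)).mul hp
      (hasLead_X_sub (pos q d b') (q3 q d * pos q d b))).div hp
      ((hasLead_lin (pos q d b') (q1 q d) (pos q d b)).mul hp
        (hasLead_lin (pos q d b') (q3 q d) (pos q d b))) (mul_ne_zero
          (by have := h.1; contrapose! this; linear_combination -this)
          (by have := h.2; contrapose! this; linear_combination -this))
    convert this using 1
    rw [one_mul]
    congr 1
    ring

end generic

/-! ### Corners of Young diagrams -/

/-- The box `b` can be added to `lam`. -/
def Addable (lam : YoungDiagram) (b : Box) : Prop :=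
  b ∉ lam.cells ∧ ∃ mu : YoungDiagram, mu.cells = insert b lam.cells

/-- The box `b` can be removed from `lam`. -/
def Removable (lam : YoungDiagram) (b : Box) : Prop :=
  b ∈ lam.cells ∧ ∃ mu : YoungDiagram, mu.cells = lam.cells.erase b

theorem mem_concaveBoxes {i : ZMod 2} {lam : YoungDiagram} {b : Box} :
    b ∈ concaveBoxes i lam ↔ color b = i ∧ Addable lam b := by
  simp [concaveBoxes, concaveSet, Addable]

theorem mem_convexBoxes {i : ZMod 2} {lam : YoungDiagram} {b : Box} :
    b ∈ convexBoxes i lam ↔ color b = i ∧ Removable lam b := by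
  simp [convexBoxes, convexSet, Removable]

theorem Addable.cells {lam : YoungDiagram} {b : Box} (h : Addable lam b) :
    (addBox lam b).cells = insert b lam.cells := by
  rw [addBox, dif_pos h.2]
  exact h.2.choose_spec

theorem Removable.cells {lam : YoungDiagram} {b : Box} (h : Removable lam b) :
    (removeBox lam b).cells = lam.cells.erase b := by
  rw [removeBox, dif_pos h.2]
  exact h.2.choose_spec

theorem Addable.removable {lam : YoungDiagram} {b : Box} (h : Addable lam b) :
    Removable (addBox lam b) b :=
  ⟨by simp [h.cells], lam, by rw [h.cells, Finset.erase_insert h.1]⟩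

theorem Removable.addable {lam : YoungDiagram} {b : Box} (h : Removable lam b) :
    Addable (removeBox lam b) b :=
  ⟨by simp [h.cells], lam, by rw [h.cells, Finset.insert_erase h.1]⟩

theorem Addable.removeBox_addBox {lam : YoungDiagram} {b : Box} (h : Addable lam b) :
    removeBox (addBox lam b) b = lam := by
  ext1
  rw [h.removable.cells, h.cells, Finset.erase_insert h.1]

theorem Removable.addBox_removeBox {lam : YoungDiagram} {b : Box} (h : Removable lam b) :
    addBox (removeBox lam b) b = lam := by
  ext1
  rw [h.addable.cells, h.cells, Finset.insert_erase h.1]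

theorem addable_iff {lam : YoungDiagram} {b : Box} : Addable lam b ↔
    b ∉ lam.cells ∧ (∀ z, b.1 = z + 1 → (z, b.2) ∈ lam.cells) ∧
      (∀ x, b.2 = x + 1 → (b.1, x) ∈ lam.cells) := by
  constructor
  · rintro ⟨h, mu, hmu⟩
    have hb : b ∈ mu.cells := by simp [hmu]
    have key : ∀ c : Box, c ≤ b → c ≠ b → c ∈ lam.cells := by
      intro c hc hne
      have : c ∈ mu.cells := mu.isLowerSet hc hb
      rw [hmu, Finset.mem_insert] at this
      exact this.resolve_left hne
    refine ⟨h, fun z hz => key _ ?_ ?_, fun x hx => key _ ?_ ?_⟩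
    · exact ⟨by dsimp; omega, le_rfl⟩
    · intro h'; rw [← h'] at hz; simp at hz
    · exact ⟨le_rfl, by dsimp; omega⟩
    · intro h'; rw [← h'] at hx; simp at hx
  · rintro ⟨h, h1, h2⟩
    refine ⟨h, ⟨insert b lam.cells, ?_⟩, rfl⟩
    intro c c' hcc hc
    simp only [Finset.coe_insert, Set.mem_insert_iff, Finset.mem_coe] at hc ⊢
    rcases hc with rfl | hc
    · by_cases hne : c' = c
      · exact Or.inl hne
      right
      obtain ⟨hl1, hl2⟩ := hcc
      by_cases hz : c'.1 = c.1
      · have hx : c'.2 ≠ c.2 := fun h => hne (Prod.ext hz h)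
        obtain ⟨x, hx⟩ : ∃ x, c.2 = x + 1 := ⟨c.2 - 1, by omega⟩
        exact lam.isLowerSet (show c' ≤ (c.1, x) from ⟨hl1, by dsimp; omega⟩) (h2 x hx)
      · obtain ⟨z, hz⟩ : ∃ z, c.1 = z + 1 := ⟨c.1 - 1, by omega⟩
        exact lam.isLowerSet (show c' ≤ (z, c.2) from ⟨by dsimp; omega, hl2⟩) (h1 z hz)
    · exact Or.inr (lam.isLowerSet hcc hc)

theorem removable_iff {lam : YoungDiagram} {b : Box} : Removable lam b ↔
    b ∈ lam.cells ∧ (b.1 + 1, b.2) ∉ lam.cells ∧ (b.1, b.2 + 1) ∉ lam.cells := by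
  constructor
  · rintro ⟨h, mu, hmu⟩
    have key : ∀ c : Box, b ≤ c → c ≠ b → c ∉ lam.cells := by
      intro c hc hne hmem
      have h1 : c ∈ mu.cells := by rw [hmu]; exact Finset.mem_erase.2 ⟨hne, hmem⟩
      have : b ∈ mu.cells := mu.isLowerSet hc h1
      simp [hmu] at this
    refine ⟨h, key _ ⟨by simp, le_rfl⟩ ?_, key _ ⟨le_rfl, by simp⟩ ?_⟩
    · intro h'; simpa using congrArg Prod.fst h'
    · intro h'; simpa using congrArg Prod.snd h'
  · rintro ⟨h, h1, h2⟩
    refine ⟨h, ⟨lam.cells.erase b, ?_⟩, rfl⟩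
    intro c c' hcc hc
    simp only [Finset.coe_erase, Set.mem_sdiff, Finset.mem_coe, Set.mem_singleton_iff] at hc ⊢
    refine ⟨lam.isLowerSet hcc hc.1, ?_⟩
    rintro rfl
    obtain ⟨hl1, hl2⟩ := hcc
    by_cases hz : c'.1 = c.1
    · have hx : c'.2 ≠ c.2 := fun h => hc.2 (Prod.ext hz.symm h.symm)
      exact h2 (lam.isLowerSet (show (c'.1, c'.2 + 1) ≤ c from ⟨hl1, by dsimp; omega⟩) hc.1)
    · exact h1 (lam.isLowerSet (show (c'.1 + 1, c'.2) ≤ c from ⟨by dsimp; omega, hl2⟩) hc.1)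

theorem before_trichotomy (b b' : Box) : Before b b' ∨ b = b' ∨ Before b' b := by
  simp only [Before, Prod.ext_iff]
  omega

theorem Before.not_before {b b' : Box} (h : Before b b') : ¬ Before b' b := by
  simp only [Before] at *
  omega

theorem Before.ne {b b' : Box} (h : Before b b') : b ≠ b' := by
  rintro rfl
  exact h.not_before h

theorem YoungDiagram_mem_of_le {lam : YoungDiagram} {a b c e : ℕ} (h : (a, b) ∈ lam.cells)
    (h1 : c ≤ a) (h2 : e ≤ b) : (c, e) ∈ lam.cells :=
  lam.isLowerSet (show (c, e) ≤ (a, b) from ⟨h1, h2⟩) h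

variable {q d : ℂ}

/-! ### The singular part of the preceding factors -/

/-- The boxes preceding `b` which are adjacent or diagonally adjacent to it. -/
def nbrs : Box → Finset Box
  | (0, 0) => ∅
  | (0, x + 1) => {(0, x)}
  | (z + 1, 0) => {(z, 0)}
  | (z + 1, x + 1) => {(z, x), (z, x + 1), (z + 1, x)}

theorem mem_nbrs {b c : Box} : c ∈ nbrs b ↔
    (b.1 = c.1 + 1 ∧ b.2 = c.2 + 1) ∨ (b.1 = c.1 ∧ b.2 = c.2 + 1) ∨
      (b.1 = c.1 + 1 ∧ b.2 = c.2) := by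
  obtain ⟨z, x⟩ := b
  obtain ⟨z', x'⟩ := c
  rcases z with _ | z <;> rcases x with _ | x <;> simp [nbrs] <;> omega

/-- The part of `φ_{lam, < b}` which comes from `Ψ` and the boxes adjacent to `b`. -/
def nbrPart (q d : ℂ) (b : Box) : RatFunc ℂ :=
  Psi q (color b) * ∏ c ∈ nbrs b, (affineRoot q d (color c) (pos q d c) (color b))⁻¹

theorem affineRoot_self (i : ZMod 2) (a : ℂ) : affineRoot q d i a i =
    (RatFunc.C (q2 q) * RatFunc.X - RatFunc.C a) / (RatFunc.X - RatFunc.C (q2 q * a)) := by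
  simp [affineRoot]

theorem affineRoot_of_ne {i j : ZMod 2} (h : j ≠ i) (a : ℂ) : affineRoot q d i a j =
    ((RatFunc.C (q1 q d) * RatFunc.X - RatFunc.C a) *
        (RatFunc.C (q3 q d) * RatFunc.X - RatFunc.C a)) /
      ((RatFunc.X - RatFunc.C (q1 q d * a)) * (RatFunc.X - RatFunc.C (q3 q d * a))) := by
  simp [affineRoot, h]

theorem C_mul_X_sub (c a : ℂ) (hc : c ≠ 0) :
    (RatFunc.C c * RatFunc.X - RatFunc.C a : RatFunc ℂ) =
      RatFunc.C c * (RatFunc.X - RatFunc.C (a / c)) := by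
  rw [mul_sub, ← map_mul, mul_div_cancel₀ _ hc]

theorem C_ne_zero {c : ℂ} (hc : c ≠ 0) : (RatFunc.C c : RatFunc ℂ) ≠ 0 := by
  rwa [Ne, map_eq_zero]

/-- `X - (position)`. -/
def lin (q d : ℂ) (n : ℤ × ℤ) : RatFunc ℂ := RatFunc.X - RatFunc.C (lpos q d n)

theorem lin_ne_zero (n : ℤ × ℤ) : lin q d n ≠ 0 := X_sub_C_ne_zero _

theorem hasLead_lin_pos (b : Box) (n : ℤ × ℤ) :
    HasLead (HahnSeries.C (pos q d b) + HahnSeries.single 1 1) (lin q d n)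
      (pos q d b - lpos q d n) := hasLead_X_sub _ _

theorem affineRoot_inv_self (h : Generic q d) (b : Box) :
    (affineRoot q d (color b) (pos q d b) (color b))⁻¹ = RatFunc.C (q2 q)⁻¹ *
      (lin q d (b.1 + 1, b.2 + 1) / lin q d (b.1 - 1, b.2 - 1)) := by
  have h2 := h.q2_mul_lpos (toLat b)
  have h2' := h.q2_mul_lpos (b.1 - 1, b.2 - 1)
  simp only [sub_add_cancel] at h2'
  have h3 : pos q d b / q2 q = lpos q d (b.1 - 1, b.2 - 1) := by
    rw [div_eq_iff h.q2_ne, mul_comm, h2']; rfl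
  rw [affineRoot_self, C_mul_X_sub _ _ h.q2_ne, h3, pos_eq_lpos, h2, inv_div]
  simp only [toLat, lin, map_inv₀]
  have := C_ne_zero h.q2_ne
  have := lin_ne_zero (q := q) (d := d) (b.1 - 1, b.2 - 1)
  rw [lin] at this
  field_simp

theorem affineRoot_inv_of_ne (h : Generic q d) (b : Box) {j : ZMod 2} (hj : j ≠ color b) :
    (affineRoot q d (color b) (pos q d b) j)⁻¹ = RatFunc.C (q2 q) *
      ((lin q d (b.1, b.2 - 1) * lin q d (b.1 - 1, b.2)) /
        (lin q d (b.1, b.2 + 1) * lin q d (b.1 + 1, b.2))) := by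
  have h1 := h.q1_mul_lpos (toLat b)
  have h3 := h.q3_mul_lpos (toLat b)
  have h1' : pos q d b / q1 q d = lpos q d (b.1, b.2 + 1) := by
    have h0 := h.q1_mul_lpos (b.1, b.2 + 1)
    simp only [add_sub_cancel_right] at h0
    rw [div_eq_iff h.q1_ne, mul_comm, h0]; rfl
  have h3' : pos q d b / q3 q d = lpos q d (b.1 + 1, b.2) := by
    have h0 := h.q3_mul_lpos (b.1 + 1, b.2)
    simp only [add_sub_cancel_right] at h0
    rw [div_eq_iff h.q3_ne, mul_comm, h0]; rfl
  rw [affineRoot_of_ne hj, C_mul_X_sub _ _ h.q1_ne, C_mul_X_sub _ _ h.q3_ne, h1', h3',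
    pos_eq_lpos, h1, h3, inv_div]
  have h2 : RatFunc.C (q2 q) = (RatFunc.C (q1 q d) * RatFunc.C (q3 q d) : RatFunc ℂ)⁻¹ := by
    rw [← map_mul, h.q1_mul_q3, map_inv₀, inv_inv]
  rw [h2]
  simp only [toLat]
  change lin q d _ * lin q d _ / (RatFunc.C _ * lin q d _ * (RatFunc.C _ * lin q d _)) = _
  have := C_ne_zero h.q1_ne
  have := C_ne_zero h.q3_ne
  have := lin_ne_zero (q := q) (d := d) (b.1, b.2 + 1)
  have := lin_ne_zero (q := q) (d := d) (b.1 + 1, b.2)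
  field_simp

theorem Psi_zero (h : Generic q d) :
    Psi q 0 = RatFunc.C q * (lin q d (-1, -1) / lin q d (0, 0)) := by
  have h2 := h.q2_mul_lpos (-1, -1)
  have h0 : lpos q d (0, 0) = 1 := by simp [lpos]
  have h1 : q⁻¹ / q = lpos q d (-1, -1) := by
    simp only [neg_add_cancel, h0] at h2
    have := h.q_ne
    rw [div_eq_iff h.q_ne, inv_eq_iff_eq_inv, ← mul_left_inj' h.q_ne]
    rw [q2] at h2
    have h3 : lpos q d (-1, -1) = (q ^ 2)⁻¹ := eq_inv_of_mul_eq_one_right h2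
    rw [h3]
    field_simp
  simp only [Psi, fundamental, if_true]
  rw [C_mul_X_sub _ _ h.q_ne, h1, inv_mul_cancel₀ h.q_ne, mul_div_assoc, ← h0]
  rfl

theorem Psi_one : Psi q 1 = 1 := by simp [Psi, fundamental]

theorem color_add_one (z x : ℕ) : color (z, x) ≠ color (z + 1, x) := by
  rw [Ne, color_eq_iff]; dsimp; omega

theorem color_add_one' (z x : ℕ) : color (z, x) ≠ color (z, x + 1) := by
  rw [Ne, color_eq_iff]; dsimp; omega

theorem color_add_add (z x : ℕ) : color (z, x) = color (z + 1, x + 1) := by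
  rw [color_eq_iff]; dsimp; omega

/-- `f` is regular and nonzero at the position of `b`. -/
def IsUnitAt (q d : ℂ) (b : Box) (f : RatFunc ℂ) : Prop :=
  ∃ r ≠ 0, HasLead (HahnSeries.C (pos q d b) + HahnSeries.single 1 1) f r

theorem IsUnitAt.mul {b : Box} {f g : RatFunc ℂ} (hf : IsUnitAt q d b f) (hg : IsUnitAt q d b g) :
    IsUnitAt q d b (f * g) := by
  obtain ⟨r, hr, hf⟩ := hf
  obtain ⟨s, hs, hg⟩ := hg
  exact ⟨r * s, mul_ne_zero hr hs, hf.mul (nonAlg_point _) hg⟩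

theorem IsUnitAt.div {b : Box} {f g : RatFunc ℂ} (hf : IsUnitAt q d b f) (hg : IsUnitAt q d b g) :
    IsUnitAt q d b (f / g) := by
  obtain ⟨r, hr, hf⟩ := hf
  obtain ⟨s, hs, hg⟩ := hg
  exact ⟨r / s, div_ne_zero hr hs, hf.div (nonAlg_point _) hg hs⟩

theorem isUnitAt_C (b : Box) {c : ℂ} (hc : c ≠ 0) : IsUnitAt q d b (RatFunc.C c) :=
  ⟨c, hc, hasLead_C (nonAlg_point _) c⟩

theorem isUnitAt_lin (h : Generic q d) {b : Box} {n : ℤ × ℤ} (hn : toLat b ≠ n) :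
    IsUnitAt q d b (lin q d n) :=
  ⟨_, sub_ne_zero.2 fun h' => hn (h.lpos_injective h'), hasLead_lin_pos b n⟩

theorem isUnitAt_Psi (h : Generic q d) {b : Box} (hb : b ≠ (0, 0)) (i : ZMod 2) :
    IsUnitAt q d b (Psi q i) := by
  fin_cases i
  · change IsUnitAt q d b (Psi q 0)
    rw [Psi_zero h]
    refine (isUnitAt_C b h.q_ne).mul ((isUnitAt_lin h ?_).div (isUnitAt_lin h ?_))
    · simp only [toLat, Ne, Prod.ext_iff]; omega
    · simp only [toLat, Ne, Prod.ext_iff] at *; omega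
  · change IsUnitAt q d b (Psi q 1)
    rw [Psi_one]
    simpa using isUnitAt_C (q := q) (d := d) b one_ne_zero

/-- The pole at the position of `b` is exactly simple. At the origin it comes from `Ψ`; along an
edge of the quadrant the unique preceding neighbor has it. In the interior the two adjacent boxes
have a pole each, and the diagonal neighbor cancels one of them by its zero. -/
theorem isUnitAt_nbrPart (h : Generic q d) (b : Box) :
    IsUnitAt q d b (nbrPart q d b * (RatFunc.X - RatFunc.C (pos q d b))) := by
  have hlin : ∀ m n : ℤ, ((b.1 : ℤ) ≠ m ∨ (b.2 : ℤ) ≠ n) → IsUnitAt q d b (lin q d (m, n)) := by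
    intro m n hmn
    apply isUnitAt_lin h
    simp only [toLat, Ne, Prod.ext_iff]
    omega
  obtain ⟨z, x⟩ := b
  rw [nbrPart, pos_eq_lpos]
  change IsUnitAt q d _ (_ * lin q d _)
  have hb0 := lin_ne_zero (q := q) (d := d) (toLat (z, x))
  have hq2 := isUnitAt_C (q := q) (d := d) (z, x) h.q2_ne
  have hq2' := isUnitAt_C (q := q) (d := d) (z, x) (inv_ne_zero h.q2_ne)
  rcases z with _ | z <;> rcases x with _ | x
  · have hc : color (0, 0) = 0 := by simp [color]
    rw [hc, Psi_zero h]
    convert (isUnitAt_C (0, 0) h.q_ne).mul (hlin (-1) (-1) (by simp)) using 1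
    simp only [nbrs, Finset.prod_empty, toLat, Nat.cast_zero] at hb0 ⊢
    field_simp
  · simp only [nbrs, Finset.prod_singleton]
    rw [affineRoot_inv_of_ne h _ (color_add_one' 0 x).symm]
    convert (isUnitAt_Psi h (by simp) (color (0, x + 1))).mul (hq2.mul
      (((hlin 0 (x - 1) (by right; push_cast; omega)).mul (hlin (0 - 1) x (by simp))).div
        (hlin (0 + 1) x (by simp)))) using 1
    have := lin_ne_zero (q := q) (d := d) (0 + 1, x)
    simp only [toLat, Nat.cast_zero, Nat.cast_add, Nat.cast_one] at hb0 ⊢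
    field_simp
  · simp only [nbrs, Finset.prod_singleton]
    rw [affineRoot_inv_of_ne h _ (color_add_one z 0).symm]
    convert (isUnitAt_Psi h (by simp) (color (z + 1, 0))).mul (hq2.mul
      (((hlin z (0 - 1) (by simp)).mul (hlin (z - 1) 0 (by left; push_cast; omega))).div
        (hlin z (0 + 1) (by simp)))) using 1
    have := lin_ne_zero (q := q) (d := d) (z, 0 + 1)
    simp only [toLat, Nat.cast_zero, Nat.cast_add, Nat.cast_one] at hb0 ⊢
    field_simp
  · have e1 : ((z, x) : Box) ∉ ({(z, x + 1), (z + 1, x)} : Finset Box) := by simp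
    have e2 : ((z, x + 1) : Box) ∉ ({(z + 1, x)} : Finset Box) := by simp
    simp only [nbrs]
    rw [Finset.prod_insert e1, Finset.prod_insert e2, Finset.prod_singleton,
      affineRoot_inv_of_ne h _ (color_add_one' (z + 1) x).symm,
      affineRoot_inv_of_ne h _ (color_add_one z (x + 1)).symm, ← color_add_add,
      affineRoot_inv_self h]
    convert (isUnitAt_Psi h (by simp) (color (z, x))).mul
      ((hq2'.mul (hq2.mul hq2)).mul
      (((hlin z x (by left; push_cast; omega)).mul (hlin (z - 1) (x + 1) (by left; push_cast; omega))).mul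
        ((hlin (z + 1) (x - 1) (by right; push_cast; omega)).mul (hlin z x (by left; push_cast; omega)))|>.div
        (((hlin (z - 1) (x - 1) (by left; push_cast; omega)).mul (hlin z (x + 1 + 1) (by left; push_cast; omega))).mul
          (hlin (z + 1 + 1) x (by left; push_cast; omega))))) using 1
    have := lin_ne_zero (q := q) (d := d) (z - 1, x - 1)
    have := lin_ne_zero (q := q) (d := d) (z, x + 1 + 1)
    have := lin_ne_zero (q := q) (d := d) (z + 1 + 1, x)
    simp only [toLat, Nat.cast_add, Nat.cast_one, add_sub_cancel_right] at hb0 ⊢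
    field_simp

/-- The residue at the position of `b` of the part of `φ_{lam, < b}` independent of `lam`. -/
def nbrRes (q d : ℂ) (b : Box) : ℂ := resLog (pos q d b) (nbrPart q d b)

theorem nbrPart_hasLead (h : Generic q d) (b : Box) :
    HasLead (HahnSeries.C (pos q d b) + HahnSeries.single 1 1)
      (nbrPart q d b * (RatFunc.X - RatFunc.C (pos q d b))) (nbrRes q d b * pos q d b) := by
  obtain ⟨r, -, hl⟩ := isUnitAt_nbrPart h b
  rwa [nbrRes, resLog_eq (h.pos_ne b) hl, div_mul_cancel₀ _ (h.pos_ne b)]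

theorem nbrRes_ne (h : Generic q d) (b : Box) : nbrRes q d b ≠ 0 := by
  obtain ⟨r, hr, hl⟩ := isUnitAt_nbrPart h b
  rw [nbrRes, resLog_eq (h.pos_ne b) hl]
  exact div_ne_zero hr (h.pos_ne b)

/-! ### Matrix coefficients and residues as products over boxes -/

/-- The coefficient of `F` as a product over boxes. -/
def prodAfter (q d : ℂ) (S : Finset Box) (b : Box) : ℂ :=
  ∏ c ∈ S with Before b c, eta q d c b

/-- The coefficient of `E` as a product over boxes. -/
def prodBefore (q d : ℂ) (S : Finset Box) (b : Box) : ℂ :=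
  nbrRes q d b * ∏ c ∈ S with (Before c b ∧ c ∉ nbrs b), eta q d c b

/-- A box of the diagram which follows an absent `b` lies in a later row and a strictly smaller
column. Such a pair is neither adjacent nor diagonal in the sense of `gBox_eq_zero_iff`. -/
theorem gBox_ne_of_after (h : Generic q d) {lam : YoungDiagram} {b c : Box} (hb : b ∉ lam.cells)
    (hc : c ∈ lam.cells) (hbc : Before b c) : gBox q d c b ≠ 0 ∧ gBox q d b c ≠ 0 := by
  have : ¬ (b.1 ≤ c.1 ∧ b.2 ≤ c.2) := fun hle => hb (YoungDiagram_mem_of_le hc hle.1 hle.2)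
  simp only [Before] at hbc
  rw [Ne, Ne, gBox_eq_zero_iff h, gBox_eq_zero_iff h]
  omega

theorem gBox_ne_of_before (h : Generic q d) {b c : Box} (hcb : Before c b) (hn : c ∉ nbrs b) :
    gBox q d c b ≠ 0 ∧ gBox q d b c ≠ 0 := by
  rw [mem_nbrs] at hn
  simp only [Before] at hcb
  rw [Ne, Ne, gBox_eq_zero_iff h, gBox_eq_zero_iff h]
  omega

theorem prodAfter_ne_zero (h : Generic q d) {lam : YoungDiagram} {b : Box} (hb : b ∉ lam.cells) :
    prodAfter q d lam.cells b ≠ 0 := by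
  refine Finset.prod_ne_zero_iff.2 fun c hc => ?_
  rw [Finset.mem_filter] at hc
  have := gBox_ne_of_after h hb hc.1 hc.2
  exact eta_ne_zero this.1 this.2

theorem prodBefore_ne_zero (h : Generic q d) (S : Finset Box) (b : Box) :
    prodBefore q d S b ≠ 0 := by
  refine mul_ne_zero (nbrRes_ne h b) (Finset.prod_ne_zero_iff.2 fun c hc => ?_)
  rw [Finset.mem_filter] at hc
  have := gBox_ne_of_before h hc.2.1 hc.2.2
  exact eta_ne_zero this.1 this.2

theorem phiAfter_hasLead (h : Generic q d) {lam : YoungDiagram} {b : Box} (hb : b ∉ lam.cells) :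
    HasLead (HahnSeries.C (pos q d b) + HahnSeries.single 1 1)
      (phiAfter q d lam b (color b)) (prodAfter q d lam.cells b) := by
  refine HasLead.prod (nonAlg_point _) _ fun c hc => ?_
  rw [Finset.mem_filter] at hc
  exact hasLead_affineRoot_inv (gBox_ne_of_after h hb hc.1 hc.2).1

/-- The singular factors are those of `Ψ` and of the neighbors, and together they depend on `b`
alone. All remaining preceding factors are regular and nonzero at `b`, so the dependence on the
diagram is a product of values `eta`. -/
theorem phiBefore_hasLead (h : Generic q d) {lam : YoungDiagram} {b : Box}
    (hb : nbrs b ⊆ lam.cells) :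
    HasLead (HahnSeries.C (pos q d b) + HahnSeries.single 1 1)
      (phiBefore q d lam b (color b) * (RatFunc.X - RatFunc.C (pos q d b)))
      (prodBefore q d lam.cells b * pos q d b) := by
  have hsplit : (lam.cells.filter (Before · b)) =
      nbrs b ∪ lam.cells.filter (fun c => Before c b ∧ c ∉ nbrs b) := by
    ext c
    simp only [Finset.mem_filter, Finset.mem_union]
    constructor
    · intro hc
      by_cases h : c ∈ nbrs b
      · exact Or.inl h
      · exact Or.inr ⟨hc.1, hc.2, h⟩
    · rintro (hc | hc)
      · refine ⟨hb hc, ?_⟩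
        rw [mem_nbrs] at hc
        simp only [Before]
        omega
      · exact ⟨hc.1, hc.2.1⟩
  have hdisj : Disjoint (nbrs b) (lam.cells.filter (fun c => Before c b ∧ c ∉ nbrs b)) := by
    rw [Finset.disjoint_left]
    intro c hc hc'
    exact (Finset.mem_filter.1 hc').2.2 hc
  have h1 := (nbrPart_hasLead h b).mul (nonAlg_point _)
    (HasLead.prod (nonAlg_point (pos q d b)) (lam.cells.filter fun c => Before c b ∧ c ∉ nbrs b)
      (F := fun c => (affineRoot q d (color c) (pos q d c) (color b))⁻¹)
      (v := fun c => eta q d c b) fun c hc => by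
        rw [Finset.mem_filter] at hc
        exact hasLead_affineRoot_inv (gBox_ne_of_before h hc.2.1 hc.2.2).1)
  convert h1 using 1
  · rw [phiBefore, hsplit, Finset.prod_union hdisj, nbrPart]
    ring
  · rw [prodBefore]
    ring

theorem Removable.nbrs_subset {lam : YoungDiagram} {b : Box} (hb : Removable lam b) :
    nbrs b ⊆ lam.cells := by
  intro c hc
  rw [mem_nbrs] at hc
  exact YoungDiagram_mem_of_le hb.1 (by omega) (by omega)

theorem Addable.nbrs_subset {lam : YoungDiagram} {b : Box} (hb : Addable lam b) :
    nbrs b ⊆ lam.cells := by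
  intro c hc
  have h1 := hb.removable.nbrs_subset hc
  rw [hb.cells, Finset.mem_insert] at h1
  refine h1.resolve_left ?_
  rintro rfl
  rw [mem_nbrs] at hc
  omega

theorem coeffA_eq (h : Generic q d) {lam : YoungDiagram} {b : Box} (hb : b ∉ lam.cells) :
    coeffA q d (color b) lam b = prodAfter q d lam.cells b :=
  value_eq (phiAfter_hasLead h hb)

theorem coeffB_eq (h : Generic q d) {lam : YoungDiagram} {b : Box} (hb : nbrs b ⊆ lam.cells) :
    coeffB q d (color b) lam b = (q - q⁻¹)⁻¹ * prodBefore q d lam.cells b := by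
  rw [coeffB, resLog_eq (h.pos_ne b) (phiBefore_hasLead h hb),
    mul_div_cancel_right₀ _ (h.pos_ne b)]

theorem phi_eq_of_addable {lam : YoungDiagram} {b : Box} (hb : b ∉ lam.cells) (i : ZMod 2) :
    phi q d lam i = phiBefore q d lam b i * phiAfter q d lam b i := by
  rw [phi, phiBefore, phiAfter, mul_assoc, ← Finset.prod_union]
  · congr 2
    ext c
    simp only [Finset.mem_union, Finset.mem_filter]
    rcases before_trichotomy b c with h | rfl | h
    · simp [h]; tauto
    · simp [hb]
    · simp [h]; tauto
  · rw [Finset.disjoint_left]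
    intro c hc hc'
    rw [Finset.mem_filter] at hc hc'
    exact hc.2.not_before hc'.2

theorem phi_addBox {lam : YoungDiagram} {b : Box} (hb : Addable lam b) (i : ZMod 2) :
    phi q d (addBox lam b) i =
      phi q d lam i * (affineRoot q d (color b) (pos q d b) i)⁻¹ := by
  rw [phi, phi, hb.cells, Finset.prod_insert hb.1]
  ring

/-- The residue of `φ_lam` at an addable box. -/
theorem resLog_phi_addable (h : Generic q d) {lam : YoungDiagram} {b : Box} (hb : Addable lam b) :
    resLog (pos q d b) (phi q d lam (color b)) =
      prodBefore q d lam.cells b * prodAfter q d lam.cells b := by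
  have h1 := (phiBefore_hasLead h hb.nbrs_subset).mul (nonAlg_point _) (phiAfter_hasLead h hb.1)
  rw [mul_right_comm, ← phi_eq_of_addable hb.1] at h1
  rw [resLog_eq (h.pos_ne b) h1]
  have := h.pos_ne b
  field_simp

/-- The residue of `φ_lam` at a removable box. -/
theorem resLog_phi_removable (h : Generic q d) {lam : YoungDiagram} {b : Box}
    (hb : Removable lam b) :
    resLog (pos q d b) (phi q d lam (color b)) =
      -(prodBefore q d (lam.cells.erase b) b * prodAfter q d (lam.cells.erase b) b) := by
  have hA := hb.addable
  have hg : gBox q d b b ≠ 0 := by rw [Ne, gBox_eq_zero_iff h]; omega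
  -- The factor of `b` itself has value `-1` at its own position. This sign makes up for the
  -- opposite order of the terms in the commutator of `E` and `F`.
  have heta : eta q d b b = -1 := by
    rw [eta, mul_div_assoc, div_self hg, mul_one, sgn, if_pos rfl]
  have h1 := ((phiBefore_hasLead h hA.nbrs_subset).mul (nonAlg_point _)
    (phiAfter_hasLead h hA.1)).mul (nonAlg_point _) (hasLead_affineRoot_inv hg)
  rw [mul_right_comm (phiBefore _ _ _ _ _), ← phi_eq_of_addable hA.1, mul_right_comm,
    ← phi_addBox hA, hb.addBox_removeBox, heta] at h1
  rw [resLog_eq (h.pos_ne b) h1, hb.cells]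
  have := h.pos_ne b
  field_simp

/-! ### Zeros and poles of the weights -/

/-- The product of linear factors with multiplicities `m`. -/
def linProd (q d : ℂ) (m : ℤ × ℤ →₀ ℤ) : RatFunc ℂ := m.prod fun n k => lin q d n ^ k

theorem linProd_zero : linProd q d 0 = 1 := Finsupp.prod_zero_index

theorem linProd_add (m m' : ℤ × ℤ →₀ ℤ) :
    linProd q d (m + m') = linProd q d m * linProd q d m' :=
  Finsupp.prod_add_index' (fun _ => zpow_zero _) fun n _ _ => zpow_add₀ (lin_ne_zero n) _ _

theorem linProd_single (n : ℤ × ℤ) : linProd q d (Finsupp.single n 1) = lin q d n := by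
  rw [linProd, Finsupp.prod_single_index (zpow_zero _), zpow_one]

theorem linProd_sub (m m' : ℤ × ℤ →₀ ℤ) :
    linProd q d (m - m') = linProd q d m / linProd q d m' := by
  have h : linProd q d m' ≠ 0 :=
    Finset.prod_ne_zero_iff.2 fun n _ => zpow_ne_zero _ (lin_ne_zero n)
  rw [eq_div_iff h, ← linProd_add, sub_add_cancel]

/-- The multiplicities of the zeros of `A_b^{-1}`. -/
def rootMult (i : ZMod 2) (b : Box) : ℤ × ℤ →₀ ℤ :=
  if color b = i then
    Finsupp.single ((b.1 : ℤ) + 1, (b.2 : ℤ) + 1) 1 -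
      Finsupp.single ((b.1 : ℤ) - 1, (b.2 : ℤ) - 1) 1
  else
    Finsupp.single ((b.1 : ℤ), (b.2 : ℤ) - 1) 1 + Finsupp.single ((b.1 : ℤ) - 1, (b.2 : ℤ)) 1 -
      (Finsupp.single ((b.1 : ℤ), (b.2 : ℤ) + 1) 1 + Finsupp.single ((b.1 : ℤ) + 1, (b.2 : ℤ)) 1)

theorem exists_affineRoot_inv_eq (h : Generic q d) (i : ZMod 2) (b : Box) : ∃ c : ℂ,
    (affineRoot q d (color b) (pos q d b) i)⁻¹ = RatFunc.C c * linProd q d (rootMult i b) := by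
  by_cases hc : color b = i
  · refine ⟨(q2 q)⁻¹, ?_⟩
    rw [rootMult, if_pos hc, linProd_sub, linProd_single, linProd_single, ← hc,
      affineRoot_inv_self h]
  · refine ⟨q2 q, ?_⟩
    rw [rootMult, if_neg hc, linProd_sub, linProd_add, linProd_add, linProd_single, linProd_single,
      linProd_single, linProd_single, affineRoot_inv_of_ne h _ (Ne.symm hc)]

/-- The multiplicities of the zeros of `Ψ`. -/
def psiMult (i : ZMod 2) : ℤ × ℤ →₀ ℤ :=
  if i = 0 then Finsupp.single (-1, -1) 1 - Finsupp.single (0, 0) 1 else 0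

/-- The multiplicities of the zeros of `φ_lam`. -/
def phiMult (lam : YoungDiagram) (i : ZMod 2) : ℤ × ℤ →₀ ℤ :=
  psiMult i + ∑ b ∈ lam.cells, rootMult i b

theorem exists_phi_eq (h : Generic q d) (lam : YoungDiagram) (i : ZMod 2) : ∃ c : ℂ,
    phi q d lam i = RatFunc.C c * linProd q d (phiMult lam i) := by
  have hpsi : ∃ c : ℂ, Psi q i = RatFunc.C c * linProd q d (psiMult i) := by
    fin_cases i
    · refine ⟨q, ?_⟩
      change Psi q 0 = _ * linProd q d (psiMult 0)
      rw [Psi_zero h, psiMult, if_pos rfl, linProd_sub, linProd_single, linProd_single]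
    · refine ⟨1, ?_⟩
      change Psi q 1 = _ * linProd q d (psiMult 1)
      rw [Psi_one, psiMult, if_neg (by decide), linProd_zero, map_one, mul_one]
  obtain ⟨c, hc⟩ := hpsi
  have hprod : ∀ S : Finset Box, ∃ c : ℂ,
      ∏ b ∈ S, (affineRoot q d (color b) (pos q d b) i)⁻¹ =
        RatFunc.C c * linProd q d (∑ b ∈ S, rootMult i b) := by
    intro S
    induction S using Finset.induction_on with
    | empty => exact ⟨1, by simp [linProd_zero]⟩
    | insert b S hb ih =>
      obtain ⟨c, hc⟩ := ih
      obtain ⟨c', hc'⟩ := exists_affineRoot_inv_eq h i b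
      refine ⟨c' * c, ?_⟩
      rw [Finset.prod_insert hb, Finset.sum_insert hb, linProd_add, hc, hc', map_mul]
      ring
  obtain ⟨c', hc'⟩ := hprod lam.cells
  refine ⟨c * c', ?_⟩
  rw [phi, hc, hc', phiMult, linProd_add, map_mul]
  ring

open Classical in
/-- The indicator function of a diagram on the lattice. -/
def chi (lam : YoungDiagram) (z x : ℤ) : ℤ := if ∃ b ∈ lam.cells, toLat b = (z, x) then 1 else 0

theorem sum_ite_eq_chi (lam : YoungDiagram) (z x s t : ℤ) :
    ∑ b ∈ lam.cells, (if ((b.1 : ℤ) + s = z ∧ (b.2 : ℤ) + t = x) then (1 : ℤ) else 0) =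
      chi lam (z - s) (x - t) := by
  have key : ∀ b : Box, ((b.1 : ℤ) + s = z ∧ (b.2 : ℤ) + t = x) ↔ toLat b = (z - s, x - t) := by
    intro b
    simp only [toLat, Prod.ext_iff]
    omega
  simp only [key, chi]
  split_ifs with h
  · obtain ⟨b, hb, hbn⟩ := h
    rw [Finset.sum_eq_single b]
    · rw [if_pos hbn]
    · intro c _ hc
      exact if_neg fun h => hc (toLat_injective (h.trans hbn.symm))
    · exact fun h => absurd hb h
  · refine Finset.sum_eq_zero fun b hb => if_neg fun hbn => h ⟨b, hb, hbn⟩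

/-- Translations by one step change the color and diagonal ones preserve it, so the condition on the
color of the box becomes one on the parity of the point. Thereby one formula covers both kinds of
factors and can be summed over all boxes. -/
theorem rootMult_apply (i : ZMod 2) (b : Box) (z x : ℤ) : rootMult i b (z, x) =
    if ((z + x : ℤ) : ZMod 2) = i then
      (if ((b.1 : ℤ) + 1 = z ∧ (b.2 : ℤ) + 1 = x) then 1 else 0)
      - (if ((b.1 : ℤ) + (-1) = z ∧ (b.2 : ℤ) + (-1) = x) then 1 else 0)
      + (if ((b.1 : ℤ) + 0 = z ∧ (b.2 : ℤ) + (-1) = x) then 1 else 0)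
      + (if ((b.1 : ℤ) + (-1) = z ∧ (b.2 : ℤ) + 0 = x) then 1 else 0)
      - (if ((b.1 : ℤ) + 0 = z ∧ (b.2 : ℤ) + 1 = x) then 1 else 0)
      - (if ((b.1 : ℤ) + 1 = z ∧ (b.2 : ℤ) + 0 = x) then 1 else 0)
    else 0 := by
  have hcol : ∀ j : ZMod 2, (color b = j ↔ (((b.2 + b.1 : ℕ) : ℤ) : ZMod 2) = j) := by
    intro j; rw [color, Int.cast_natCast]
  have hpar : (color b = i ↔ ((z + x : ℤ) : ZMod 2) = i) ↔ (z + x - b.1 - b.2) % 2 = 0 := by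
    have h1 : color b = ((z + x : ℤ) : ZMod 2) ↔ (z + x - b.1 - b.2) % 2 = 0 := by
      rw [hcol, ZMod.intCast_eq_intCast_iff', Nat.cast_add]
      omega
    rw [← h1]
    generalize color b = u
    generalize ((z + x : ℤ) : ZMod 2) = v
    revert i u v
    decide
  unfold rootMult
  simp only [← sub_eq_add_neg, add_zero]
  rcases Int.emod_two_eq_zero_or_one (z + x - b.1 - b.2) with h0 | h0
  · have h1 := hpar.2 h0
    have e1 : ¬ ((b.1 : ℤ) = z ∧ (b.2 : ℤ) - 1 = x) := by omega
    have e2 : ¬ ((b.1 : ℤ) - 1 = z ∧ (b.2 : ℤ) = x) := by omega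
    have e3 : ¬ ((b.1 : ℤ) = z ∧ (b.2 : ℤ) + 1 = x) := by omega
    have e4 : ¬ ((b.1 : ℤ) + 1 = z ∧ (b.2 : ℤ) = x) := by omega
    rw [if_neg e1, if_neg e2, if_neg e3, if_neg e4]
    by_cases h2 : color b = i
    · rw [if_pos h2, if_pos (h1.1 h2)]
      simp only [Finsupp.sub_apply, Finsupp.single_apply, Prod.mk.injEq]
      ring
    · rw [if_neg h2, if_neg (fun h => h2 (h1.2 h))]
      simp only [Finsupp.sub_apply, Finsupp.add_apply, Finsupp.single_apply, Prod.mk.injEq]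
      rw [if_neg e1, if_neg e2, if_neg e3, if_neg e4]
      rfl
  · have h1 : ¬ (color b = i ↔ ((z + x : ℤ) : ZMod 2) = i) := fun h => by
      rw [hpar.1 h] at h0; omega
    have e1 : ¬ ((b.1 : ℤ) + 1 = z ∧ (b.2 : ℤ) + 1 = x) := by omega
    have e2 : ¬ ((b.1 : ℤ) - 1 = z ∧ (b.2 : ℤ) - 1 = x) := by omega
    rw [if_neg e1, if_neg e2]
    by_cases h2 : color b = i
    · rw [if_pos h2, if_neg (fun h => h1 (iff_of_true h2 h))]
      simp only [Finsupp.sub_apply, Finsupp.single_apply, Prod.mk.injEq]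
      rw [if_neg e1, if_neg e2]
      rfl
    · rw [if_neg h2, if_pos (by by_contra h; exact h1 (iff_of_false h2 h))]
      simp only [Finsupp.sub_apply, Finsupp.add_apply, Finsupp.single_apply, Prod.mk.injEq]
      ring

/-- Summation over the boxes turns the shifts into values of the indicator function near the point.
The multiplicity becomes a difference of two mixed second differences of this indicator, corrected
by the divisor of `Ψ`. -/
theorem phiMult_apply (lam : YoungDiagram) (i : ZMod 2) (z x : ℤ) : phiMult lam i (z, x) =
    if ((z + x : ℤ) : ZMod 2) = i then
      chi lam (z - 1) (x - 1) - chi lam (z + 1) (x + 1) + chi lam z (x + 1) + chi lam (z + 1) x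
        - chi lam z (x - 1) - chi lam (z - 1) x
        + (if z = -1 ∧ x = -1 then 1 else 0) - (if z = 0 ∧ x = 0 then 1 else 0)
    else 0 := by
  have hpsi : psiMult i (z, x) = if ((z + x : ℤ) : ZMod 2) = i then
      (if z = -1 ∧ x = -1 then 1 else 0) - (if z = 0 ∧ x = 0 then 1 else 0) else 0 := by
    unfold psiMult
    by_cases h1 : z = -1 ∧ x = -1
    · obtain ⟨rfl, rfl⟩ := h1
      have : (((-1 + -1 : ℤ)) : ZMod 2) = 0 := by decide
      rw [this]
      by_cases hi : i = 0 <;> simp [hi, eq_comm]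
    · by_cases h2 : z = 0 ∧ x = 0
      · obtain ⟨rfl, rfl⟩ := h2
        by_cases hi : i = 0 <;> simp [hi, eq_comm]
      · by_cases hi : i = 0 <;> simp [hi, h1, h2]
  rw [phiMult, Finsupp.add_apply, Finsupp.finsetSum_apply, hpsi]
  simp only [rootMult_apply]
  split_ifs with h <;>
    simp only [Finset.sum_add_distrib, Finset.sum_sub_distrib, sum_ite_eq_chi, sub_neg_eq_add,
      sub_zero, Finset.sum_const_zero] <;> ring

theorem chi_eq_zero_or_one (lam : YoungDiagram) (z x : ℤ) : chi lam z x = 0 ∨ chi lam z x = 1 := by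
  unfold chi
  split_ifs <;> simp

theorem chi_natCast (lam : YoungDiagram) (z x : ℕ) :
    chi lam z x = 1 ↔ (z, x) ∈ lam.cells := by
  unfold chi
  constructor
  · intro h
    obtain ⟨⟨a, b⟩, hb, hbn⟩ := (ite_ne_right_iff.1 (h.trans_ne one_ne_zero)).1
    simp only [toLat, Prod.mk.injEq, Nat.cast_inj] at hbn
    rwa [← hbn.1, ← hbn.2]
  · intro h
    exact if_pos ⟨(z, x), h, rfl⟩

theorem chi_of_neg (lam : YoungDiagram) {z x : ℤ} (h : z < 0 ∨ x < 0) : chi lam z x = 0 := by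
  refine if_neg ?_
  rintro ⟨b, -, hb⟩
  simp only [toLat, Prod.mk.injEq] at hb
  omega

theorem chi_anti (lam : YoungDiagram) {z x z' x' : ℤ} (hz : 0 ≤ z') (hx : 0 ≤ x') (hz' : z' ≤ z)
    (hx' : x' ≤ x) : chi lam z x ≤ chi lam z' x' := by
  lift z' to ℕ using hz
  lift x' to ℕ using hx
  lift z to ℕ using by omega
  lift x to ℕ using by omega
  rcases chi_eq_zero_or_one lam z x with h | h
  · rcases chi_eq_zero_or_one lam z' x' with h' | h' <;> omega
  · rw [h, (chi_natCast lam z' x').2]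
    exact YoungDiagram_mem_of_le ((chi_natCast lam z x).1 h) (by omega) (by omega)

/-- The poles of `φ_lam` are simple and lie at the corners of `lam`. -/
theorem phiMult_cases (lam : YoungDiagram) (i : ZMod 2) (z x : ℤ) :
    0 ≤ phiMult lam i (z, x) ∨ (phiMult lam i (z, x) = -1 ∧
      ∃ b ∈ concaveBoxes i lam ∪ convexBoxes i lam, toLat b = (z, x)) := by
  rw [phiMult_apply]
  by_cases hi : ((z + x : ℤ) : ZMod 2) = i
  swap
  · rw [if_neg hi]
    exact Or.inl le_rfl
  rw [if_pos hi]
  have key : ∀ z x : ℤ, chi lam z x = 0 ∨ chi lam z x = 1 := chi_eq_zero_or_one lam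
  have hneg : ∀ z x : ℤ, z < 0 ∨ x < 0 → chi lam z x = 0 := fun z x => chi_of_neg lam
  -- Outside the quadrant there are no poles; on its border the correction from `Ψ` enters only at
  -- `(-1, -1)`, as a zero.
  by_cases hq : z < 0 ∨ x < 0
  · left
    have h1 := key (z - 1) (x - 1)
    have h2 := key (z + 1) (x + 1)
    have h3 := key z (x + 1)
    have h4 := key (z + 1) x
    have n1 := hneg (z - 1) (x - 1)
    have n2 := hneg (z + 1) (x + 1)
    have n5 := hneg z (x - 1)
    have n6 := hneg (z - 1) x
    have a1 : 0 ≤ z + 1 → 0 ≤ x → chi lam (z + 1) (x + 1) ≤ chi lam (z + 1) x :=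
      fun h h' => chi_anti lam h h' (by omega) (by omega)
    have a2 : 0 ≤ z → 0 ≤ x + 1 → chi lam (z + 1) (x + 1) ≤ chi lam z (x + 1) :=
      fun h h' => chi_anti lam h h' (by omega) (by omega)
    omega
  · push Not at hq
    lift z to ℕ using hq.1
    lift x to ℕ using hq.2
    have h0 := key z x
    have h1 := key (z - 1) (x - 1)
    have h2 := key (z + 1) (x + 1)
    have h3 := key z (x + 1)
    have h4 := key (z + 1) x
    have h5 := key z (x - 1)
    have h6 := key (z - 1) x
    have n1 := hneg (z - 1) (x - 1)
    have n5 := hneg z (x - 1)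
    have n6 := hneg (z - 1) x
    have a1 := chi_anti lam (z := z + 1) (x := x + 1) (z' := z + 1) (x' := x) (by omega) (by omega)
      (by omega) (by omega)
    have a2 := chi_anti lam (z := z + 1) (x := x + 1) (z' := z) (x' := x + 1) (by omega) (by omega)
      (by omega) (by omega)
    have a3 := chi_anti lam (z := z + 1) (x := x) (z' := z) (x' := x) (by omega) (by omega)
      (by omega) (by omega)
    have a4 := chi_anti lam (z := z) (x := x + 1) (z' := z) (x' := x) (by omega) (by omega)
      (by omega) (by omega)
    have a5 : 1 ≤ (z : ℤ) → chi lam z x ≤ chi lam (z - 1) x :=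
      fun h => chi_anti lam (by omega) (by omega) (by omega) (by omega)
    have a6 : 1 ≤ (x : ℤ) → chi lam z x ≤ chi lam z (x - 1) :=
      fun h => chi_anti lam (by omega) (by omega) (by omega) (by omega)
    have a7 : 1 ≤ (z : ℤ) → 1 ≤ (x : ℤ) → chi lam z (x - 1) ≤ chi lam (z - 1) (x - 1) :=
      fun h h' => chi_anti lam (by omega) (by omega) (by omega) (by omega)
    have a8 : 1 ≤ (z : ℤ) → 1 ≤ (x : ℤ) → chi lam (z - 1) x ≤ chi lam (z - 1) (x - 1) :=
      fun h h' => chi_anti lam (by omega) (by omega) (by omega) (by omega)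
    have hcol : color (z, x) = i := by
      rw [← hi, color]
      push_cast
      ring
    rw [or_iff_not_imp_left]
    intro hlt
    -- A finite check: the indicator takes the values `0` and `1` and decreases in both directions,
    -- so a negative multiplicity forces the local picture of an addable or a removable box.
    have hcorner : (chi lam z x = 0 ∧ ((z : ℤ) = 0 ∨ chi lam (z - 1) x = 1) ∧
        ((x : ℤ) = 0 ∨ chi lam z (x - 1) = 1)) ∨
        (chi lam z x = 1 ∧ chi lam (z + 1) x = 0 ∧ chi lam z (x + 1) = 0) := by
      omega
    refine ⟨by omega, (z, x), ?_, rfl⟩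
    rw [Finset.mem_union, mem_concaveBoxes, mem_convexBoxes, addable_iff, removable_iff]
    refine hcorner.imp (fun hc => ⟨hcol, ?_, ?_, ?_⟩) (fun hc => ⟨hcol, ?_, ?_, ?_⟩)
    · rw [← chi_natCast]; omega
    · rintro z' hz'
      dsimp only at hz' ⊢
      subst hz'
      rw [← chi_natCast]
      have := hc.2.1
      push_cast at this
      rw [add_sub_cancel_right] at this
      omega
    · rintro x' hx'
      dsimp only at hx' ⊢
      subst hx'
      rw [← chi_natCast]
      have := hc.2.2
      push_cast at this
      rw [add_sub_cancel_right] at this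
      omega
    · rw [← chi_natCast]; omega
    · dsimp only; rw [← chi_natCast]; push_cast; omega
    · dsimp only; rw [← chi_natCast]; push_cast; omega

/-- The product of `φ_lam` with the linear factors at its poles is a polynomial. -/
theorem exists_phi_mul_eq (h : Generic q d) (lam : YoungDiagram) (i : ZMod 2) :
    ∃ N : Polynomial ℂ, phi q d lam i *
      ∏ b ∈ concaveBoxes i lam ∪ convexBoxes i lam, (RatFunc.X - RatFunc.C (pos q d b)) =
        algebraMap _ _ N := by
  obtain ⟨S, hS⟩ : ∃ S, S = concaveBoxes i lam ∪ convexBoxes i lam := ⟨_, rfl⟩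
  rw [← hS]
  obtain ⟨c, hc⟩ := exists_phi_eq h lam i
  set m := phiMult lam i + ∑ b ∈ S, Finsupp.single (toLat b) 1 with hm
  have h1 : ∀ S : Finset Box, ∏ b ∈ S, (RatFunc.X - RatFunc.C (pos q d b)) =
      linProd q d (∑ b ∈ S, Finsupp.single (toLat b) 1) := by
    intro S
    induction S using Finset.induction_on with
    | empty => simp [linProd_zero]
    | insert b S hb ih =>
      rw [Finset.prod_insert hb, Finset.sum_insert hb, linProd_add, linProd_single, ih, pos_eq_lpos]
      rfl
  -- One extra linear factor at each corner compensates every pole, since all poles are simple.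
  have hnn : ∀ n, 0 ≤ m n := by
    rintro ⟨z, x⟩
    have h2 : ∀ b : Box, 0 ≤ (Finsupp.single (toLat b) (1 : ℤ)) (z, x) := by
      intro b
      rw [Finsupp.single_apply]
      split_ifs <;> simp
    rw [hm, Finsupp.add_apply, Finsupp.finsetSum_apply]
    rcases phiMult_cases lam i z x with h0 | ⟨h0, b, hb, hbn⟩
    · exact add_nonneg h0 (Finset.sum_nonneg fun b _ => h2 b)
    · rw [← hS] at hb
      have := Finset.single_le_sum (f := fun b => (Finsupp.single (toLat b) (1 : ℤ)) (z, x))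
        (fun b _ => h2 b) hb
      rw [hbn, Finsupp.single_eq_same] at this
      omega
  refine ⟨Polynomial.C c * ∏ n ∈ m.support,
    (Polynomial.X - Polynomial.C (lpos q d n)) ^ (m n).toNat, ?_⟩
  rw [h1, hc, mul_assoc, ← linProd_add, ← hm, map_mul, RatFunc.algebraMap_C, map_prod, linProd]
  congr 1
  refine Finset.prod_congr rfl fun n _ => ?_
  rw [map_pow, map_sub, RatFunc.algebraMap_X, RatFunc.algebraMap_C, ← zpow_natCast,
    Int.toNat_of_nonneg (hnn n)]
  rfl

/-! ### Values at infinity and at zero -/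

/-- The eigenvalue of `K_i` on `ket lam`. -/
def kVal (q : ℂ) (lam : YoungDiagram) (i : ZMod 2) : ℂ :=
  (if i = 0 then q else 1) * ∏ b ∈ lam.cells, if color b = i then (q2 q)⁻¹ else q2 q

theorem kVal_ne (h : Generic q d) (lam : YoungDiagram) (i : ZMod 2) : kVal q lam i ≠ 0 := by
  refine mul_ne_zero ?_ (Finset.prod_ne_zero_iff.2 fun b _ => ?_)
  · split_ifs
    exacts [h.q_ne, one_ne_zero]
  · split_ifs
    exacts [inv_ne_zero h.q2_ne, h.q2_ne]

/-- Every box contributes `(q2 q)⁻¹` for its own color and `q2 q` for the other one, so only the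
factor `q` of `Ψ` remains. -/
theorem kVal_mul (h : Generic q d) (lam : YoungDiagram) : kVal q lam 0 * kVal q lam 1 = q := by
  have hcol : ∀ b : Box, color b = 1 ↔ ¬ color b = 0 := by
    intro b
    generalize color b = i
    revert i
    decide
  have h2 := h.q2_ne
  rw [kVal, kVal, mul_mul_mul_comm, ← Finset.prod_mul_distrib, if_pos rfl, if_neg (by decide),
    Finset.prod_eq_one, mul_one, mul_one]
  intro b _
  by_cases hb : color b = 0
  · rw [if_pos hb, if_neg (by rw [hcol]; exact not_not.2 hb), inv_mul_cancel₀ h2]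
  · rw [if_neg hb, if_pos ((hcol b).2 hb), mul_inv_cancel₀ h2]

theorem phi_hasLead_infty (h : Generic q d) (lam : YoungDiagram) (i : ZMod 2) :
    HasLead (HahnSeries.single (-1) 1) (phi q d lam i) (kVal q lam i) := by
  refine HasLead.mul nonAlg_infty ?_ (HasLead.prod nonAlg_infty _ fun b _ => ?_)
  · rw [Psi, fundamental]
    split_ifs
    · simpa using hasLead_infty_div (α := q) (β := q⁻¹) (γ := 1) (δ := q⁻¹ * q) one_ne_zero
    · exact hasLead_one nonAlg_infty
  · by_cases hb : color b = i
    · rw [if_pos hb, hb, affineRoot_self, inv_div]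
      simpa using hasLead_infty_div (α := 1) (β := q2 q * pos q d b) (γ := q2 q) (δ := pos q d b)
        h.q2_ne
    · rw [if_neg hb, affineRoot_of_ne (Ne.symm hb), inv_div, mul_div_mul_comm]
      have h1 := (hasLead_infty_div (α := 1) (β := q1 q d * pos q d b) (δ := pos q d b)
        h.q1_ne).mul nonAlg_infty (hasLead_infty_div (α := 1) (β := q3 q d * pos q d b)
          (δ := pos q d b) h.q3_ne)
      rw [div_mul_div_comm 1, h.q1_mul_q3, one_mul, one_div, inv_inv] at h1
      simpa [mul_div_mul_comm] using h1

theorem phi_hasLead_zero (h : Generic q d) (lam : YoungDiagram) (i : ZMod 2) :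
    HasLead (HahnSeries.single 1 1) (phi q d lam i) (kVal q lam i)⁻¹ := by
  rw [kVal, mul_inv, ← Finset.prod_inv_distrib]
  refine HasLead.mul nonAlg_zero ?_ (HasLead.prod nonAlg_zero _ fun b _ => ?_)
  · rw [Psi, fundamental]
    split_ifs
    · have := hasLead_zero_div (α := q) (β := q⁻¹) (γ := 1) (δ := q⁻¹ * q)
        (mul_ne_zero (inv_ne_zero h.q_ne) h.q_ne)
      rw [inv_mul_cancel₀ h.q_ne] at this ⊢
      simpa using this
    · simpa using hasLead_one nonAlg_zero
  · have hp := h.pos_ne b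
    by_cases hb : color b = i
    · rw [if_pos hb, hb, affineRoot_self, inv_div, inv_inv]
      have := hasLead_zero_div (α := 1) (β := q2 q * pos q d b) (γ := q2 q) hp
      rw [mul_div_cancel_right₀ _ hp] at this
      simpa using this
    · rw [if_neg hb, affineRoot_of_ne (Ne.symm hb), inv_div, mul_div_mul_comm]
      have h1 := (hasLead_zero_div (α := 1) (β := q1 q d * pos q d b) (γ := q1 q d) hp).mul
        nonAlg_zero (hasLead_zero_div (α := 1) (β := q3 q d * pos q d b) (γ := q3 q d) hp)
      rw [mul_div_cancel_right₀ _ hp, mul_div_cancel_right₀ _ hp, h.q1_mul_q3] at h1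
      simpa using h1

theorem expansionCoeff_phi_sub (h : Generic q d) (lam : YoungDiagram) (i : ZMod 2) (n : ℤ) :
    expansionCoeff PM.plus (phi q d lam i) n - expansionCoeff PM.minus (phi q d lam i) n =
      ∑ b ∈ concaveBoxes i lam ∪ convexBoxes i lam,
        resLog (pos q d b) (phi q d lam i) * pos q d b ^ n := by
  obtain ⟨N, hN⟩ := exists_phi_mul_eq h lam i
  obtain ⟨c, r, hcr⟩ := exists_partialFractions _ (pos q d) h.pos_injective.injOn hN
    (phi_hasLead_infty h lam i)
  exact expansionCoeff_sub_eq_sum_resLog _ (pos q d) (fun b _ => h.pos_ne b)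
    h.pos_injective.injOn c r hcr n

/-! ### Separation of partitions by their weights -/

theorem isUnitAt_affineRoot_inv (h : Generic q d) {b c : Box}
    (hc : c.1 + c.2 ≤ b.1 + b.2) (hbc : c ≠ b) (p : Box)
    (hp : p = (b.1 + 1, b.2 + 1)) :
    IsUnitAt q d p (affineRoot q d (color c) (pos q d c) (color b))⁻¹ := by
  subst hp
  rw [Ne, Prod.ext_iff] at hbc
  have hlin : ∀ m n : ℤ, ((b.1 : ℤ) + 1 ≠ m ∨ (b.2 : ℤ) + 1 ≠ n) →
      IsUnitAt q d (b.1 + 1, b.2 + 1) (lin q d (m, n)) := by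
    intro m n hmn
    apply isUnitAt_lin h
    simp only [toLat, Ne, Prod.ext_iff]
    push_cast
    omega
  by_cases hci : color c = color b
  · rw [← hci, affineRoot_inv_self h]
    exact (isUnitAt_C _ (inv_ne_zero h.q2_ne)).mul
      ((hlin _ _ (by omega)).div (hlin _ _ (by omega)))
  · rw [affineRoot_inv_of_ne h _ (Ne.symm hci)]
    rw [color_eq_iff] at hci
    exact (isUnitAt_C _ h.q2_ne).mul (((hlin _ _ (by omega)).mul (hlin _ _ (by omega))).div
      ((hlin _ _ (by omega)).mul (hlin _ _ (by omega))))

theorem IsUnitAt.prod {p : Box} (S : Finset Box) {F : Box → RatFunc ℂ}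
    (hF : ∀ b ∈ S, IsUnitAt q d p (F b)) : IsUnitAt q d p (∏ b ∈ S, F b) := by
  induction S using Finset.induction_on with
  | empty => simpa using isUnitAt_C (q := q) (d := d) p one_ne_zero
  | insert b S hb ih =>
    rw [Finset.prod_insert hb]
    exact (hF b (by simp)).mul (ih fun c hc => hF c (by simp [hc]))

/-- In the grading by the sum of coordinates, the factor of `c` has zeros and poles at most two
levels above `c`, and level two is reached only at `c + (1, 1)`. For `b` of maximal level the point
`b + (1, 1)` is therefore a zero of the first product, while the second is regular and nonzero
there. -/
theorem prod_affineRoot_inv_ne (h : Generic q d) {S T : Finset Box} {b : Box} (hb : b ∈ S)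
    (hbT : b ∉ T) (hS : ∀ c ∈ S, c.1 + c.2 ≤ b.1 + b.2) (hT : ∀ c ∈ T, c.1 + c.2 ≤ b.1 + b.2) :
    ∏ c ∈ S, (affineRoot q d (color c) (pos q d c) (color b))⁻¹ ≠
      ∏ c ∈ T, (affineRoot q d (color c) (pos q d c) (color b))⁻¹ := by
  intro heq
  set p : Box := (b.1 + 1, b.2 + 1) with hp
  obtain ⟨r, hr, hT⟩ := IsUnitAt.prod (q := q) (d := d) (p := p) T fun c hc =>
    isUnitAt_affineRoot_inv h (hT c hc) (fun h => hbT (h ▸ hc)) p hp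
  obtain ⟨s, hs, hS⟩ := IsUnitAt.prod (q := q) (d := d) (p := p) (S.erase b) fun c hc =>
    isUnitAt_affineRoot_inv h (hS c (Finset.mem_of_mem_erase hc)) (Finset.ne_of_mem_erase hc)
      p hp
  have hg : gBox q d b p ≠ 0 := by
    rw [Ne, gBox_eq_zero_iff h]
    simp only [hp]
    omega
  have hcol : color p = color b := (color_add_add b.1 b.2).symm
  have h1 := (hasLead_affineRoot_inv hg).mul (nonAlg_point _) (hcol ▸ hS)
  rw [hcol, Finset.mul_prod_erase S
    (fun c => (affineRoot q d (color c) (pos q d c) (color b))⁻¹) hb, heq] at h1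
  refine hr (hT.unique h1 |>.trans ?_)
  have h0 : gBox q d p b = 0 := by
    rw [gBox_eq_zero_iff h]
    simp [hp]
  rw [eta, h0]
  simp

/-- Distinct partitions have distinct `ℓ`-weights. -/
theorem phi_injective (h : Generic q d) : Function.Injective (phi q d) := by
  intro lam mu heq
  by_contra hne
  have hne' : lam.cells ≠ mu.cells := fun h => hne (YoungDiagram.ext h)
  have hD : (symmDiff lam.cells mu.cells).Nonempty := by
    rw [Finset.nonempty_iff_ne_empty, Ne, ← Finset.bot_eq_empty, symmDiff_eq_bot]
    exact hne'
  obtain ⟨b, hb, hmax⟩ := Finset.exists_max_image _ (fun c : Box => c.1 + c.2) hD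
  have hprod : ∏ c ∈ lam.cells \ mu.cells, (affineRoot q d (color c) (pos q d c) (color b))⁻¹ =
      ∏ c ∈ mu.cells \ lam.cells, (affineRoot q d (color c) (pos q d c) (color b))⁻¹ := by
    have h1 := congrFun heq (color b)
    have hne0 : ∀ c : Box, (affineRoot q d (color c) (pos q d c) (color b))⁻¹ ≠ 0 := by
      intro c
      by_cases hc : color c = color b
      · rw [← hc, affineRoot_inv_self h]
        exact mul_ne_zero (C_ne_zero (inv_ne_zero h.q2_ne))
          (div_ne_zero (lin_ne_zero _) (lin_ne_zero _))
      · rw [affineRoot_inv_of_ne h _ (Ne.symm hc)]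
        exact mul_ne_zero (C_ne_zero h.q2_ne) (div_ne_zero
          (mul_ne_zero (lin_ne_zero _) (lin_ne_zero _))
          (mul_ne_zero (lin_ne_zero _) (lin_ne_zero _)))
    have hPsi : Psi q (color b) ≠ 0 := by
      generalize color b = i
      fin_cases i
      · change Psi q 0 ≠ 0
        rw [Psi_zero h]
        exact mul_ne_zero (C_ne_zero h.q_ne) (div_ne_zero (lin_ne_zero _) (lin_ne_zero _))
      · change Psi q 1 ≠ 0
        rw [Psi_one]
        exact one_ne_zero
    rw [phi, phi, mul_right_inj' hPsi, ← Finset.prod_inter_mul_prod_sdiff lam.cells mu.cells,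
      ← Finset.prod_inter_mul_prod_sdiff mu.cells lam.cells, Finset.inter_comm mu.cells] at h1
    exact mul_left_cancel₀ (Finset.prod_ne_zero_iff.2 fun c _ => hne0 c) h1
  have hS : ∀ c ∈ lam.cells \ mu.cells, c.1 + c.2 ≤ b.1 + b.2 := fun c hc =>
    hmax c (Finset.mem_symmDiff.2 (Or.inl (Finset.mem_sdiff.1 hc)))
  have hT : ∀ c ∈ mu.cells \ lam.cells, c.1 + c.2 ≤ b.1 + b.2 := fun c hc =>
    hmax c (Finset.mem_symmDiff.2 (Or.inr (Finset.mem_sdiff.1 hc)))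
  rcases Finset.mem_symmDiff.1 hb with hb | hb
  · exact prod_affineRoot_inv_ne h (Finset.mem_sdiff.2 hb) (by simp [hb.1, hb.2]) hS hT hprod
  · exact prod_affineRoot_inv_ne h (Finset.mem_sdiff.2 hb) (by simp [hb.1, hb.2]) hT hS hprod.symm

/-! ### The Serre relation from the exchange relations -/

section serre

variable {A : Type*} [Ring A] [Algebra ℂ A]

/-- The expansion of one summand of the Serre relation, up to symmetrization. -/
def serreTerm (t : ℂ) (a b c y : A) : A :=
  a * (b * (c * y)) - (t + 1 + t⁻¹) • (a * (b * (y * c))) + (t + 1 + t⁻¹) • (a * (y * (b * c))) -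
    y * (a * (b * c))

/-- The expansion of the Serre relation. -/
def serreSum (t : ℂ) (a b c y : A) : A :=
  serreTerm t a b c y + serreTerm t a c b y + serreTerm t b a c y + serreTerm t b c a y +
    serreTerm t c a b y + serreTerm t c b a y

theorem serreSum_swap₁ (t : ℂ) (a b c y : A) : serreSum t a b c y = serreSum t b a c y := by
  unfold serreSum
  abel

theorem serreSum_swap₂ (t : ℂ) (a b c y : A) : serreSum t a b c y = serreSum t a c b y := by
  unfold serreSum
  abel

theorem univ_perm_three : (Finset.univ : Finset (Equiv.Perm (Fin 3))) =
    {1, Equiv.swap 0 1, Equiv.swap 0 2, Equiv.swap 1 2, Equiv.swap 0 1 * Equiv.swap 1 2,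
      Equiv.swap 1 2 * Equiv.swap 0 1} := by
  decide

theorem serre_eq_serreSum (q : ℂ) (hq : q ≠ 0) (X Y : ℤ → A) (k : Fin 3 → ℤ) (l : ℤ) :
    serre q X Y k l =
      ((Nat.factorial 3 : ℂ)⁻¹) • serreSum (q ^ 2) (X (k 0)) (X (k 1)) (X (k 2)) (Y l) := by
  rw [serre]
  congr 1
  have hsum : ∀ f : Equiv.Perm (Fin 3) → A, ∑ s, f s = f 1 + f (Equiv.swap 0 1) +
      f (Equiv.swap 0 2) + f (Equiv.swap 1 2) + f (Equiv.swap 0 1 * Equiv.swap 1 2) +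
      f (Equiv.swap 1 2 * Equiv.swap 0 1) := by
    intro f
    rw [univ_perm_three, Finset.sum_insert (by decide), Finset.sum_insert (by decide),
      Finset.sum_insert (by decide), Finset.sum_insert (by decide), Finset.sum_insert (by decide),
      Finset.sum_singleton]
    abel
  have e1 : ∀ i : Fin 3, (1 : Equiv.Perm (Fin 3)) i = i := fun _ => rfl
  have e2 : (Equiv.swap (0 : Fin 3) 1) 2 = 2 := by decide
  have e3 : (Equiv.swap (0 : Fin 3) 2) 1 = 1 := by decide
  have e4 : (Equiv.swap (1 : Fin 3) 2) 0 = 0 := by decide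
  rw [hsum]
  simp only [e1, e2, e3, e4, Equiv.Perm.mul_apply, Equiv.swap_apply_left, Equiv.swap_apply_right]
  have hq2 : q ^ (-2 : ℤ) = (q ^ 2)⁻¹ := by rw [zpow_neg]; rfl
  have ht : q ^ 2 ≠ 0 := pow_ne_zero _ hq
  rw [hq2]
  generalize q ^ 2 = t at ht
  generalize X (k 0) = a
  generalize X (k 1) = b
  generalize X (k 2) = c
  generalize Y l = y
  simp only [serreSum, serreTerm, qComm, mul_sub, sub_mul, mul_assoc, one_smul, smul_sub,
    mul_smul_comm, smul_mul_assoc, smul_smul, inv_mul_cancel₀ ht]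
  -- Expanding the nested commutators gives eight words. After symmetrization the three words with
  -- `y` in a given inner position combine, and their coefficients add up to `t + 1 + t⁻¹` up to
  -- sign.
  match_scalars <;> field_simp <;> ring

variable {ι : Type*} {q1 q3 t w : ℂ} {z : ι → ℂ} {x : ι → A} {y : A}

/-- The exchange relations between three currents of one color and a current of the other color,
at fixed values of the variables. -/
structure SerreData (q1 q3 t w : ℂ) (z : ι → ℂ) (x : ι → A) (y : A) : Prop where
  t_ne : t ≠ 0
  mul_eq : q1 * q3 = t⁻¹
  ne (i j : ι) : z i - t * z j ≠ 0
  xx (i j : ι) : (z i - t * z j) • (x i * x j) = (-(z j - t * z i)) • (x j * x i)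
  xy (i : ι) : ((z i - q1 * w) * (z i - q3 * w)) • (x i * y) =
    ((w - q1 * z i) * (w - q3 * z i)) • (y * x i)
  uv (i : ι) : (w - q1 * z i) * (w - q3 * z i) = 0 → (z i - q1 * w) * (z i - q3 * w) ≠ 0

theorem SerreData.ne' (h : SerreData q1 q3 t w z x y) (i j : ι) : q1 * q3 * z j - z i ≠ 0 := by
  have h1 := h.ne j i
  have ht := h.t_ne
  rw [h.mul_eq]
  contrapose! h1
  field_simp at h1
  linear_combination h1

theorem SerreData.swap (h : SerreData q1 q3 t w z x y) (i j : ι) :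
    x j * x i = (-(q1 * q3 * z i - z j) / (q1 * q3 * z j - z i)) • (x i * x j) := by
  rw [div_eq_inv_mul, mul_smul, eq_inv_smul_iff₀ (h.ne' i j)]
  have h1 := congrArg (fun m => t⁻¹ • m) (h.xx j i)
  simp only [smul_smul] at h1
  have ht := h.t_ne
  rw [h.mul_eq]
  convert h1 using 2 <;> field_simp

/-- `(w - q₁ z) (w - q₃ z)`. -/
def uFun (q1 q3 w z : ℂ) : ℂ := (w - q1 * z) * (w - q3 * z)

theorem SerreData.move (h : SerreData q1 q3 t w z x y) {i : ι} (hu : uFun q1 q3 w (z i) ≠ 0) :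
    y * x i = (uFun q1 q3 (z i) w / uFun q1 q3 w (z i)) • (x i * y) := by
  rw [div_eq_inv_mul, mul_smul, eq_inv_smul_iff₀ hu]
  exact (h.xy i).symm

theorem SerreData.zero (h : SerreData q1 q3 t w z x y) {i : ι} (hu : uFun q1 q3 w (z i) = 0) :
    x i * y = 0 := by
  have h1 := h.xy i
  rw [uFun] at hu
  rw [hu, zero_smul] at h1
  exact (smul_eq_zero.1 h1).resolve_left (h.uv i hu)

theorem mul_left_of_eq {a b c e : A} {r : ℂ} (h : a * b = r • (c * e)) (m : A) :
    a * (b * m) = r • (c * (e * m)) := by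
  rw [← mul_assoc, h, smul_mul_assoc, mul_assoc]

omit [Algebra ℂ A] in
theorem mul_left_of_eq_zero {a b : A} (h : a * b = 0) (m : A) : a * (b * m) = 0 := by
  rw [← mul_assoc, h, zero_mul]

/-- In this and the next three lemmas the index counts the `x` factors which vanish when multiplied
by `y` on the right. The others are moved to the left of `y`, so the surviving word has `y` before
exactly the degenerate factors. -/
theorem serreSum_case₀ {x1 x2 x3 : A} {a b c r1 r2 r3 : ℂ} (h12 : x2 * x1 = a • (x1 * x2))
    (h13 : x3 * x1 = b • (x1 * x3)) (h23 : x3 * x2 = c • (x2 * x3))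
    (h1 : y * x1 = r1 • (x1 * y)) (h2 : y * x2 = r2 • (x2 * y)) (h3 : y * x3 = r3 • (x3 * y)) :
    serreSum t x1 x2 x3 y =
      ((1 + c + a + a * b + b * c + a * b * c) * (1 - r1 * r2 * r3) - (t + 1 + t⁻¹) *
        ((1 - r2) * r3 + c * (1 - r3) * r2 + a * (1 - r1) * r3 + a * b * (1 - r3) * r1 +
          b * c * (1 - r1) * r2 + a * b * c * (1 - r2) * r1)) • (x1 * (x2 * (x3 * y))) := by
  have h12' := mul_left_of_eq h12
  have h13' := mul_left_of_eq h13
  have h23' := mul_left_of_eq h23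
  have h1' := mul_left_of_eq h1
  have h2' := mul_left_of_eq h2
  simp only [serreSum, serreTerm, h12, h13, h23, h12', h13', h23', h1, h2, h3, h1', h2',
    mul_smul_comm, smul_smul]
  module

theorem serreSum_case₁ {x1 x2 x3 : A} {a b c r1 r2 : ℂ} (h12 : x2 * x1 = a • (x1 * x2))
    (h13 : x3 * x1 = b • (x1 * x3)) (h23 : x3 * x2 = c • (x2 * x3))
    (h1 : y * x1 = r1 • (x1 * y)) (h2 : y * x2 = r2 • (x2 * y)) (h3 : x3 * y = 0) :
    serreSum t x1 x2 x3 y =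
      ((t + 1 + t⁻¹) * (-1 - a + (1 + c) * r2 + a * (1 + b) * r1) -
        (1 + c + a + a * b + b * c + a * b * c) * r1 * r2) • (x1 * (x2 * (y * x3))) := by
  have h12' := mul_left_of_eq h12
  have h13' := mul_left_of_eq h13
  have h23' := mul_left_of_eq h23
  have h1' := mul_left_of_eq h1
  have h2' := mul_left_of_eq h2
  simp only [serreSum, serreTerm, h12, h13, h23, h12', h13', h23', h1, h2, h3, h1', h2',
    mul_smul_comm, smul_smul, mul_zero, smul_zero]
  module

theorem serreSum_case₂ {x1 x2 x3 : A} {a b c r1 : ℂ} (h12 : x2 * x1 = a • (x1 * x2))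
    (h13 : x3 * x1 = b • (x1 * x3)) (h23 : x3 * x2 = c • (x2 * x3))
    (h1 : y * x1 = r1 • (x1 * y)) (h2 : x2 * y = 0) (h3 : x3 * y = 0) :
    serreSum t x1 x2 x3 y =
      ((t + 1 + t⁻¹) * (1 + c) - (1 + c + a + a * b + b * c + a * b * c) * r1) •
        (x1 * (y * (x2 * x3))) := by
  have h12' := mul_left_of_eq h12
  have h13' := mul_left_of_eq h13
  have h1' := mul_left_of_eq h1
  have h2' := mul_left_of_eq_zero h2
  have h3' := mul_left_of_eq_zero h3
  simp only [serreSum, serreTerm, h12, h13, h23, h12', h13', h1, h2, h3, h1', h2', h3',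
    mul_smul_comm, smul_smul, mul_zero, smul_zero]
  module

theorem serreSum_case₃ {x1 x2 x3 : A} {a b c : ℂ} (h12 : x2 * x1 = a • (x1 * x2))
    (h13 : x3 * x1 = b • (x1 * x3)) (h23 : x3 * x2 = c • (x2 * x3))
    (h1 : x1 * y = 0) (h2 : x2 * y = 0) (h3 : x3 * y = 0) :
    serreSum t x1 x2 x3 y =
      (-(1 + c + a + a * b + b * c + a * b * c)) • (y * (x1 * (x2 * x3))) := by
  have h12' := mul_left_of_eq h12
  have h13' := mul_left_of_eq h13
  have h1' := mul_left_of_eq_zero h1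
  have h2' := mul_left_of_eq_zero h2
  have h3' := mul_left_of_eq_zero h3
  simp only [serreSum, serreTerm, h12, h13, h23, h12', h13', h1, h2, h3, h1', h2', h3',
    mul_smul_comm, smul_smul, mul_zero, smul_zero]
  module

/-- The generic form of the Serre identity, with `t = (q1 * q3)⁻¹`. Only the product and the sum of
`q1` and `q3` enter, which keeps the polynomial identity manageable. -/
theorem serre_scalar₀ {q1 q3 w z1 z2 z3 : ℂ} (h1' : q1 ≠ 0) (h3' : q3 ≠ 0)
    (h12 : q1 * q3 * z2 - z1 ≠ 0) (h13 : q1 * q3 * z3 - z1 ≠ 0) (h23 : q1 * q3 * z3 - z2 ≠ 0)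
    {a b c r1 r2 r3 : ℂ}
    (ha : a = -(q1 * q3 * z1 - z2) / (q1 * q3 * z2 - z1))
    (hb : b = -(q1 * q3 * z1 - z3) / (q1 * q3 * z3 - z1))
    (hc : c = -(q1 * q3 * z2 - z3) / (q1 * q3 * z3 - z2))
    (h1 : uFun q1 q3 w z1 ≠ 0) (h2 : uFun q1 q3 w z2 ≠ 0) (h3 : uFun q1 q3 w z3 ≠ 0)
    (hr1 : r1 = uFun q1 q3 z1 w / uFun q1 q3 w z1)
    (hr2 : r2 = uFun q1 q3 z2 w / uFun q1 q3 w z2)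
    (hr3 : r3 = uFun q1 q3 z3 w / uFun q1 q3 w z3) :
    (1 + c + a + a * b + b * c + a * b * c) * (1 - r1 * r2 * r3) -
      ((q1 * q3)⁻¹ + 1 + ((q1 * q3)⁻¹)⁻¹) *
        ((1 - r2) * r3 + c * (1 - r3) * r2 + a * (1 - r1) * r3 + a * b * (1 - r3) * r1 +
          b * c * (1 - r1) * r2 + a * b * c * (1 - r2) * r1) = 0 := by
  have key : ∀ w z, uFun q1 q3 w z = w ^ 2 - (q1 + q3) * w * z + q1 * q3 * z ^ 2 := by
    intro w z
    rw [uFun]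
    ring
  have hs : q1 * q3 ≠ 0 := mul_ne_zero h1' h3'
  simp only [key] at *
  generalize q1 * q3 = s at *
  generalize q1 + q3 = e at *
  rw [ha, hb, hc, hr1, hr2, hr3]
  generalize hu1 : w ^ 2 - e * w * z1 + s * z1 ^ 2 = u1 at *
  generalize hu2 : w ^ 2 - e * w * z2 + s * z2 ^ 2 = u2 at *
  generalize hu3 : w ^ 2 - e * w * z3 + s * z3 ^ 2 = u3 at *
  rw [inv_inv]
  field_simp
  rw [← hu1, ← hu2, ← hu3]
  ring

theorem serre_scalar₁ {q1 q3 w z1 z2 z3 : ℂ} (h1' : q1 ≠ 0) (h3' : q3 ≠ 0)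
    (h12 : q1 * q3 * z2 - z1 ≠ 0) (h13 : q1 * q3 * z3 - z1 ≠ 0) (h23 : q1 * q3 * z3 - z2 ≠ 0)
    {a b c r1 r2 : ℂ}
    (ha : a = -(q1 * q3 * z1 - z2) / (q1 * q3 * z2 - z1))
    (hb : b = -(q1 * q3 * z1 - z3) / (q1 * q3 * z3 - z1))
    (hc : c = -(q1 * q3 * z2 - z3) / (q1 * q3 * z3 - z2))
    (h1 : uFun q1 q3 w z1 ≠ 0) (h2 : uFun q1 q3 w z2 ≠ 0) (h3 : uFun q1 q3 w z3 = 0)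
    (hr1 : r1 = uFun q1 q3 z1 w / uFun q1 q3 w z1)
    (hr2 : r2 = uFun q1 q3 z2 w / uFun q1 q3 w z2) :
    ((q1 * q3)⁻¹ + 1 + ((q1 * q3)⁻¹)⁻¹) * (-1 - a + (1 + c) * r2 + a * (1 + b) * r1) -
        (1 + c + a + a * b + b * c + a * b * c) * r1 * r2 = 0 := by
  -- The identity is symmetric in `q1` and `q3`, so one of the two roots suffices.
  wlog hw : w = q1 * z3 generalizing q1 q3
  · have hsymm : ∀ w z, uFun q1 q3 w z = uFun q3 q1 w z := fun w z => mul_comm _ _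
    simp only [hsymm, mul_comm q1 q3] at *
    refine this h3' h1' h12 h13 h23 ha hb hc h1 h2 h3 hr1 hr2 ?_
    rcases mul_eq_zero.1 h3 with h | h
    · exact sub_eq_zero.1 h
    · exact absurd (sub_eq_zero.1 h) hw
  have hs : q1 * q3 ≠ 0 := mul_ne_zero h1' h3'
  rw [ha, hb, hc, hr1, hr2]
  rw [inv_inv]
  generalize hu1 : uFun q1 q3 w z1 = u1 at *
  generalize hu2 : uFun q1 q3 w z2 = u2 at *
  field_simp
  rw [← hu1, ← hu2, hw]
  simp only [uFun]
  ring

/-- Currents of one color anticommute at equal arguments, so the symmetrized product of the three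
vanishes. -/
theorem serre_scalar_of_eq {s z1 z2 z3 : ℂ} (h12 : s * z2 - z1 ≠ 0) (h13 : s * z3 - z1 ≠ 0)
    (h23 : s * z3 - z2 ≠ 0) {a b c : ℂ} (ha : a = -(s * z1 - z2) / (s * z2 - z1))
    (hb : b = -(s * z1 - z3) / (s * z3 - z1)) (hc : c = -(s * z2 - z3) / (s * z3 - z2))
    (h : z1 = z2 ∨ z1 = z3 ∨ z2 = z3) : 1 + c + a + a * b + b * c + a * b * c = 0 := by
  rcases h with rfl | rfl | rfl
  · have ha' : a = -1 := by rw [ha, neg_div, div_self h12]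
    rw [ha', hb, ← hc]
    ring
  · have hb' : b = -1 := by rw [hb, neg_div, div_self h13]
    have hac : a * c = 1 := by
      rw [ha, hc]
      field_simp
    rw [hb']
    linear_combination -hac
  · have hc' : c = -1 := by rw [hc, neg_div, div_self h23]
    rw [hc', ha, ← hb]
    ring

theorem serre_scalar₂ {q1 q3 w z1 z2 z3 : ℂ} (h1' : q1 ≠ 0) (h3' : q3 ≠ 0)
    (h12 : q1 * q3 * z2 - z1 ≠ 0) (h13 : q1 * q3 * z3 - z1 ≠ 0) (h23 : q1 * q3 * z3 - z2 ≠ 0)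
    {a b c r1 : ℂ}
    (ha : a = -(q1 * q3 * z1 - z2) / (q1 * q3 * z2 - z1))
    (hb : b = -(q1 * q3 * z1 - z3) / (q1 * q3 * z3 - z1))
    (hc : c = -(q1 * q3 * z2 - z3) / (q1 * q3 * z3 - z2))
    (h1 : uFun q1 q3 w z1 ≠ 0) (h2 : uFun q1 q3 w z2 = 0) (h3 : uFun q1 q3 w z3 = 0)
    (hr1 : r1 = uFun q1 q3 z1 w / uFun q1 q3 w z1) :
    ((q1 * q3)⁻¹ + 1 + ((q1 * q3)⁻¹)⁻¹) * (1 + c) -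
      (1 + c + a + a * b + b * c + a * b * c) * r1 = 0 := by
  by_cases h0 : z2 = z3
  · have hc' : c = -1 := by
      rw [hc, h0, neg_div, div_self]
      rwa [h0] at h23
    rw [serre_scalar_of_eq h12 h13 h23 ha hb hc (Or.inr (Or.inr h0)), hc']
    ring
  wlog hw : w = q1 * z2 generalizing q1 q3
  · have hsymm : ∀ w z, uFun q1 q3 w z = uFun q3 q1 w z := fun w z => mul_comm _ _
    simp only [hsymm, mul_comm q1 q3] at *
    refine this h3' h1' h12 h13 h23 ha hb hc h1 h2 h3 hr1 ?_
    rcases mul_eq_zero.1 h2 with h | h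
    · exact sub_eq_zero.1 h
    · exact absurd (sub_eq_zero.1 h) hw
  have hw' : q1 * z2 = q3 * z3 := by
    rcases mul_eq_zero.1 h3 with h | h
    · rw [hw, sub_eq_zero] at h
      exact absurd (mul_left_cancel₀ h1' h) h0
    · rwa [hw, sub_eq_zero] at h
  -- Distinct `z2` and `z3` are the two different roots. The parameter `m` resolves `q1 * z2 = q3 *
  -- z3`, after which the identity is polynomial in free variables.
  obtain ⟨m, hz2⟩ : ∃ m, z2 = q3 * m := ⟨z2 / q3, by field_simp⟩
  have hz3 : z3 = q1 * m := by
    apply mul_left_cancel₀ h3'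
    rw [← hw', hz2]
    ring
  rw [ha, hb, hc, hr1, inv_inv]
  generalize hu1 : uFun q1 q3 w z1 = u1 at *
  generalize hD1 : q1 * q3 * z2 - z1 = D1 at *
  generalize hD2 : q1 * q3 * z3 - z1 = D2 at *
  generalize hD3 : q1 * q3 * z3 - z2 = D3 at *
  field_simp
  rw [← hu1, ← hD1, ← hD2, ← hD3, hw, hz2, hz3]
  simp only [uFun]
  ring

/-- Pigeonhole: for fixed `w` there are at most the two roots `w / q1` and `w / q3`. -/
theorem serre_scalar₃ {q1 q3 w z1 z2 z3 : ℂ} (h1' : q1 ≠ 0) (h3' : q3 ≠ 0)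
    (h1 : uFun q1 q3 w z1 = 0) (h2 : uFun q1 q3 w z2 = 0) (h3 : uFun q1 q3 w z3 = 0) :
    z1 = z2 ∨ z1 = z3 ∨ z2 = z3 := by
  have key : ∀ z, uFun q1 q3 w z = 0 → z = w / q1 ∨ z = w / q3 := by
    intro z hz
    rcases mul_eq_zero.1 hz with h | h
    · left
      rw [eq_div_iff h1']
      linear_combination -h
    · right
      rw [eq_div_iff h3']
      linear_combination -h
  rcases key z1 h1 with h1 | h1 <;> rcases key z2 h2 with h2 | h2 <;>
    rcases key z3 h3 with h3 | h3 <;> simp [h1, h2, h3]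

/-- The Serre relation follows from the exchange relations, as long as these are nondegenerate
for the currents of equal color. -/
theorem SerreData.serreSum_eq_zero (h : SerreData q1 q3 t w z x y) (i j k : ι) :
    serreSum t (x i) (x j) (x k) y = 0 := by
  have ht : t = (q1 * q3)⁻¹ := by rw [h.mul_eq, inv_inv]
  have hs : q1 * q3 ≠ 0 := by rw [h.mul_eq]; exact inv_ne_zero h.t_ne
  have h1' := left_ne_zero_of_mul hs
  have h3' := right_ne_zero_of_mul hs
  have c₀ : ∀ i j k, uFun q1 q3 w (z i) ≠ 0 → uFun q1 q3 w (z j) ≠ 0 → uFun q1 q3 w (z k) ≠ 0 →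
      serreSum t (x i) (x j) (x k) y = 0 := by
    intro i j k hi hj hk
    rw [serreSum_case₀ (h.swap i j) (h.swap i k) (h.swap j k) (h.move hi) (h.move hj) (h.move hk),
      ht, serre_scalar₀ h1' h3' (h.ne' i j) (h.ne' i k) (h.ne' j k) rfl rfl rfl hi hj hk
        rfl rfl rfl, zero_smul]
  have c₁ : ∀ i j k, uFun q1 q3 w (z i) ≠ 0 → uFun q1 q3 w (z j) ≠ 0 → uFun q1 q3 w (z k) = 0 →
      serreSum t (x i) (x j) (x k) y = 0 := by
    intro i j k hi hj hk
    rw [serreSum_case₁ (h.swap i j) (h.swap i k) (h.swap j k) (h.move hi) (h.move hj) (h.zero hk),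
      ht, serre_scalar₁ h1' h3' (h.ne' i j) (h.ne' i k) (h.ne' j k) rfl rfl rfl hi hj hk
        rfl rfl, zero_smul]
  have c₂ : ∀ i j k, uFun q1 q3 w (z i) ≠ 0 → uFun q1 q3 w (z j) = 0 → uFun q1 q3 w (z k) = 0 →
      serreSum t (x i) (x j) (x k) y = 0 := by
    intro i j k hi hj hk
    rw [serreSum_case₂ (h.swap i j) (h.swap i k) (h.swap j k) (h.move hi) (h.zero hj) (h.zero hk),
      ht, serre_scalar₂ h1' h3' (h.ne' i j) (h.ne' i k) (h.ne' j k) rfl rfl rfl hi hj hk rfl,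
      zero_smul]
  have c₃ : uFun q1 q3 w (z i) = 0 → uFun q1 q3 w (z j) = 0 → uFun q1 q3 w (z k) = 0 →
      serreSum t (x i) (x j) (x k) y = 0 := by
    intro hi hj hk
    rw [serreSum_case₃ (h.swap i j) (h.swap i k) (h.swap j k) (h.zero hi) (h.zero hj) (h.zero hk),
      serre_scalar_of_eq (h.ne' i j) (h.ne' i k) (h.ne' j k) rfl rfl rfl
        (serre_scalar₃ h1' h3' hi hj hk), neg_zero, zero_smul]
  -- The sum is symmetric in the three currents, so the degenerate ones may be placed last.
  by_cases hi : uFun q1 q3 w (z i) = 0 <;> by_cases hj : uFun q1 q3 w (z j) = 0 <;>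
    by_cases hk : uFun q1 q3 w (z k) = 0
  · exact c₃ hi hj hk
  · rw [serreSum_swap₂, serreSum_swap₁]; exact c₂ k i j hk hi hj
  · rw [serreSum_swap₁]; exact c₂ j i k hj hi hk
  · rw [serreSum_swap₁, serreSum_swap₂]; exact c₁ j k i hj hk hi
  · exact c₂ i j k hi hj hk
  · rw [serreSum_swap₂]; exact c₁ i k j hi hk hj
  · exact c₁ i j k hi hj hk
  · exact c₀ i j k hi hj hk

end serre

/-! ### Operators adding or removing one box -/

/-- Endomorphisms of the Fock space. -/
abbrev FockEnd : Type := Module.End ℂ FockSpace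

theorem fockEnd_ext {A B : FockEnd} (h : ∀ lam, A (ket lam) = B (ket lam)) : A = B :=
  Finsupp.lhom_ext' fun lam => LinearMap.ext_ring (h lam)

/-- The endomorphism with prescribed values on the basis. -/
def ofKet (f : YoungDiagram → FockSpace) : FockEnd := Finsupp.linearCombination ℂ f

theorem ofKet_ket (f : YoungDiagram → FockSpace) (lam : YoungDiagram) :
    ofKet f (ket lam) = f lam := by
  simp [ofKet, ket]

open Classical in
/-- The component of `E` which removes the box `b`. -/
def eOp (q d : ℂ) (b : Box) : FockEnd :=
  ofKet fun lam => if Removable lam b then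
    coeffB q d (color b) lam b • ket (removeBox lam b) else 0

open Classical in
/-- The component of `F` which adds the box `b`. -/
def fOp (q d : ℂ) (b : Box) : FockEnd :=
  ofKet fun lam => if Addable lam b then coeffA q d (color b) lam b • ket (addBox lam b) else 0

theorem eOp_ket (h : Generic q d) {lam : YoungDiagram} {b : Box} (hb : Removable lam b) :
    eOp q d b (ket lam) = ((q - q⁻¹)⁻¹ * prodBefore q d lam.cells b) • ket (removeBox lam b) := by
  rw [eOp, ofKet_ket, if_pos hb, coeffB_eq h hb.nbrs_subset]

theorem eOp_ket_of_not {lam : YoungDiagram} {b : Box} (hb : ¬ Removable lam b) :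
    eOp q d b (ket lam) = 0 := by
  rw [eOp, ofKet_ket, if_neg hb]

theorem fOp_ket (h : Generic q d) {lam : YoungDiagram} {b : Box} (hb : Addable lam b) :
    fOp q d b (ket lam) = prodAfter q d lam.cells b • ket (addBox lam b) := by
  rw [fOp, ofKet_ket, if_pos hb, coeffA_eq h hb.1]

theorem fOp_ket_of_not {lam : YoungDiagram} {b : Box} (hb : ¬ Addable lam b) :
    fOp q d b (ket lam) = 0 := by
  rw [fOp, ofKet_ket, if_neg hb]

/-! ### Coefficients after adding a box -/

theorem prodAfter_insert {S : Finset Box} {b c : Box} (hc : c ∉ S) (h : Before b c) :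
    prodAfter q d (insert c S) b = eta q d c b * prodAfter q d S b := by
  rw [prodAfter, prodAfter, Finset.filter_insert, if_pos h, Finset.prod_insert (by simp [hc])]

theorem prodAfter_insert_of_not {S : Finset Box} {b c : Box} (h : ¬ Before b c) :
    prodAfter q d (insert c S) b = prodAfter q d S b := by
  rw [prodAfter, prodAfter, Finset.filter_insert, if_neg h]

theorem prodBefore_insert {S : Finset Box} {b c : Box} (hc : c ∉ S) (h : Before c b)
    (hn : c ∉ nbrs b) : prodBefore q d (insert c S) b = eta q d c b * prodBefore q d S b := by
  rw [prodBefore, prodBefore, Finset.filter_insert, if_pos ⟨h, hn⟩,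
    Finset.prod_insert (by simp [hc])]
  ring

theorem prodBefore_insert_of_not {S : Finset Box} {b c : Box} (h : ¬ Before c b) :
    prodBefore q d (insert c S) b = prodBefore q d S b := by
  rw [prodBefore, prodBefore, Finset.filter_insert, if_neg fun h' => h h'.1]

/-! ### Removing two boxes -/

/-- If `b` becomes removable only by the removal of `c`, then `c` is the next box in the row or
column of `b`, and there `gBox q d b c` vanishes. -/
theorem Removable.swap_or (h : Generic q d) {lam : YoungDiagram} {b c : Box}
    (hc : Removable lam c) (hb : Removable (removeBox lam c) b) :
    (Removable lam b ∧ Removable (removeBox lam b) c) ∨ gBox q d b c = 0 := by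
  rw [removable_iff, hc.cells] at hb
  simp only [Finset.mem_erase, not_and_or, not_not, Ne] at hb
  by_cases hb' : Removable lam b
  · left
    refine ⟨hb', ?_⟩
    rw [removable_iff] at hc ⊢
    rw [hb'.cells]
    simp only [Finset.mem_erase]
    exact ⟨⟨fun h => hb.1.1 h.symm, hc.1⟩, fun h => hc.2.1 h.2, fun h => hc.2.2 h.2⟩
  · right
    rw [removable_iff] at hb'
    rw [gBox_eq_zero_iff h]
    simp only [hb.1.2, true_and, not_and_or, not_not] at hb'
    rcases hb' with h1 | h1
    · have := hb.2.1.resolve_right (not_not.2 h1)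
      rw [← this]
      simp
    · have := hb.2.2.resolve_right (not_not.2 h1)
      rw [← this]
      simp

theorem Removable.removeBox_comm {lam : YoungDiagram} {b c : Box} (hb : Removable lam b)
    (hc : Removable lam c) (hcb : Removable (removeBox lam c) b)
    (hbc : Removable (removeBox lam b) c) :
    removeBox (removeBox lam c) b = removeBox (removeBox lam b) c := by
  ext1
  rw [hcb.cells, hbc.cells, hb.cells, hc.cells, Finset.erase_right_comm]

/-- The coefficient of the earlier box does not see the later one, while that of `c` contains `eta q
d b c` exactly when `b` is still present. The two orders therefore differ by this factor; an order
possible alone is killed by `Removable.swap_or`. -/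
theorem eOp_exchange_of_before (h : Generic q d) {b c : Box} (hbc : Before b c) :
    gBox q d b c • (eOp q d b * eOp q d c) =
      (sgn b c * gBox q d c b) • (eOp q d c * eOp q d b) := by
  refine fockEnd_ext fun lam => ?_
  simp only [LinearMap.smul_apply, Module.End.mul_apply]
  by_cases h1 : Removable lam c ∧ Removable (removeBox lam c) b
  · by_cases h2 : Removable lam b ∧ Removable (removeBox lam b) c
    · have hn : b ∉ nbrs c := by
        intro hn
        have := hbc
        have h3 := removable_iff.1 h1.2
        rw [mem_nbrs] at hn
        rw [removable_iff] at h2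
        have hc := h1.1.1
        rcases hn with hn | hn | hn
        · exact h2.1.2.1 (YoungDiagram_mem_of_le hc (by omega) (by omega))
        · exact h2.1.2.2 (YoungDiagram_mem_of_le hc (by omega) (by omega))
        · exact h2.1.2.1 (YoungDiagram_mem_of_le hc (by omega) (by omega))
      have hg := (gBox_ne_of_before h hbc hn).1
      rw [eOp_ket h h1.1, eOp_ket h h2.1, map_smul, map_smul, eOp_ket h h1.2, eOp_ket h h2.2,
        h2.1.removeBox_comm h1.1 h1.2 h2.2, smul_smul, smul_smul, smul_smul, smul_smul,
        h1.1.cells, h2.1.cells]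
      congr 1
      have e1 : prodBefore q d (lam.cells.erase c) b = prodBefore q d lam.cells b := by
        conv_rhs => rw [← Finset.insert_erase h1.1.1]
        rw [prodBefore_insert_of_not hbc.not_before]
      have e2 : prodBefore q d lam.cells c =
          eta q d b c * prodBefore q d (lam.cells.erase b) c := by
        conv_lhs => rw [← Finset.insert_erase h2.1.1]
        rw [prodBefore_insert (by simp) hbc hn]
      rw [e1, e2, eta]
      field_simp
    · rw [((h1.1.swap_or h h1.2).resolve_left h2), zero_smul]
      by_cases h3 : Removable lam b
      · rw [eOp_ket h h3, map_smul, eOp_ket_of_not fun h4 => h2 ⟨h3, h4⟩, smul_zero, smul_zero]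
      · rw [eOp_ket_of_not h3, map_zero, smul_zero]
  · have e1 : eOp q d b (eOp q d c (ket lam)) = 0 := by
      by_cases h3 : Removable lam c
      · rw [eOp_ket h h3, map_smul, eOp_ket_of_not fun h4 => h1 ⟨h3, h4⟩, smul_zero]
      · rw [eOp_ket_of_not h3, map_zero]
    rw [e1, smul_zero]
    by_cases h2 : Removable lam b ∧ Removable (removeBox lam b) c
    · rw [((h2.1.swap_or h h2.2).resolve_left h1), mul_zero, zero_smul]
    · by_cases h3 : Removable lam b
      · rw [eOp_ket h h3, map_smul, eOp_ket_of_not fun h4 => h2 ⟨h3, h4⟩, smul_zero, smul_zero]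
      · rw [eOp_ket_of_not h3, map_zero, smul_zero]

theorem eOp_mul_self (h : Generic q d) (b : Box) : eOp q d b * eOp q d b = 0 := by
  refine fockEnd_ext fun lam => ?_
  rw [Module.End.mul_apply, LinearMap.zero_apply]
  by_cases h3 : Removable lam b
  · rw [eOp_ket h h3, map_smul, eOp_ket_of_not, smul_zero]
    intro h4
    have := h4.1
    rw [h3.cells] at this
    simp at this
  · rw [eOp_ket_of_not h3, map_zero]

theorem eOp_exchange (h : Generic q d) (b c : Box) :
    gBox q d b c • (eOp q d b * eOp q d c) =
      (sgn b c * gBox q d c b) • (eOp q d c * eOp q d b) := by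
  rcases before_trichotomy b c with hbc | rfl | hbc
  · exact eOp_exchange_of_before h hbc
  · rw [eOp_mul_self h, smul_zero, smul_zero]
  · have h1 := eOp_exchange_of_before h hbc
    rw [mul_smul, h1, smul_smul, ← mul_assoc, sgn_comm c b, sgn_mul_self, one_mul]

/-! ### Adding two boxes -/

/-- If `b` needs `c` to be added first, then `c` directly precedes it in its row or column, where
`gBox q d c b` vanishes. -/
theorem Addable.swap_or (h : Generic q d) {lam : YoungDiagram} {b c : Box}
    (hc : Addable lam c) (hb : Addable (addBox lam c) b) :
    (Addable lam b ∧ Addable (addBox lam b) c) ∨ gBox q d c b = 0 := by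
  rw [addable_iff, hc.cells] at hb
  simp only [Finset.mem_insert, not_or] at hb
  by_cases hb' : Addable lam b
  · left
    refine ⟨hb', ?_⟩
    rw [addable_iff] at hc ⊢
    rw [hb'.cells]
    simp only [Finset.mem_insert, not_or]
    exact ⟨⟨fun h => hb.1.1 h.symm, hc.1⟩, fun z hz => Or.inr (hc.2.1 z hz),
      fun x hx => Or.inr (hc.2.2 x hx)⟩
  · right
    rw [addable_iff] at hb'
    rw [gBox_eq_zero_iff h]
    simp only [hb.1.2, not_false_eq_true, true_and, not_and_or, not_forall] at hb'
    rcases hb' with ⟨z, hz, h1⟩ | ⟨x, hx, h1⟩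
    · have := (hb.2.1 z hz).resolve_right h1
      rw [← this]
      simp [hz]
    · have := (hb.2.2 x hx).resolve_right h1
      rw [← this]
      simp [hx]

theorem Addable.addBox_comm {lam : YoungDiagram} {b c : Box} (hb : Addable lam b)
    (hc : Addable lam c) (hcb : Addable (addBox lam c) b) (hbc : Addable (addBox lam b) c) :
    addBox (addBox lam c) b = addBox (addBox lam b) c := by
  ext1
  rw [hcb.cells, hbc.cells, hb.cells, hc.cells, Finset.insert_comm]

theorem fOp_exchange_of_before (h : Generic q d) {b c : Box} (hbc : Before b c) :
    gBox q d c b • (fOp q d b * fOp q d c) =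
      (sgn b c * gBox q d b c) • (fOp q d c * fOp q d b) := by
  refine fockEnd_ext fun lam => ?_
  simp only [LinearMap.smul_apply, Module.End.mul_apply]
  by_cases h1 : Addable lam c ∧ Addable (addBox lam c) b
  · by_cases h2 : Addable lam b ∧ Addable (addBox lam b) c
    · have hg := (gBox_ne_of_after h h1.2.1 (by simp [h1.1.cells]) hbc).1
      rw [fOp_ket h h1.1, fOp_ket h h2.1, map_smul, map_smul, fOp_ket h h1.2, fOp_ket h h2.2,
        h2.1.addBox_comm h1.1 h1.2 h2.2, smul_smul, smul_smul, smul_smul, smul_smul,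
        h1.1.cells, h2.1.cells, prodAfter_insert h1.1.1 hbc,
        prodAfter_insert_of_not hbc.not_before]
      congr 1
      rw [eta, sgn_comm c b]
      field_simp
    · rw [((h1.1.swap_or h h1.2).resolve_left h2), zero_smul]
      by_cases h3 : Addable lam b
      · rw [fOp_ket h h3, map_smul, fOp_ket_of_not fun h4 => h2 ⟨h3, h4⟩, smul_zero, smul_zero]
      · rw [fOp_ket_of_not h3, map_zero, smul_zero]
  · have e1 : fOp q d b (fOp q d c (ket lam)) = 0 := by
      by_cases h3 : Addable lam c
      · rw [fOp_ket h h3, map_smul, fOp_ket_of_not fun h4 => h1 ⟨h3, h4⟩, smul_zero]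
      · rw [fOp_ket_of_not h3, map_zero]
    rw [e1, smul_zero]
    by_cases h2 : Addable lam b ∧ Addable (addBox lam b) c
    · rw [((h2.1.swap_or h h2.2).resolve_left h1), mul_zero, zero_smul]
    · by_cases h3 : Addable lam b
      · rw [fOp_ket h h3, map_smul, fOp_ket_of_not fun h4 => h2 ⟨h3, h4⟩, smul_zero, smul_zero]
      · rw [fOp_ket_of_not h3, map_zero, smul_zero]

theorem fOp_mul_self (h : Generic q d) (b : Box) : fOp q d b * fOp q d b = 0 := by
  refine fockEnd_ext fun lam => ?_
  rw [Module.End.mul_apply, LinearMap.zero_apply]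
  by_cases h3 : Addable lam b
  · rw [fOp_ket h h3, map_smul, fOp_ket_of_not, smul_zero]
    intro h4
    have := h4.1
    rw [h3.cells] at this
    simp at this
  · rw [fOp_ket_of_not h3, map_zero]

theorem fOp_exchange (h : Generic q d) (b c : Box) :
    gBox q d c b • (fOp q d b * fOp q d c) =
      (sgn b c * gBox q d b c) • (fOp q d c * fOp q d b) := by
  rcases before_trichotomy b c with hbc | rfl | hbc
  · exact fOp_exchange_of_before h hbc
  · rw [fOp_mul_self h, smul_zero, smul_zero]
  · have h1 := fOp_exchange_of_before h hbc
    rw [mul_smul, h1, smul_smul, ← mul_assoc, sgn_comm c b, sgn_mul_self, one_mul]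

/-! ### Adding a box and removing another one -/

theorem Addable.removable_iff_of_ne {lam : YoungDiagram} {b c : Box} (hbc : b ≠ c) :
    (Addable lam b ∧ Removable (addBox lam b) c) ↔
      (Removable lam c ∧ Addable (removeBox lam c) b) := by
  constructor
  · rintro ⟨h1, h2⟩
    have h3 : Removable lam c := by
      rw [removable_iff, h1.cells] at h2
      simp only [Finset.mem_insert, not_or] at h2
      rw [removable_iff]
      exact ⟨h2.1.resolve_left hbc.symm, h2.2.1.2, h2.2.2.2⟩
    refine ⟨h3, ?_, removeBox (addBox lam b) c, ?_⟩
    · rw [h3.cells, Finset.mem_erase]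
      exact fun h => h1.1 h.2
    · rw [h2.cells, h1.cells, h3.cells, Finset.erase_insert_of_ne hbc]
  · rintro ⟨h1, h2⟩
    have h3 : Addable lam b := by
      rw [addable_iff, h1.cells] at h2
      simp only [Finset.mem_erase, not_and_or, not_not] at h2
      rw [addable_iff]
      exact ⟨h2.1.resolve_left hbc, fun z hz => (h2.2.1 z hz).2, fun x hx => (h2.2.2 x hx).2⟩
    refine ⟨h3, ?_, addBox (removeBox lam c) b, ?_⟩
    · rw [h3.cells, Finset.mem_insert]
      exact Or.inr h1.1
    · rw [h2.cells, h1.cells, h3.cells, Finset.erase_insert_of_ne hbc]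

/-- If `b` precedes `c`, adding `b` multiplies the coefficient of `c` by `eta q d b c`, and keeping
`c` multiplies that of `b` by `eta q d c b`; these are inverse to each other. If `c` precedes `b`,
neither coefficient sees the other box. -/
theorem eOp_mul_fOp (h : Generic q d) {b c : Box} (hbc : b ≠ c) :
    eOp q d c * fOp q d b = fOp q d b * eOp q d c := by
  refine fockEnd_ext fun lam => ?_
  simp only [Module.End.mul_apply]
  by_cases h1 : Addable lam b ∧ Removable (addBox lam b) c
  · have h2 := (Addable.removable_iff_of_ne hbc).1 h1
    have hdiag : removeBox (addBox lam b) c = addBox (removeBox lam c) b := by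
      ext1
      rw [h1.2.cells, h2.2.cells, h1.1.cells, h2.1.cells, Finset.erase_insert_of_ne hbc]
    rw [fOp_ket h h1.1, eOp_ket h h2.1, map_smul, map_smul, eOp_ket h h1.2, fOp_ket h h2.2,
      smul_smul, smul_smul, hdiag, h1.1.cells, h2.1.cells]
    congr 1
    have hcell : lam.cells = insert c (lam.cells.erase c) := (Finset.insert_erase h2.1.1).symm
    have hb := h1.1.1
    rcases before_trichotomy b c with hlt | rfl | hlt
    · have hn : b ∉ nbrs c := fun hn => hb (h2.1.nbrs_subset hn)
      have hg := gBox_ne_of_before h hlt hn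
      have e1 : prodAfter q d lam.cells b = eta q d c b * prodAfter q d (lam.cells.erase c) b := by
        conv_lhs => rw [hcell]
        rw [prodAfter_insert (by simp) hlt]
      rw [prodBefore_insert hb hlt hn, e1]
      linear_combination (prodAfter q d (lam.cells.erase c) b * (q - q⁻¹)⁻¹ *
        prodBefore q d lam.cells c) * eta_mul_eta hg.1 hg.2
    · exact absurd rfl hbc
    · have e1 : prodAfter q d lam.cells b = prodAfter q d (lam.cells.erase c) b := by
        conv_lhs => rw [hcell]
        rw [prodAfter_insert_of_not hlt.not_before]
      rw [prodBefore_insert_of_not hlt.not_before, e1]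
      ring
  · have h2 := fun h' => h1 ((Addable.removable_iff_of_ne hbc).2 h')
    trans 0
    · by_cases h3 : Addable lam b
      · rw [fOp_ket h h3, map_smul, eOp_ket_of_not fun h4 => h1 ⟨h3, h4⟩, smul_zero]
      · rw [fOp_ket_of_not h3, map_zero]
    · by_cases h3 : Removable lam c
      · rw [eOp_ket h h3, map_smul, fOp_ket_of_not fun h4 => h2 ⟨h3, h4⟩, smul_zero]
      · rw [eOp_ket_of_not h3, map_zero]

/-- A box is never both addable and removable, so at most one term acts. The coefficients of `E` and
`F` split the weight into preceding and following factors, and their product recovers its residue.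
-/
theorem eOp_fOp_sub (h : Generic q d) (lam : YoungDiagram) (b : Box) :
    (eOp q d b * fOp q d b - fOp q d b * eOp q d b) (ket lam) =
      if b ∈ concaveBoxes (color b) lam ∪ convexBoxes (color b) lam then
        ((q - q⁻¹)⁻¹ * resLog (pos q d b) (phi q d lam (color b))) • ket lam else 0 := by
  have hbb : ¬ Before b b := fun h => h.ne rfl
  rw [LinearMap.sub_apply, Module.End.mul_apply, Module.End.mul_apply]
  have hmem : b ∈ concaveBoxes (color b) lam ∪ convexBoxes (color b) lam ↔
      Addable lam b ∨ Removable lam b := by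
    rw [Finset.mem_union, mem_concaveBoxes, mem_convexBoxes]
    tauto
  by_cases h1 : Addable lam b
  · have h2 : ¬ Removable lam b := fun h => h1.1 h.1
    rw [if_pos (hmem.2 (Or.inl h1)), eOp_ket_of_not h2, map_zero, sub_zero, fOp_ket h h1, map_smul,
      eOp_ket h h1.removable, h1.removeBox_addBox, smul_smul, resLog_phi_addable h h1, h1.cells,
      prodBefore_insert_of_not hbb]
    congr 1
    ring
  · by_cases h2 : Removable lam b
    · rw [if_pos (hmem.2 (Or.inr h2)), fOp_ket_of_not h1, map_zero, zero_sub, eOp_ket h h2,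
        map_smul,
        fOp_ket h h2.addable, h2.addBox_removeBox, smul_smul, resLog_phi_removable h h2, ← neg_smul,
        h2.cells]
      congr 1
      have e1 : prodBefore q d lam.cells b = prodBefore q d (lam.cells.erase b) b := by
        conv_lhs => rw [← Finset.insert_erase h2.1]
        rw [prodBefore_insert_of_not hbb]
      rw [e1]
      ring
    · rw [if_neg (by rw [hmem]; tauto), fOp_ket_of_not h1, eOp_ket_of_not h2, map_zero, map_zero,
        sub_zero]

/-! ### Words of box operators -/

/-- `A` maps every basis vector to a multiple of the one obtained by removing the boxes in `S`. -/
def Removes (S : Finset Box) (A : FockEnd) : Prop :=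
  ∀ lam, A (ket lam) = 0 ∨ ∃ (mu : YoungDiagram) (c : ℂ),
    A (ket lam) = c • ket mu ∧ S ⊆ lam.cells ∧ mu.cells = lam.cells \ S

/-- `A` maps every basis vector to a multiple of the one obtained by adding the boxes in `S`. -/
def Adds (S : Finset Box) (A : FockEnd) : Prop :=
  ∀ lam, A (ket lam) = 0 ∨ ∃ (mu : YoungDiagram) (c : ℂ),
    A (ket lam) = c • ket mu ∧ Disjoint S lam.cells ∧ mu.cells = S ∪ lam.cells

theorem removes_eOp (h : Generic q d) (b : Box) : Removes {b} (eOp q d b) := by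
  intro lam
  by_cases hb : Removable lam b
  · refine Or.inr ⟨_, _, eOp_ket h hb, by simpa using hb.1, ?_⟩
    rw [hb.cells, Finset.sdiff_singleton_eq_erase]
  · exact Or.inl (eOp_ket_of_not hb)

theorem adds_fOp (h : Generic q d) (b : Box) : Adds {b} (fOp q d b) := by
  intro lam
  by_cases hb : Addable lam b
  · exact Or.inr ⟨_, _, fOp_ket h hb, by simpa using hb.1, by rw [hb.cells]; rfl⟩
  · exact Or.inl (fOp_ket_of_not hb)

theorem Removes.mul {S T : Finset Box} {A B : FockEnd} (hA : Removes S A) (hB : Removes T B) :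
    Removes (S ∪ T) (A * B) := by
  intro lam
  rw [Module.End.mul_apply]
  rcases hB lam with h | ⟨mu, c, h, hT, hmu⟩
  · exact Or.inl (by rw [h, map_zero])
  rw [h, map_smul]
  rcases hA mu with h' | ⟨nu, c', h', hS, hnu⟩
  · exact Or.inl (by rw [h', smul_zero])
  refine Or.inr ⟨nu, c * c', by rw [h', smul_smul], ?_, ?_⟩
  · rw [hmu] at hS
    exact Finset.union_subset (hS.trans Finset.sdiff_subset) hT
  · rw [hnu, hmu, sdiff_sdiff_left, sup_comm]
    rfl

theorem Adds.mul {S T : Finset Box} {A B : FockEnd} (hA : Adds S A) (hB : Adds T B) :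
    Adds (S ∪ T) (A * B) := by
  intro lam
  rw [Module.End.mul_apply]
  rcases hB lam with h | ⟨mu, c, h, hT, hmu⟩
  · exact Or.inl (by rw [h, map_zero])
  rw [h, map_smul]
  rcases hA mu with h' | ⟨nu, c', h', hS, hnu⟩
  · exact Or.inl (by rw [h', smul_zero])
  refine Or.inr ⟨nu, c * c', by rw [h', smul_smul], ?_, ?_⟩
  · rw [hmu, Finset.disjoint_union_right] at hS
    exact Finset.disjoint_union_left.2 ⟨hS.2, hT⟩
  · rw [hnu, hmu, Finset.union_assoc]

/-- A skew shape containing a box and its diagonal neighbor contains the two boxes in between. -/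
def Convexity (S : Finset Box) : Prop :=
  ∀ b ∈ S, (b.1 + 1, b.2 + 1) ∈ S → (b.1 + 1, b.2) ∈ S ∧ (b.1, b.2 + 1) ∈ S

/-- A box between `b` and its diagonal neighbor lies in the larger diagram; were it in the smaller
one, `b` would be there too. -/
theorem convexity_of_sdiff {S : Finset Box} {lam mu : YoungDiagram} (hS : S ⊆ lam.cells)
    (hmu : mu.cells = lam.cells \ S) : Convexity S := by
  intro b hb hb'
  have key : ∀ c : Box, b ≤ c → c ≤ (b.1 + 1, b.2 + 1) → c ∈ S := by
    intro c h1 h2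
    by_contra hc
    have h3 : c ∈ lam.cells := lam.isLowerSet h2 (hS hb')
    have h4 : c ∈ mu.cells := by rw [hmu]; exact Finset.mem_sdiff.2 ⟨h3, hc⟩
    have h5 : b ∈ mu.cells := mu.isLowerSet h1 h4
    rw [hmu, Finset.mem_sdiff] at h5
    exact h5.2 hb
  exact ⟨key _ ⟨by simp, le_rfl⟩ ⟨le_rfl, by simp⟩, key _ ⟨le_rfl, by simp⟩ ⟨by simp, le_rfl⟩⟩

theorem Removes.convexity {S : Finset Box} {A : FockEnd} (hA : Removes S A) (h0 : A ≠ 0) :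
    Convexity S := by
  by_contra hS
  refine h0 (fockEnd_ext fun lam => ?_)
  rcases hA lam with h | ⟨mu, c, -, h1, h2⟩
  · exact h
  · exact absurd (convexity_of_sdiff h1 h2) hS

theorem Adds.convexity {S : Finset Box} {A : FockEnd} (hA : Adds S A) (h0 : A ≠ 0) :
    Convexity S := by
  by_contra hS
  refine h0 (fockEnd_ext fun lam => ?_)
  rcases hA lam with h | ⟨mu, c, -, h1, h2⟩
  · exact h
  · refine absurd (convexity_of_sdiff (lam := mu) (mu := lam) ?_ ?_) hS
    · rw [h2]
      exact Finset.subset_union_left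
    · rw [h2, Finset.union_sdiff_left, Finset.sdiff_eq_self_of_disjoint h1.symm]

/-- `g_{i,j}(z, w)` for the colors `i, j` of two boxes, at arbitrary values of the variables. -/
def gOf (q d : ℂ) (P : Box → ℂ) (b c : Box) : ℂ :=
  if color b = color c then P b - q2 q * P c else (P b - q1 q d * P c) * (P b - q3 q d * P c)

theorem gOf_pos (b c : Box) : gOf q d (pos q d) b c = gBox q d b c := rfl

/-- Inverting the variables exchanges `g(z, w)` and `g(w, z)` up to a common factor. Hence the
operators `fOp` satisfy the exchange relations of type `E` at inverse positions, and one argument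
serves both Serre relations. -/
theorem gOf_pos_inv (h : Generic q d) (b c : Box) : ∃ r ≠ 0,
    gOf q d (fun b => (pos q d b)⁻¹) b c = r * gBox q d c b ∧
      gOf q d (fun b => (pos q d b)⁻¹) c b = r * gBox q d b c := by
  have hb := h.pos_ne b
  have hc := h.pos_ne c
  unfold gOf gBox
  by_cases h0 : color b = color c
  · rw [if_pos h0, if_pos h0.symm, if_pos h0.symm, if_pos h0]
    refine ⟨(pos q d b * pos q d c)⁻¹, inv_ne_zero (mul_ne_zero hb hc), ?_, ?_⟩ <;> field_simp
  · rw [if_neg h0, if_neg (Ne.symm h0), if_neg (Ne.symm h0), if_neg h0]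
    refine ⟨((pos q d b * pos q d c) ^ 2)⁻¹,
      inv_ne_zero (pow_ne_zero _ (mul_ne_zero hb hc)), ?_, ?_⟩ <;> field_simp

/-- Box operators satisfying exchange relations. -/
structure BoxSystem (q d : ℂ) (P : Box → ℂ) (x : Box → FockEnd) : Prop where
  exchange (b c : Box) : gOf q d P b c • (x b * x c) = (sgn b c * gOf q d P c b) • (x c * x b)
  same (b c : Box) : color b = color c → gOf q d P b c = 0 →
    (b.1 = c.1 + 1 ∧ b.2 = c.2 + 1) ∨ (c.1 = b.1 + 1 ∧ c.2 = b.2 + 1)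
  diff (b c : Box) : color b ≠ color c → gOf q d P b c = 0 → gOf q d P c b ≠ 0
  word (a b c e : Box) : x a * (x b * (x c * x e)) ≠ 0 → Convexity {a, b, c, e}

theorem boxSystem_eOp (h : Generic q d) : BoxSystem q d (pos q d) (eOp q d) where
  exchange b c := eOp_exchange h b c
  same b c hc h0 := by
    rw [gOf_pos, gBox_eq_zero_iff h] at h0
    rw [color_eq_iff] at hc
    omega
  diff b c hc h0 := by
    rw [gOf_pos, gBox_eq_zero_iff h] at h0
    rw [gOf_pos, Ne, gBox_eq_zero_iff h]
    omega
  word a b c e h0 := by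
    have := ((removes_eOp h a).mul ((removes_eOp h b).mul
      ((removes_eOp h c).mul (removes_eOp h e)))).convexity h0
    exact this

theorem boxSystem_fOp (h : Generic q d) :
    BoxSystem q d (fun b => (pos q d b)⁻¹) (fOp q d) where
  exchange b c := by
    obtain ⟨r, -, h1, h2⟩ := gOf_pos_inv h b c
    rw [h1, h2, mul_smul, fOp_exchange h, smul_smul]
    congr 1
    ring
  same b c hc h0 := by
    obtain ⟨r, hr, h1, h2⟩ := gOf_pos_inv h b c
    rw [h1, mul_eq_zero, gBox_eq_zero_iff h] at h0
    rw [color_eq_iff] at hc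
    have := h0.resolve_left hr
    omega
  diff b c hc h0 := by
    obtain ⟨r, hr, h1, h2⟩ := gOf_pos_inv h b c
    rw [h1, mul_eq_zero, gBox_eq_zero_iff h] at h0
    have := h0.resolve_left hr
    rw [h2]
    refine mul_ne_zero hr ?_
    rw [Ne, gBox_eq_zero_iff h]
    omega
  word a b c e h0 := by
    have := ((adds_fOp h a).mul ((adds_fOp h b).mul
      ((adds_fOp h c).mul (adds_fOp h e)))).convexity h0
    exact this

/-- The exchange relations for equal colors degenerate only for diagonal neighbors. In that case
each single word vanishes for a combinatorial reason; otherwise the algebraic argument through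
`SerreData` applies. -/
theorem BoxSystem.serreSum_eq_zero (h : Generic q d) {P : Box → ℂ} {x : Box → FockEnd}
    (hx : BoxSystem q d P x) {i j : ZMod 2} (hij : i ≠ j) {b₀ b₁ b₂ c : Box} (h₀ : color b₀ = i)
    (h₁ : color b₁ = i) (h₂ : color b₂ = i) (hc : color c = j) :
    serreSum (q2 q) (x b₀) (x b₁) (x b₂) (x c) = 0 := by
  set B : Fin 3 → Box := ![b₀, b₁, b₂] with hB
  have hcol : ∀ k, color (B k) = i := by
    intro k
    fin_cases k <;> assumption
  by_cases hdiag : ∃ k l, (B k).1 = (B l).1 + 1 ∧ (B k).2 = (B l).2 + 1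
  · obtain ⟨k, l, hkl⟩ := hdiag
    have hk : B k = ((B l).1 + 1, (B l).2 + 1) := Prod.ext hkl.1 hkl.2
    have hw : ∀ s t u v : Box, (∀ b, b ∈ ({s, t, u, v} : Finset Box) ↔
        b = c ∨ b = b₀ ∨ b = b₁ ∨ b = b₂) → x s * (x t * (x u * x v)) = 0 := by
      intro s t u v hS
      by_contra h0
      have hconv := hx.word s t u v h0
      have hmem : ∀ m, B m ∈ ({s, t, u, v} : Finset Box) := by
        intro m
        rw [hS]
        fin_cases m <;> simp [hB]
      have hmemc : ∀ b ∈ ({s, t, u, v} : Finset Box), color b ≠ i → b = c := by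
        intro b hb hne
        rw [hS] at hb
        rcases hb with rfl | rfl | rfl | rfl
        · rfl
        · exact absurd h₀ hne
        · exact absurd h₁ hne
        · exact absurd h₂ hne
      have h1 := hconv (B l) (hmem l) (hk ▸ hmem k)
      have e1 := hmemc _ h1.1 (by rw [← hcol l]; exact (color_add_one _ _).symm)
      have e2 := hmemc _ h1.2 (by rw [← hcol l]; exact (color_add_one' _ _).symm)
      -- The two boxes between diagonal neighbors are distinct, but both have the other color and so
      -- would have to be `c`.
      have e3 := e1.trans e2.symm
      simp at e3
    simp only [serreSum, serreTerm]
    rw [hw, hw, hw, hw, hw, hw, hw, hw, hw, hw, hw, hw, hw, hw, hw, hw, hw, hw, hw, hw, hw, hw,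
      hw, hw]
    · simp
    all_goals
      intro b
      simp only [Finset.mem_insert, Finset.mem_singleton] <;> tauto
  · have hdata : SerreData (q1 q d) (q3 q d) (q2 q) (P c) (fun k => P (B k)) (fun k => x (B k))
        (x c) := by
      have hg : ∀ k l, gOf q d P (B k) (B l) = P (B k) - q2 q * P (B l) := fun k l =>
        if_pos ((hcol k).trans (hcol l).symm)
      have hne : ∀ k, color (B k) ≠ color c := fun k => by rw [hcol, hc]; exact hij
      refine ⟨h.q2_ne, h.q1_mul_q3, fun k l h0 => ?_, fun k l => ?_, fun k => ?_, fun k h0 => ?_⟩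
      · rcases hx.same (B k) (B l) ((hcol k).trans (hcol l).symm) (by rw [hg, h0]) with h1 | h1
        · exact hdiag ⟨k, l, h1⟩
        · exact hdiag ⟨l, k, h1⟩
      · have := hx.exchange (B k) (B l)
        rwa [hg, hg, sgn, if_pos ((hcol k).trans (hcol l).symm), neg_one_mul] at this
      · have := hx.exchange (B k) c
        rwa [gOf, gOf, if_neg (hne k), if_neg (hne k).symm, sgn, if_neg (hne k), one_mul] at this
      · have := hx.diff c (B k) (hne k).symm
        rw [gOf, gOf, if_neg (hne k), if_neg (hne k).symm] at this
        exact this h0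
    exact hdata.serreSum_eq_zero 0 1 2

/-! ### Sums over finite sets of boxes -/

section sums

variable {A : Type*} [Ring A] [Algebra ℂ A]

theorem serreSum_smul (t r : ℂ) (a b c y : A) :
    serreSum t (r • a) b c y = r • serreSum t a b c y := by
  simp only [serreSum, serreTerm, smul_mul_assoc, mul_smul_comm, smul_sub, smul_add, smul_smul,
    mul_comm r]

theorem serreSum_add (t : ℂ) (a a' b c y : A) :
    serreSum t (a + a') b c y = serreSum t a b c y + serreSum t a' b c y := by
  simp only [serreSum, serreTerm, add_mul, mul_add, smul_add]
  abel

theorem serreSum_smul_right (t r : ℂ) (a b c y : A) :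
    serreSum t a b c (r • y) = r • serreSum t a b c y := by
  simp only [serreSum, serreTerm, smul_mul_assoc, mul_smul_comm, smul_sub, smul_add, smul_smul,
    mul_comm r]

theorem serreSum_add_right (t : ℂ) (a b c y y' : A) :
    serreSum t a b c (y + y') = serreSum t a b c y + serreSum t a b c y' := by
  simp only [serreSum, serreTerm, add_mul, mul_add, smul_add]
  abel

theorem serreSum_sum {ι : Type*} (t : ℂ) (S : Finset ι) (r : ι → ℂ) (x : ι → A) (b c y : A)
    (h : ∀ s ∈ S, serreSum t (x s) b c y = 0) : serreSum t (∑ s ∈ S, r s • x s) b c y = 0 := by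
  classical
  induction S using Finset.induction_on with
  | empty => simp [serreSum, serreTerm]
  | insert s S hs ih =>
    rw [Finset.sum_insert hs, serreSum_add, serreSum_smul, h s (by simp), smul_zero, zero_add]
    exact ih fun u hu => h u (by simp [hu])

theorem serreSum_sum_right {ι : Type*} (t : ℂ) (S : Finset ι) (r : ι → ℂ) (x : ι → A) (a b c : A)
    (h : ∀ s ∈ S, serreSum t a b c (x s) = 0) : serreSum t a b c (∑ s ∈ S, r s • x s) = 0 := by
  classical
  induction S using Finset.induction_on with
  | empty => simp [serreSum, serreTerm]
  | insert s S hs ih =>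
    rw [Finset.sum_insert hs, serreSum_add_right, serreSum_smul_right, h s (by simp), smul_zero,
      zero_add]
    exact ih fun u hu => h u (by simp [hu])

end sums

/-- The part of the current of color `i` which comes from the boxes in `T`. -/
def partCurrent (P : Box → ℂ) (x : Box → FockEnd) (i : ZMod 2) (k : ℤ) (T : Finset Box) :
    FockEnd := ∑ b ∈ T with color b = i, P b ^ k • x b

theorem BoxSystem.serreSum_partCurrent (h : Generic q d) {P : Box → ℂ} {x : Box → FockEnd}
    (hx : BoxSystem q d P x) {i j : ZMod 2} (hij : i ≠ j) (k₀ k₁ k₂ l : ℤ) (T : Finset Box) :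
    serreSum (q2 q) (partCurrent P x i k₀ T) (partCurrent P x i k₁ T) (partCurrent P x i k₂ T)
      (partCurrent P x j l T) = 0 := by
  have hcol : ∀ {i : ZMod 2} {b : Box}, b ∈ T.filter (color · = i) → color b = i :=
    fun hb => (Finset.mem_filter.1 hb).2
  refine serreSum_sum _ _ _ _ _ _ _ fun b₀ h₀ => ?_
  rw [serreSum_swap₁]
  refine serreSum_sum _ _ _ _ _ _ _ fun b₁ h₁ => ?_
  -- Multilinearity is proved in the first slot only; the symmetry brings each remaining sum there.
  rw [serreSum_swap₂, serreSum_swap₁]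
  refine serreSum_sum _ _ _ _ _ _ _ fun b₂ h₂ => ?_
  refine serreSum_sum_right _ _ _ _ _ _ _ fun c hc => ?_
  exact hx.serreSum_eq_zero h hij (hcol h₂) (hcol h₁) (hcol h₀) (hcol hc)

open Filter

/-! ### Locally finite sums of operators -/

/-- On every vector, `A` agrees with `A' T` for all sufficiently large `T`. -/
def Approx (A : FockEnd) (A' : Finset Box → FockEnd) : Prop :=
  ∀ v, ∀ᶠ T in atTop, A v = A' T v

theorem Approx.of_ket {A : FockEnd} {A' : Finset Box → FockEnd}
    (h : ∀ lam, ∀ᶠ T in atTop, A (ket lam) = A' T (ket lam)) : Approx A A' := by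
  intro v
  induction v using Finsupp.induction_linear with
  | zero => simp
  | add u v hu hv =>
    filter_upwards [hu, hv] with T h1 h2
    rw [map_add, map_add, h1, h2]
  | single lam c =>
    filter_upwards [h lam] with T hT
    rw [← mul_one c, ← smul_eq_mul, ← Finsupp.smul_single, map_smul, map_smul]
    exact congrArg _ hT

theorem Approx.const (A : FockEnd) : Approx A fun _ => A := fun _ =>
  Eventually.of_forall fun _ => rfl

theorem Approx.add {A B : FockEnd} {A' B' : Finset Box → FockEnd} (hA : Approx A A')
    (hB : Approx B B') : Approx (A + B) fun T => A' T + B' T := fun v => by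
  filter_upwards [hA v, hB v] with T h1 h2
  rw [LinearMap.add_apply, LinearMap.add_apply, h1, h2]

theorem Approx.sub {A B : FockEnd} {A' B' : Finset Box → FockEnd} (hA : Approx A A')
    (hB : Approx B B') : Approx (A - B) fun T => A' T - B' T := fun v => by
  filter_upwards [hA v, hB v] with T h1 h2
  rw [LinearMap.sub_apply, LinearMap.sub_apply, h1, h2]

theorem Approx.smul (c : ℂ) {A : FockEnd} {A' : Finset Box → FockEnd} (hA : Approx A A') :
    Approx (c • A) fun T => c • A' T := fun v => by
  filter_upwards [hA v] with T h1
  rw [LinearMap.smul_apply, LinearMap.smul_apply, h1]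

/-- The bound on `T` may depend on the vector, so it is enough to take `T` large for `v` and for `B
v`. -/
theorem Approx.mul {A B : FockEnd} {A' B' : Finset Box → FockEnd} (hA : Approx A A')
    (hB : Approx B B') : Approx (A * B) fun T => A' T * B' T := fun v => by
  filter_upwards [hA (B v), hB v] with T h1 h2
  rw [Module.End.mul_apply, Module.End.mul_apply, h1, h2]

theorem Approx.congr {A B : FockEnd} {A' : Finset Box → FockEnd} (hA : Approx A A')
    (hB : Approx B A') : A = B :=
  LinearMap.ext fun v => by
    obtain ⟨T, h1, h2⟩ := ((hA v).and (hB v)).exists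
    exact h1.trans h2.symm

/-- Relations pass from the finite truncations to the full currents, which are infinite sums over
boxes. -/
theorem Approx.eq_zero {A : FockEnd} {A' : Finset Box → FockEnd} (hA : Approx A A')
    (h : ∀ T, A' T = 0) : A = 0 :=
  hA.congr (by rw [funext h]; exact Approx.const 0)

theorem Approx.mulGzw (i j : ZMod 2) {f : ℤ → ℤ → FockEnd} {f' : Finset Box → ℤ → ℤ → FockEnd}
    (h : ∀ k l, Approx (f k l) fun T => f' T k l) (k l : ℤ) :
    Approx (mulGzw q d i j f k l) fun T => QTor.mulGzw q d i j (f' T) k l := by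
  have key : ∀ (a : ℂ) {f : ℤ → ℤ → FockEnd} {f' : Finset Box → ℤ → ℤ → FockEnd},
      (∀ k l, Approx (f k l) fun T => f' T k l) →
      ∀ k l, Approx (mulZW a f k l) fun T => mulZW a (f' T) k l := fun a _ _ h k l =>
    (h (k + 1) l).sub ((h k (l + 1)).smul a)
  unfold QTor.mulGzw
  split_ifs
  · exact key _ h k l
  · exact key _ (key _ h) k l

theorem Approx.mulGwz (i j : ZMod 2) {f : ℤ → ℤ → FockEnd} {f' : Finset Box → ℤ → ℤ → FockEnd}
    (h : ∀ k l, Approx (f k l) fun T => f' T k l) (k l : ℤ) :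
    Approx (mulGwz q d i j f k l) fun T => QTor.mulGwz q d i j (f' T) k l := by
  have key : ∀ (a : ℂ) {f : ℤ → ℤ → FockEnd} {f' : Finset Box → ℤ → ℤ → FockEnd},
      (∀ k l, Approx (f k l) fun T => f' T k l) →
      ∀ k l, Approx (mulWZ a f k l) fun T => mulWZ a (f' T) k l := fun a _ _ h k l =>
    (h k (l + 1)).sub ((h (k + 1) l).smul a)
  unfold QTor.mulGwz
  split_ifs
  · exact key _ h k l
  · exact key _ (key _ h) k l

theorem Approx.exchangeE (i j : ZMod 2) {X Y : ℤ → FockEnd} {X' Y' : ℤ → Finset Box → FockEnd}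
    (hX : ∀ k, Approx (X k) (X' k)) (hY : ∀ k, Approx (Y k) (Y' k)) (k l : ℤ) :
    Approx (exchangeE q d i j X Y k l) fun T =>
      QTor.exchangeE q d i j (fun k => X' k T) (fun l => Y' l T) k l :=
  ((Approx.mulGzw i j (fun k l => (hX k).mul (hY l)) k l).smul _).add
    (Approx.mulGwz j i (fun k l => (hY l).mul (hX k)) k l)

theorem Approx.exchangeF (i j : ZMod 2) {X Y : ℤ → FockEnd} {X' Y' : ℤ → Finset Box → FockEnd}
    (hX : ∀ k, Approx (X k) (X' k)) (hY : ∀ k, Approx (Y k) (Y' k)) (k l : ℤ) :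
    Approx (exchangeF q d i j X Y k l) fun T =>
      QTor.exchangeF q d i j (fun k => X' k T) (fun l => Y' l T) k l :=
  ((Approx.mulGwz j i (fun k l => (hX k).mul (hY l)) k l).smul _).add
    (Approx.mulGzw i j (fun k l => (hY l).mul (hX k)) k l)

theorem Approx.serreSum (t : ℂ) {a b c y : FockEnd} {a' b' c' y' : Finset Box → FockEnd}
    (ha : Approx a a') (hb : Approx b b') (hc : Approx c c') (hy : Approx y y') :
    Approx (serreSum t a b c y) fun T => QTor.serreSum t (a' T) (b' T) (c' T) (y' T) := by
  have key : ∀ {a b c : FockEnd} {a' b' c' : Finset Box → FockEnd}, Approx a a' → Approx b b' →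
      Approx c c' → Approx (serreTerm t a b c y) fun T => serreTerm t (a' T) (b' T) (c' T) (y' T) :=
    fun ha hb hc => (((ha.mul (hb.mul (hc.mul hy))).sub ((ha.mul (hb.mul (hy.mul hc))).smul _)).add
      ((ha.mul (hy.mul (hb.mul hc))).smul _)).sub (hy.mul (ha.mul (hb.mul hc)))
  exact (((((key ha hb hc).add (key ha hc hb)).add (key hb ha hc)).add (key hb hc ha)).add
    (key hc ha hb)).add (key hc hb ha)

/-! ### Exchange relations for sums of delta functions -/

section exchange

variable {A : Type*} [Ring A] [Algebra ℂ A] {ι : Type*}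

theorem mulGzw_add (i j : ZMod 2) (f f' : ℤ → ℤ → A) (k l : ℤ) :
    mulGzw q d i j (fun k l => f k l + f' k l) k l =
      mulGzw q d i j f k l + mulGzw q d i j f' k l := by
  unfold mulGzw
  split_ifs <;> simp only [mulZW, smul_add, smul_sub] <;> abel

theorem mulGwz_add (i j : ZMod 2) (f f' : ℤ → ℤ → A) (k l : ℤ) :
    mulGwz q d i j (fun k l => f k l + f' k l) k l =
      mulGwz q d i j f k l + mulGwz q d i j f' k l := by
  unfold mulGwz
  split_ifs <;> simp only [mulWZ, smul_add, smul_sub] <;> abel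

theorem mulGzw_zero (i j : ZMod 2) (k l : ℤ) : mulGzw q d i j (fun _ _ => (0 : A)) k l = 0 := by
  unfold mulGzw
  split_ifs <;> simp [mulZW]

theorem mulGwz_zero (i j : ZMod 2) (k l : ℤ) : mulGwz q d i j (fun _ _ => (0 : A)) k l = 0 := by
  unfold mulGwz
  split_ifs <;> simp [mulWZ]

theorem mulGzw_sum (i j : ZMod 2) (S : Finset ι) (f : ι → ℤ → ℤ → A) (k l : ℤ) :
    mulGzw q d i j (fun k l => ∑ b ∈ S, f b k l) k l = ∑ b ∈ S, mulGzw q d i j (f b) k l := by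
  classical
  induction S using Finset.induction_on with
  | empty => simpa using mulGzw_zero i j k l
  | insert b S hb ih =>
    simp only [Finset.sum_insert hb]
    rw [mulGzw_add, ih]

theorem mulGwz_sum (i j : ZMod 2) (S : Finset ι) (f : ι → ℤ → ℤ → A) (k l : ℤ) :
    mulGwz q d i j (fun k l => ∑ b ∈ S, f b k l) k l = ∑ b ∈ S, mulGwz q d i j (f b) k l := by
  classical
  induction S using Finset.induction_on with
  | empty => simpa using mulGwz_zero i j k l
  | insert b S hb ih =>
    simp only [Finset.sum_insert hb]
    rw [mulGwz_add, ih]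

theorem exchangeE_sum_right (i j : ZMod 2) (S : Finset ι) (X : ℤ → A) (Y : ι → ℤ → A) (k l : ℤ) :
    exchangeE q d i j X (fun l => ∑ b ∈ S, Y b l) k l =
      ∑ b ∈ S, exchangeE q d i j X (Y b) k l := by
  simp only [exchangeE, Finset.mul_sum, Finset.sum_mul, mulGzw_sum, mulGwz_sum, Finset.smul_sum,
    Finset.sum_add_distrib]

theorem exchangeE_sum_left (i j : ZMod 2) (S : Finset ι) (X : ι → ℤ → A) (Y : ℤ → A) (k l : ℤ) :
    exchangeE q d i j (fun k => ∑ b ∈ S, X b k) Y k l =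
      ∑ b ∈ S, exchangeE q d i j (X b) Y k l := by
  simp only [exchangeE, Finset.mul_sum, Finset.sum_mul, mulGzw_sum, mulGwz_sum, Finset.smul_sum,
    Finset.sum_add_distrib]

theorem exchangeF_sum_right (i j : ZMod 2) (S : Finset ι) (X : ℤ → A) (Y : ι → ℤ → A) (k l : ℤ) :
    exchangeF q d i j X (fun l => ∑ b ∈ S, Y b l) k l =
      ∑ b ∈ S, exchangeF q d i j X (Y b) k l := by
  simp only [exchangeF, Finset.mul_sum, Finset.sum_mul, mulGzw_sum, mulGwz_sum, Finset.smul_sum,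
    Finset.sum_add_distrib]

theorem exchangeF_sum_left (i j : ZMod 2) (S : Finset ι) (X : ι → ℤ → A) (Y : ℤ → A) (k l : ℤ) :
    exchangeF q d i j (fun k => ∑ b ∈ S, X b k) Y k l =
      ∑ b ∈ S, exchangeF q d i j (X b) Y k l := by
  simp only [exchangeF, Finset.mul_sum, Finset.sum_mul, mulGzw_sum, mulGwz_sum, Finset.smul_sum,
    Finset.sum_add_distrib]

/-- A shift of a mode index of `δ(z/p)` is multiplication by `p`, so a polynomial acts on a product
of delta functions by its value at the supporting point. -/
theorem mulGzw_zpow (h : Generic q d) (b c : Box) (x : A) (k l : ℤ) :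
    mulGzw q d (color b) (color c) (fun k l => (pos q d b ^ k * pos q d c ^ l) • x) k l =
      (pos q d b ^ k * pos q d c ^ l * gBox q d b c) • x := by
  unfold mulGzw gBox
  split_ifs <;>
  · simp only [mulZW, smul_smul, ← sub_smul, zpow_add₀ (h.pos_ne _), zpow_one]
    congr 1
    ring

theorem mulGwz_zpow (h : Generic q d) (b c : Box) (x : A) (k l : ℤ) :
    mulGwz q d (color c) (color b) (fun k l => (pos q d b ^ k * pos q d c ^ l) • x) k l =
      (pos q d b ^ k * pos q d c ^ l * gBox q d c b) • x := by
  unfold mulGwz gBox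
  split_ifs <;>
  · simp only [mulWZ, smul_smul, ← sub_smul, zpow_add₀ (h.pos_ne _), zpow_one]
    congr 1
    ring

theorem parity_color (b c : Box) : parity (color b) (color c) = -sgn b c := by
  unfold parity sgn
  split_ifs <;> simp

theorem exchangeE_zpow (h : Generic q d) {b c : Box} {x y : A}
    (hxy : gBox q d b c • (x * y) = (sgn b c * gBox q d c b) • (y * x)) (k l : ℤ) :
    exchangeE q d (color b) (color c) (fun k => pos q d b ^ k • x) (fun l => pos q d c ^ l • y) k l
      = 0 := by
  simp only [exchangeE, smul_mul_smul_comm]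
  have hcomm : ∀ k l : ℤ, pos q d c ^ l * pos q d b ^ k = pos q d b ^ k * pos q d c ^ l :=
    fun _ _ => mul_comm _ _
  simp only [hcomm]
  rw [mulGzw_zpow h, mulGwz_zpow h, parity_color, mul_smul _ (gBox q d b c), hxy, smul_smul,
    smul_smul, ← add_smul]
  convert zero_smul ℂ _
  linear_combination (-(pos q d b ^ k * pos q d c ^ l * gBox q d c b)) * sgn_mul_self b c

theorem exchangeF_zpow (h : Generic q d) {b c : Box} {x y : A}
    (hxy : gBox q d c b • (x * y) = (sgn b c * gBox q d b c) • (y * x)) (k l : ℤ) :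
    exchangeF q d (color b) (color c) (fun k => pos q d b ^ k • x) (fun l => pos q d c ^ l • y) k l
      = 0 := by
  simp only [exchangeF, smul_mul_smul_comm]
  have hcomm : ∀ k l : ℤ, pos q d c ^ l * pos q d b ^ k = pos q d b ^ k * pos q d c ^ l :=
    fun _ _ => mul_comm _ _
  simp only [hcomm]
  rw [mulGzw_zpow h, mulGwz_zpow h, parity_color, mul_smul _ (gBox q d c b), hxy, smul_smul,
    smul_smul, ← add_smul]
  convert zero_smul ℂ _
  linear_combination (-(pos q d b ^ k * pos q d c ^ l * gBox q d b c)) * sgn_mul_self b c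

end exchange

/-! ### The currents -/

/-- The modes of `E_i(z)`. -/
def eCur (q d : ℂ) (i : ZMod 2) (k : ℤ) : FockEnd := ofKet fun lam =>
  ∑ b ∈ convexBoxes i lam, (coeffB q d i lam b * pos q d b ^ k) • ket (removeBox lam b)

/-- The modes of `F_i(z)`. -/
def fCur (q d : ℂ) (i : ZMod 2) (k : ℤ) : FockEnd := ofKet fun lam =>
  ∑ b ∈ concaveBoxes i lam, (coeffA q d i lam b * pos q d b ^ k) • ket (addBox lam b)

/-- On a fixed diagram only the finitely many removable boxes of color `i` contribute, and any `T`
containing them gives the exact action. -/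
theorem approx_eCur (i : ZMod 2) (k : ℤ) :
    Approx (eCur q d i k) (partCurrent (pos q d) (eOp q d) i k) := by
  refine Approx.of_ket fun lam => ?_
  filter_upwards [eventually_ge_atTop (convexBoxes i lam)] with T hT
  rw [eCur, ofKet_ket, partCurrent, LinearMap.sum_apply]
  have hsub : convexBoxes i lam ⊆ T.filter (color · = i) := fun b hb =>
    Finset.mem_filter.2 ⟨hT hb, (mem_convexBoxes.1 hb).1⟩
  rw [← Finset.sum_subset hsub]
  · refine Finset.sum_congr rfl fun b hb => ?_
    rw [mem_convexBoxes] at hb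
    rw [LinearMap.smul_apply, eOp, ofKet_ket, if_pos hb.2, hb.1, smul_smul, mul_comm]
  · intro b hb hb'
    rw [mem_convexBoxes] at hb'
    rw [LinearMap.smul_apply, eOp_ket_of_not fun h => hb' ⟨(Finset.mem_filter.1 hb).2, h⟩,
      smul_zero]

theorem approx_fCur (i : ZMod 2) (k : ℤ) :
    Approx (fCur q d i k) (partCurrent (pos q d) (fOp q d) i k) := by
  refine Approx.of_ket fun lam => ?_
  filter_upwards [eventually_ge_atTop (concaveBoxes i lam)] with T hT
  rw [fCur, ofKet_ket, partCurrent, LinearMap.sum_apply]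
  have hsub : concaveBoxes i lam ⊆ T.filter (color · = i) := fun b hb =>
    Finset.mem_filter.2 ⟨hT hb, (mem_concaveBoxes.1 hb).1⟩
  rw [← Finset.sum_subset hsub]
  · refine Finset.sum_congr rfl fun b hb => ?_
    rw [mem_concaveBoxes] at hb
    rw [LinearMap.smul_apply, fOp, ofKet_ket, if_pos hb.2, hb.1, smul_smul, mul_comm]
  · intro b hb hb'
    rw [mem_concaveBoxes] at hb'
    rw [LinearMap.smul_apply, fOp_ket_of_not fun h => hb' ⟨(Finset.mem_filter.1 hb).2, h⟩,
      smul_zero]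

theorem exchangeE_eCur (h : Generic q d) (i j : ZMod 2) (k l : ℤ) :
    exchangeE q d i j (eCur q d i) (eCur q d j) k l = 0 := by
  refine (Approx.exchangeE i j (approx_eCur i) (approx_eCur j) k l).eq_zero fun T => ?_
  unfold partCurrent
  rw [exchangeE_sum_left]
  refine Finset.sum_eq_zero fun b hb => ?_
  rw [exchangeE_sum_right]
  refine Finset.sum_eq_zero fun c hc => ?_
  obtain ⟨-, rfl⟩ := Finset.mem_filter.1 hb
  obtain ⟨-, rfl⟩ := Finset.mem_filter.1 hc
  exact exchangeE_zpow h (eOp_exchange h b c) k l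

theorem exchangeF_fCur (h : Generic q d) (i j : ZMod 2) (k l : ℤ) :
    exchangeF q d i j (fCur q d i) (fCur q d j) k l = 0 := by
  refine (Approx.exchangeF i j (approx_fCur i) (approx_fCur j) k l).eq_zero fun T => ?_
  unfold partCurrent
  rw [exchangeF_sum_left]
  refine Finset.sum_eq_zero fun b hb => ?_
  rw [exchangeF_sum_right]
  refine Finset.sum_eq_zero fun c hc => ?_
  obtain ⟨-, rfl⟩ := Finset.mem_filter.1 hb
  obtain ⟨-, rfl⟩ := Finset.mem_filter.1 hc
  exact exchangeF_zpow h (fOp_exchange h b c) k l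

theorem serre_eCur (h : Generic q d) (i : ZMod 2) (k : Fin 3 → ℤ) (l : ℤ) :
    serre q (eCur q d i) (eCur q d (i + 1)) k l = 0 := by
  rw [serre_eq_serreSum q h.q_ne]
  rw [(Approx.serreSum (q ^ 2) (approx_eCur i (k 0)) (approx_eCur i (k 1)) (approx_eCur i (k 2))
    (approx_eCur (i + 1) l)).eq_zero, smul_zero]
  exact (boxSystem_eOp h).serreSum_partCurrent h (by simp) _ _ _ _

theorem partCurrent_inv (P : Box → ℂ) (x : Box → FockEnd) (i : ZMod 2) (k : ℤ) :
    partCurrent (fun b => (P b)⁻¹) x i (-k) = partCurrent P x i k := by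
  unfold partCurrent
  simp

theorem serre_fCur (h : Generic q d) (i : ZMod 2) (k : Fin 3 → ℤ) (l : ℤ) :
    serre q (fCur q d i) (fCur q d (i + 1)) k l = 0 := by
  rw [serre_eq_serreSum q h.q_ne]
  rw [(Approx.serreSum (q ^ 2) (approx_fCur i (k 0)) (approx_fCur i (k 1)) (approx_fCur i (k 2))
    (approx_fCur (i + 1) l)).eq_zero, smul_zero]
  -- Inverse positions with negated modes give the same current, as required by `boxSystem_fOp`.
  simp only [← partCurrent_inv (pos q d)]
  exact (boxSystem_fOp h).serreSum_partCurrent h (by simp) _ _ _ _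

/-! ### Cartan currents -/

/-- Diagonal operators. -/
def diag : (YoungDiagram → ℂ) →ₐ[ℂ] FockEnd :=
  AlgHom.ofLinearMap
    { toFun := fun f => ofKet fun lam => f lam • ket lam
      map_add' := fun f g => fockEnd_ext fun lam => by
        simp only [ofKet_ket, LinearMap.add_apply, Pi.add_apply, add_smul]
      map_smul' := fun c f => fockEnd_ext fun lam => by
        simp only [ofKet_ket, LinearMap.smul_apply, Pi.smul_apply, smul_smul, smul_eq_mul,
          RingHom.id_apply] }
    (fockEnd_ext fun lam => by simp [ofKet_ket])
    (fun f g => fockEnd_ext fun lam => by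
      simp [ofKet_ket, smul_smul, mul_comm])

theorem diag_ket (f : YoungDiagram → ℂ) (lam : YoungDiagram) :
    diag f (ket lam) = f lam • ket lam := ofKet_ket _ _

/-- The modes of `K_i^±(z)`. -/
def kCur (q d : ℂ) (e : PM) (i : ZMod 2) (k : ℤ) : FockEnd :=
  diag fun lam => expansionCoeff e (phi q d lam i) k

/-- Different boxes commute, so only commutators at one box remain; there the two powers of the
position combine into the mode `k + l`. The sum of residues over the corners is the difference of
the two expansions by `expansionCoeff_phi_sub`. -/
theorem eCur_fCur (h : Generic q d) (i j : ZMod 2) (k l : ℤ) :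
    eCur q d i k * fCur q d j l - fCur q d j l * eCur q d i k =
      if i = j then (q - q⁻¹)⁻¹ • (kCur q d PM.plus i (k + l) - kCur q d PM.minus i (k + l))
        else 0 := by
  have hE := approx_eCur (q := q) (d := d) i k
  have hF := approx_fCur (q := q) (d := d) j l
  refine ((hE.mul hF).sub (hF.mul hE)).congr (Approx.of_ket fun lam => ?_)
  filter_upwards [eventually_ge_atTop (concaveBoxes i lam ∪ convexBoxes i lam)] with T hT
  have hsum : partCurrent (pos q d) (eOp q d) i k T * partCurrent (pos q d) (fOp q d) j l T -
      partCurrent (pos q d) (fOp q d) j l T * partCurrent (pos q d) (eOp q d) i k T =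
      ∑ b ∈ T with color b = i, ∑ c ∈ T with color c = j, (pos q d b ^ k * pos q d c ^ l) •
        (eOp q d b * fOp q d c - fOp q d c * eOp q d b) := by
    unfold partCurrent
    rw [Finset.sum_mul_sum, Finset.sum_mul_sum, Finset.sum_comm (s := T.filter (color · = j))]
    refine (Finset.sum_sub_distrib (G := FockEnd) _ _).symm.trans
      (Finset.sum_congr rfl fun b _ => ?_)
    refine (Finset.sum_sub_distrib (G := FockEnd) _ _).symm.trans
      (Finset.sum_congr rfl fun c _ => ?_)
    rw [smul_mul_smul_comm, smul_mul_smul_comm, mul_comm (pos q d c ^ l)]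
    exact (smul_sub (A := FockEnd) (_ : ℂ) _ _).symm
  rw [hsum]
  split_ifs with hij
  · subst hij
    have hdiag : ∀ b ∈ T.filter (color · = i), ∑ c ∈ T with color c = i,
        (pos q d b ^ k * pos q d c ^ l) • (eOp q d b * fOp q d c - fOp q d c * eOp q d b) =
        pos q d b ^ (k + l) • (eOp q d b * fOp q d b - fOp q d b * eOp q d b) := by
      intro b hb
      rw [Finset.sum_eq_single_of_mem b hb, zpow_add₀ (h.pos_ne b)]
      intro c _ hc
      rw [sub_eq_zero_of_eq (eOp_mul_fOp h hc), smul_zero]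
    rw [Finset.sum_congr rfl hdiag, LinearMap.sum_apply]
    simp only [LinearMap.smul_apply, LinearMap.sub_apply, kCur, diag_ket]
    rw [← sub_smul, expansionCoeff_phi_sub h, smul_smul, Finset.mul_sum, Finset.sum_smul]
    have hsub : concaveBoxes i lam ∪ convexBoxes i lam ⊆ T.filter (color · = i) := fun b hb =>
      Finset.mem_filter.2 ⟨hT hb, by
        rw [Finset.mem_union, mem_concaveBoxes, mem_convexBoxes] at hb
        exact hb.elim (·.1) (·.1)⟩
    refine Finset.sum_subset_zero_on_sdiff hsub (fun b hb => ?_) fun b hb => ?_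
    · rw [Finset.mem_sdiff, Finset.mem_filter] at hb
      have := eOp_fOp_sub h lam b
      rw [LinearMap.sub_apply] at this
      rw [this, hb.1.2, if_neg hb.2, smul_zero]
    · have := eOp_fOp_sub h lam b
      rw [LinearMap.sub_apply] at this
      rw [this, (Finset.mem_filter.1 (hsub hb)).2, if_pos hb, smul_smul]
      congr 1
      ring
  · rw [Finset.sum_eq_zero]
    intro b hb
    refine Finset.sum_eq_zero fun c hc => ?_
    obtain ⟨-, rfl⟩ := Finset.mem_filter.1 hb
    obtain ⟨-, rfl⟩ := Finset.mem_filter.1 hc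
    rw [sub_eq_zero_of_eq (eOp_mul_fOp h fun hbc => hij (by rw [hbc])), smul_zero]

/-- Clearing the denominator of `A_b⁻¹` in `phi_addBox` gives an identity of rational functions;
multiplication by `z` shifts the coefficients of either expansion. This is the exchange relation of
`K` with the one-box operators. -/
theorem expansionCoeff_addBox_same {lam : YoungDiagram} {b : Box} (h : Generic q d)
    (hb : Addable lam b) (e : PM) (k : ℤ) :
    q2 q * expansionCoeff e (phi q d (addBox lam b) (color b)) (k + 1) -
        pos q d b * expansionCoeff e (phi q d (addBox lam b) (color b)) k =
      expansionCoeff e (phi q d lam (color b)) (k + 1) -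
        q2 q * pos q d b * expansionCoeff e (phi q d lam (color b)) k := by
  have key : RatFunc.C (q2 q) * (RatFunc.X * phi q d (addBox lam b) (color b)) +
      RatFunc.C (-pos q d b) * phi q d (addBox lam b) (color b) =
      RatFunc.X * phi q d lam (color b) +
        RatFunc.C (-(q2 q * pos q d b)) * phi q d lam (color b) := by
    have hne : RatFunc.C (q2 q) * RatFunc.X - RatFunc.C (pos q d b) ≠ 0 := by
      rw [C_mul_X_sub _ _ h.q2_ne]
      exact mul_ne_zero (C_ne_zero h.q2_ne) (X_sub_C_ne_zero _)
    rw [phi_addBox hb, affineRoot_self, inv_div]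
    simp only [map_neg]
    field_simp
    ring
  have := congrArg (fun f => expansionCoeff e f k) key
  simp only [expansionCoeff_add, expansionCoeff_C_mul, expansionCoeff_X_mul] at this
  linear_combination this

theorem expansionCoeff_addBox_of_ne {lam : YoungDiagram} {b : Box} (h : Generic q d)
    (hb : Addable lam b) {i : ZMod 2} (hi : i ≠ color b) (e : PM) (k : ℤ) :
    q1 q d * q3 q d * expansionCoeff e (phi q d (addBox lam b) i) (k + 1 + 1) -
        (q1 q d + q3 q d) * pos q d b * expansionCoeff e (phi q d (addBox lam b) i) (k + 1) +
        pos q d b ^ 2 * expansionCoeff e (phi q d (addBox lam b) i) k =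
      expansionCoeff e (phi q d lam i) (k + 1 + 1) -
        (q1 q d + q3 q d) * pos q d b * expansionCoeff e (phi q d lam i) (k + 1) +
        q1 q d * q3 q d * pos q d b ^ 2 * expansionCoeff e (phi q d lam i) k := by
  have key : RatFunc.C (q1 q d * q3 q d) * (RatFunc.X * (RatFunc.X * phi q d (addBox lam b) i)) +
      RatFunc.C (-((q1 q d + q3 q d) * pos q d b)) * (RatFunc.X * phi q d (addBox lam b) i) +
      RatFunc.C (pos q d b ^ 2) * phi q d (addBox lam b) i =
      RatFunc.X * (RatFunc.X * phi q d lam i) +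
        RatFunc.C (-((q1 q d + q3 q d) * pos q d b)) * (RatFunc.X * phi q d lam i) +
        RatFunc.C (q1 q d * q3 q d * pos q d b ^ 2) * phi q d lam i := by
    have hne : ∀ c : ℂ, c ≠ 0 → RatFunc.C c * RatFunc.X - RatFunc.C (pos q d b) ≠ 0 := by
      intro c hc
      rw [C_mul_X_sub _ _ hc]
      exact mul_ne_zero (C_ne_zero hc) (X_sub_C_ne_zero _)
    have h1 := hne _ h.q1_ne
    have h3 := hne _ h.q3_ne
    rw [phi_addBox hb, affineRoot_of_ne hi, inv_div]
    simp only [map_neg, map_mul, map_add, map_pow]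
    field_simp
    ring
  have := congrArg (fun f => expansionCoeff e f k) key
  simp only [expansionCoeff_add, expansionCoeff_C_mul, expansionCoeff_X_mul] at this
  linear_combination this

theorem exchangeE_kCur_eOp (h : Generic q d) (e : PM) (i : ZMod 2) (b : Box) (k l : ℤ) :
    exchangeE q d i (color b) (kCur q d e i) (fun l => pos q d b ^ l • eOp q d b) k l = 0 := by
  refine fockEnd_ext fun lam => ?_
  have hp := h.pos_ne b
  by_cases hb : Removable lam b
  · have hadd := hb.addable
    have heq := hb.addBox_removeBox
    unfold exchangeE mulGzw mulGwz parity
    by_cases hi : i = color b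
    · subst hi
      -- The diagram to which `b` is added is the one left after its removal.
      have key := expansionCoeff_addBox_same h hadd e k
      rw [heq] at key
      simp only [if_pos, mulZW, mulWZ, LinearMap.add_apply, LinearMap.sub_apply,
        LinearMap.smul_apply, Module.End.mul_apply, map_smul, kCur, diag_ket, eOp_ket h hb,
        smul_smul, ← sub_smul, ← add_smul, LinearMap.zero_apply, zpow_add_one₀ hp]
      convert zero_smul ℂ _
      linear_combination (-((q - q⁻¹)⁻¹ * prodBefore q d lam.cells b * pos q d b ^ l)) * key
    · have key := expansionCoeff_addBox_of_ne h hadd hi e k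
      rw [heq] at key
      simp only [if_neg hi, if_neg (Ne.symm hi), mulZW, mulWZ, LinearMap.add_apply,
        LinearMap.sub_apply, LinearMap.smul_apply, Module.End.mul_apply, map_smul, kCur, diag_ket,
        eOp_ket h hb, smul_smul, smul_sub, ← sub_smul, ← add_smul, LinearMap.zero_apply,
        zpow_add_one₀ hp]
      convert zero_smul ℂ _
      linear_combination ((q - q⁻¹)⁻¹ * prodBefore q d lam.cells b * pos q d b ^ l) * key
  · unfold exchangeE mulGzw mulGwz
    split_ifs <;>
    simp [mulZW, mulWZ, kCur, diag_ket, eOp_ket_of_not hb]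

theorem exchangeF_kCur_fOp (h : Generic q d) (e : PM) (i : ZMod 2) (b : Box) (k l : ℤ) :
    exchangeF q d i (color b) (kCur q d e i) (fun l => pos q d b ^ l • fOp q d b) k l = 0 := by
  refine fockEnd_ext fun lam => ?_
  have hp := h.pos_ne b
  by_cases hb : Addable lam b
  · unfold exchangeF mulGzw mulGwz parity
    by_cases hi : i = color b
    · subst hi
      have key := expansionCoeff_addBox_same h hb e k
      simp only [if_pos, mulZW, mulWZ, LinearMap.add_apply, LinearMap.sub_apply,
        LinearMap.smul_apply, Module.End.mul_apply, map_smul, kCur, diag_ket, fOp_ket h hb,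
        smul_smul, ← sub_smul, ← add_smul, LinearMap.zero_apply, zpow_add_one₀ hp]
      convert zero_smul ℂ _
      linear_combination (-(prodAfter q d lam.cells b * pos q d b ^ l)) * key
    · have key := expansionCoeff_addBox_of_ne h hb hi e k
      simp only [if_neg hi, if_neg (Ne.symm hi), mulZW, mulWZ, LinearMap.add_apply,
        LinearMap.sub_apply, LinearMap.smul_apply, Module.End.mul_apply, map_smul, kCur, diag_ket,
        fOp_ket h hb, smul_smul, smul_sub, ← sub_smul, ← add_smul, LinearMap.zero_apply,
        zpow_add_one₀ hp]
      convert zero_smul ℂ _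
      linear_combination (-(prodAfter q d lam.cells b * pos q d b ^ l)) * key
  · unfold exchangeF mulGzw mulGwz
    split_ifs <;>
    simp [mulZW, mulWZ, kCur, diag_ket, fOp_ket_of_not hb]

theorem exchangeE_kCur_eCur (h : Generic q d) (e : PM) (i j : ZMod 2) (k l : ℤ) :
    exchangeE q d i j (kCur q d e i) (eCur q d j) k l = 0 := by
  refine (Approx.exchangeE i j (fun k => Approx.const (kCur q d e i k)) (approx_eCur j)
    k l).eq_zero fun T => ?_
  unfold partCurrent
  rw [exchangeE_sum_right]
  refine Finset.sum_eq_zero fun b hb => ?_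
  obtain ⟨-, rfl⟩ := Finset.mem_filter.1 hb
  exact exchangeE_kCur_eOp h e i b k l

theorem exchangeF_kCur_fCur (h : Generic q d) (e : PM) (i j : ZMod 2) (k l : ℤ) :
    exchangeF q d i j (kCur q d e i) (fCur q d j) k l = 0 := by
  refine (Approx.exchangeF i j (fun k => Approx.const (kCur q d e i k)) (approx_fCur j)
    k l).eq_zero fun T => ?_
  unfold partCurrent
  rw [exchangeF_sum_right]
  refine Finset.sum_eq_zero fun b hb => ?_
  obtain ⟨-, rfl⟩ := Finset.mem_filter.1 hb
  exact exchangeF_kCur_fOp h e i b k l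

/-! ### The representation -/

theorem expCoeff_congr {A : Type*} [Ring A] [Algebra ℂ A] {h h' : ℕ → A}
    (hh : ∀ r, r ≠ 0 → h r = h' r) (n : ℕ) : expCoeff h n = expCoeff h' n := by
  have : (fun r => if r = 0 then 0 else h r) = fun r => if r = 0 then 0 else h' r := by
    funext r
    split_ifs with hr
    exacts [rfl, hh r hr]
  rw [expCoeff, expCoeff, this]

/-- The eigenvalue of `H_{i,r}`. -/
def hVal (q d : ℂ) (i : ZMod 2) (r : ℤ) (lam : YoungDiagram) : ℂ :=
  if 0 < r then
    (q - q⁻¹)⁻¹ * logSeq (fun n => (kVal q lam i)⁻¹ *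
      expansionCoeff PM.plus (phi q d lam i) n) r.toNat
  else
    -(q - q⁻¹)⁻¹ * logSeq (fun n => kVal q lam i *
      expansionCoeff PM.minus (phi q d lam i) (-n)) (-r).toNat

/-- The action of the generators. -/
def genAct (q d τ : ℂ) : Gen → FockEnd
  | Gen.E i k => eCur q d i k
  | Gen.F i k => fCur q d i k
  | Gen.H i r => diag (hVal q d i r)
  | Gen.K i => diag fun lam => kVal q lam i
  | Gen.Kinv i => diag fun lam => (kVal q lam i)⁻¹
  | Gen.t => algebraMap ℂ FockEnd τ
  | Gen.tinv => algebraMap ℂ FockEnd τ⁻¹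

/-- The action of the free algebra. -/
def freeAct (q d τ : ℂ) : Free →ₐ[ℂ] FockEnd := FreeAlgebra.lift ℂ (genAct q d τ)

theorem freeAct_gen (τ : ℂ) (x : Gen) : freeAct q d τ (gen x) = genAct q d τ x :=
  FreeAlgebra.lift_ι_apply _ _

theorem freeAct_freeH (τ : ℂ) (i : ZMod 2) {r : ℤ} (hr : r ≠ 0) :
    freeAct q d τ (freeH i r) = diag (hVal q d i r) := by
  rw [freeH, dif_pos hr, freeAct_gen, genAct]

/-- The modes `H_{i,r}` act diagonally, and algebra homomorphisms commute with the exponential, so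
it can be computed on eigenvalues. -/
theorem freeAct_expCoeff (τ c : ℂ) (i : ZMod 2) (s : ℕ → ℤ) (hs : ∀ r, r ≠ 0 → s r ≠ 0) (n : ℕ) :
    freeAct q d τ (expCoeff (fun r => c • freeH i (s r)) n) =
      diag fun lam => expCoeff (fun r => c * hVal q d i (s r) lam) n := by
  refine (expCoeff_map (A := Free) (B := FockEnd) (freeAct q d τ) _ n).trans ?_
  rw [expCoeff_congr (h' := fun r => diag (c • hVal q d i (s r))), ← expCoeff_map]
  · congr 1
    funext lam
    exact expCoeff_map (Pi.evalAlgHom ℂ (fun _ : YoungDiagram => ℂ) lam) _ n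
  · intro r hr
    rw [map_smul, map_smul, freeAct_freeH τ i (hs r hr)]

/-- The values `hVal` were chosen as logarithms of the expansions divided by their constant terms
`kVal` at infinity and `kVal⁻¹` at zero. Exponentiation returns the expansions, and the modes of the
wrong sign vanish on both sides. -/
theorem freeAct_freeCartan (h : Generic q d) (τ : ℂ) (e : PM) (i : ZMod 2) (k : ℤ) :
    freeAct q d τ (freeCartan q e i k) = kCur q d e i k := by
  have hq := h.q_sub_inv_ne
  cases e with
  | plus =>
    have hlead := fun lam => expansionCoeff_plus_of_hasLead (phi_hasLead_infty h lam i)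
    rw [freeCartan, kCur]
    split_ifs with hk
    · obtain ⟨n, rfl⟩ := Int.eq_ofNat_of_zero_le hk
      rw [map_mul, freeAct_expCoeff τ _ i _ (fun r hr => by simpa using hr), freeAct_gen, genAct,
        ← map_mul]
      congr 1
      funext lam
      have hkv := kVal_ne h lam i
      rw [Pi.mul_apply, expCoeff_congr (h' := logSeq (fun n => (kVal q lam i)⁻¹ *
        expansionCoeff PM.plus (phi q d lam i) n)), expCoeff_logSeq]
      · simp [hkv]
      · simp [(hlead lam).1, hkv]
      · intro r hr
        rw [hVal, if_pos (by omega), Int.toNat_natCast, mul_inv_cancel_left₀ hq]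
    · rw [map_zero]
      refine (map_zero diag).symm.trans (congrArg diag ?_)
      funext lam
      exact ((hlead lam).2 k (by omega)).symm
  | minus =>
    have hlead := fun lam => expansionCoeff_minus_of_hasLead (phi_hasLead_zero h lam i)
    rw [freeCartan, kCur]
    split_ifs with hk
    · obtain ⟨n, hn⟩ := Int.eq_ofNat_of_zero_le (a := -k) (by omega)
      obtain rfl : k = -(n : ℤ) := by omega
      rw [map_mul, freeAct_expCoeff τ _ i (fun r => -(r : ℤ)) (fun r hr => by simpa using hr),
        freeAct_gen, genAct, ← map_mul]
      congr 1
      funext lam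
      have hkv := kVal_ne h lam i
      rw [Pi.mul_apply, expCoeff_congr (h' := logSeq (fun n => kVal q lam i *
        expansionCoeff PM.minus (phi q d lam i) (-n))), expCoeff_logSeq]
      · simp [hkv]
      · simp [(hlead lam).1, hkv]
      · intro r hr
        rw [hVal, if_neg (by omega), neg_neg, Int.toNat_natCast, ← mul_assoc,
          neg_mul_neg, mul_inv_cancel₀ hq, one_mul]
    · rw [map_zero]
      refine (map_zero diag).symm.trans (congrArg diag ?_)
      funext lam
      exact ((hlead lam).2 k (by omega)).symm

section map

variable {A B : Type*} [Ring A] [Algebra ℂ A] [Ring B] [Algebra ℂ B] (f : A →ₐ[ℂ] B)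

theorem map_mulGzw (i j : ZMod 2) (x : ℤ → ℤ → A) (k l : ℤ) :
    f (mulGzw q d i j x k l) = mulGzw q d i j (fun k l => f (x k l)) k l := by
  unfold mulGzw
  split_ifs <;> simp [mulZW]

theorem map_mulGwz (i j : ZMod 2) (x : ℤ → ℤ → A) (k l : ℤ) :
    f (mulGwz q d i j x k l) = mulGwz q d i j (fun k l => f (x k l)) k l := by
  unfold mulGwz
  split_ifs <;> simp [mulWZ]

theorem map_exchangeE (i j : ZMod 2) (X Y : ℤ → A) (k l : ℤ) :
    f (exchangeE q d i j X Y k l) =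
      exchangeE q d i j (fun k => f (X k)) (fun l => f (Y l)) k l := by
  simp only [exchangeE, map_add, map_smul, map_mulGzw, map_mulGwz, map_mul]

theorem map_exchangeF (i j : ZMod 2) (X Y : ℤ → A) (k l : ℤ) :
    f (exchangeF q d i j X Y k l) =
      exchangeF q d i j (fun k => f (X k)) (fun l => f (Y l)) k l := by
  simp only [exchangeF, map_add, map_smul, map_mulGzw, map_mulGwz, map_mul]

theorem map_serre (X Y : ℤ → A) (k : Fin 3 → ℤ) (l : ℤ) :
    f (serre q X Y k l) = serre q (fun k => f (X k)) (fun l => f (Y l)) k l := by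
  simp only [serre, qComm, map_smul, map_sum, map_sub, map_mul]

end map

theorem freeAct_rel (h : Generic q d) {τ : ℂ} (hτ : τ ≠ 0) {x y : Free} (hxy : Rel q d x y) :
    freeAct q d τ x = freeAct q d τ y := by
  have hE : ∀ i k, freeAct q d τ (freeE i k) = eCur q d i k := fun i k => freeAct_gen _ _
  have hF : ∀ i k, freeAct q d τ (freeF i k) = fCur q d i k := fun i k => freeAct_gen _ _
  have hK := freeAct_freeCartan h τ
  induction hxy with
  | K_Kinv i =>
    rw [map_mul, freeAct_gen, freeAct_gen, genAct, genAct, ← map_mul, map_one, ← map_one diag]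
    exact congrArg diag (funext fun lam => mul_inv_cancel₀ (kVal_ne h lam i))
  | Kinv_K i =>
    rw [map_mul, freeAct_gen, freeAct_gen, genAct, genAct, ← map_mul, map_one, ← map_one diag]
    exact congrArg diag (funext fun lam => inv_mul_cancel₀ (kVal_ne h lam i))
  | t_tinv =>
    rw [map_mul, freeAct_gen, freeAct_gen, genAct, genAct, ← map_mul, mul_inv_cancel₀ hτ, map_one,
      map_one]
  | tinv_t =>
    rw [map_mul, freeAct_gen, freeAct_gen, genAct, genAct, ← map_mul, inv_mul_cancel₀ hτ, map_one,
      map_one]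
  | t_central x =>
    rw [map_mul, map_mul, freeAct_gen, genAct]
    exact Algebra.commutes _ _
  | KK e e' i j k l => rw [map_mul, map_mul, hK, hK, kCur, kCur, ← map_mul, ← map_mul, mul_comm]
  | KE e i j k l =>
    refine (map_exchangeE (A := Free) (B := FockEnd) (freeAct q d τ) i j _ _ k l).trans ?_
    simp only [hK, hE, exchangeE_kCur_eCur h, map_zero]
  | KF e i j k l =>
    refine (map_exchangeF (A := Free) (B := FockEnd) (freeAct q d τ) i j _ _ k l).trans ?_
    simp only [hK, hF, exchangeF_kCur_fCur h, map_zero]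
  | EF i j k l =>
    rw [map_sub, map_mul, map_mul, hE, hF, eCur_fCur h]
    split_ifs
    · rw [map_smul, map_sub, hK, hK]
    · rw [map_zero]
  | EE i j k l =>
    refine (map_exchangeE (A := Free) (B := FockEnd) (freeAct q d τ) i j _ _ k l).trans ?_
    simp only [hE, exchangeE_eCur h, map_zero]
  | FF i j k l =>
    refine (map_exchangeF (A := Free) (B := FockEnd) (freeAct q d τ) i j _ _ k l).trans ?_
    simp only [hF, exchangeF_fCur h, map_zero]
  | serreE i k l =>
    refine (map_serre (A := Free) (B := FockEnd) (freeAct q d τ) _ _ k l).trans ?_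
    simp only [hE, serre_eCur h, map_zero]
  | serreF i k l =>
    refine (map_serre (A := Free) (B := FockEnd) (freeAct q d τ) _ _ k l).trans ?_
    simp only [hF, serre_fCur h, map_zero]

/-- The Fock representation. -/
def fockRep (h : Generic q d) {τ : ℂ} (hτ : τ ≠ 0) : Toroidal q d →ₐ[ℂ] FockEnd :=
  RingQuot.liftAlgHom ℂ ⟨freeAct q d τ, fun _ _ hxy => freeAct_rel h hτ hxy⟩

theorem fockRep_proj (h : Generic q d) {τ : ℂ} (hτ : τ ≠ 0) (x : Free) :
    fockRep h hτ (proj q d x) = freeAct q d τ x :=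
  RingQuot.liftAlgHom_mkAlgHom_apply ℂ _ _ x

theorem isFockAction_fockRep (h : Generic q d) {τ : ℂ} (hτ : τ ≠ 0) :
    IsFockAction q d τ (fockRep h hτ) where
  cartan_ket lam e i k := by
    rw [cartan, fockRep_proj, freeAct_freeCartan h, kCur, diag_ket]
  F_ket i k lam := by
    rw [F, fockRep_proj, freeF, freeAct_gen, genAct, fCur, ofKet_ket]
  E_ket i k lam := by
    rw [E, fockRep_proj, freeE, freeAct_gen, genAct, eCur, ofKet_ket]
  t_ket v := by
    rw [t, fockRep_proj, freeAct_gen, genAct, Module.algebraMap_end_apply]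

theorem hasLevel_fockRep (h : Generic q d) {τ : ℂ} (hτ : τ ≠ 0) : HasLevel (fockRep h hτ) q := by
  intro v
  have : fockRep h hτ (K q d 0 * K q d 1) = q • 1 := by
    refine fockEnd_ext fun lam => ?_
    rw [map_mul, K, K, fockRep_proj, fockRep_proj, freeAct_gen, freeAct_gen, genAct, genAct,
      ← map_mul, diag_ket, Pi.mul_apply, kVal_mul h]
    rfl
  rw [this]
  rfl

/-! ### Structure of the Fock module -/

section fock

variable {τ : ℂ} {ρ : Toroidal q d →ₐ[ℂ] Module.End ℂ FockSpace}

theorem IsFockAction.isTame (h : Generic q d) (hρ : IsFockAction q d τ ρ) : IsTame ρ :=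
  ⟨YoungDiagram, Finsupp.basisSingleOne, phi q d, phi_injective h, fun lam => by
    rw [Finsupp.coe_basisSingleOne]
    exact hρ.cartan_ket lam⟩

/-- Two different basis vectors are separated by a Cartan mode. -/
theorem exists_expansionCoeff_ne (h : Generic q d) {lam mu : YoungDiagram} (hne : lam ≠ mu) :
    ∃ i k, expansionCoeff PM.plus (phi q d lam i) k ≠ expansionCoeff PM.plus (phi q d mu i) k := by
  by_contra hcon
  push Not at hcon
  exact hne (phi_injective h (funext fun i => expansionCoeff_ext (hcon i)))

-- Submodules are spanned by basis vectors because the weights separate these. If the support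
-- contains some `mu ≠ lam`, a Cartan mode minus its eigenvalue at `mu` removes `mu` and keeps
-- `lam`; induction on the size of the support does the rest.
open Classical in
theorem IsFockAction.ket_mem (h : Generic q d) (hρ : IsFockAction q d τ ρ)
    {U : Submodule ℂ FockSpace} (hU : ∀ x, ∀ u ∈ U, ρ x u ∈ U) (n : ℕ) :
    ∀ u ∈ U, u.support.card ≤ n → ∀ lam ∈ u.support, ket lam ∈ U := by
  induction n with
  | zero =>
    intro u _ hn lam hlam
    simp [Finset.card_eq_zero.1 (Nat.le_zero.1 hn)] at hlam
  | succ n ih =>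
    intro u hu hn lam hlam
    by_cases hall : ∀ mu ∈ u.support, mu = lam
    · have hsup : u = u lam • ket lam := by
        ext mu
        rw [Finsupp.smul_apply, ket, Finsupp.single_apply, smul_eq_mul]
        split_ifs with hmu
        · rw [hmu, mul_one]
        · rw [mul_zero]
          by_contra h0
          exact hmu (hall mu (Finsupp.mem_support_iff.2 h0)).symm
      have h1 := U.smul_mem (u lam)⁻¹ hu
      rwa [hsup, Finsupp.smul_apply, ket, Finsupp.single_eq_same, smul_smul, smul_eq_mul, mul_one,
        inv_mul_cancel₀ (Finsupp.mem_support_iff.1 hlam), one_smul] at h1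
    · push Not at hall
      obtain ⟨mu, hmu, hne⟩ := hall
      obtain ⟨i, k, hik⟩ := exists_expansionCoeff_ne h hne
      set c : YoungDiagram → ℂ := fun nu => expansionCoeff PM.plus (phi q d nu i) k with hc
      have hact : ∀ v : FockSpace, ∀ nu, (ρ (cartan q d PM.plus i k) v) nu = c nu * v nu := by
        intro v nu
        induction v using Finsupp.induction_linear with
        | zero => simp
        | add v w hv hw => rw [map_add, Finsupp.add_apply, Finsupp.add_apply, hv, hw, mul_add]
        | single kap a =>
          have h1 : Finsupp.single kap a = a • ket kap := by simp [ket]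
          rw [h1, map_smul, hρ.cartan_ket kap, smul_smul, Finsupp.smul_apply, Finsupp.smul_apply,
            ket, Finsupp.single_apply]
          split_ifs with hk
          · subst hk
            simp [hc, mul_comm]
          · simp
      set w : FockSpace := ρ (cartan q d PM.plus i k) u - c mu • u with hw
      have hwU : w ∈ U := U.sub_mem (hU _ u hu) (U.smul_mem _ hu)
      have hwv : ∀ nu, w nu = (c nu - c mu) * u nu := by
        intro nu
        rw [hw, Finsupp.sub_apply, hact, Finsupp.smul_apply, smul_eq_mul, sub_mul]
      have hsub : w.support ⊆ u.support.erase mu := by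
        intro nu hnu
        rw [Finsupp.mem_support_iff, hwv, mul_ne_zero_iff, sub_ne_zero] at hnu
        refine Finset.mem_erase.2 ⟨fun h0 => hnu.1 (by rw [h0]), Finsupp.mem_support_iff.2 hnu.2⟩
      refine ih w hwU ?_ lam ?_
      · have h1 := Finset.card_le_card hsub
        rw [Finset.card_erase_of_mem hmu] at h1
        omega
      · rw [Finsupp.mem_support_iff, hwv]
        exact mul_ne_zero (sub_ne_zero.2 (Ne.symm hik)) (Finsupp.mem_support_iff.1 hlam)

/-- A box with maximal sum of coordinates has no box of the diagram to its right or below it. -/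
theorem exists_removable {lam : YoungDiagram} (hlam : lam.cells.Nonempty) :
    ∃ b, Removable lam b := by
  obtain ⟨b, hb, hmax⟩ := lam.cells.exists_max_image (fun b => b.1 + b.2) hlam
  refine ⟨b, (removable_iff).2 ⟨hb, fun h1 => ?_, fun h1 => ?_⟩⟩
  · have := hmax _ h1
    simp at this
  · have := hmax _ h1
    simp at this

theorem coeffA_ne_zero (h : Generic q d) {lam : YoungDiagram} {b : Box} (hb : Addable lam b) :
    coeffA q d (color b) lam b ≠ 0 := by
  rw [coeffA_eq h hb.1]
  exact prodAfter_ne_zero h hb.1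

theorem coeffB_ne_zero (h : Generic q d) {lam : YoungDiagram} {b : Box} (hb : Removable lam b) :
    coeffB q d (color b) lam b ≠ 0 := by
  rw [coeffB_eq h hb.nbrs_subset]
  exact mul_ne_zero (inv_ne_zero h.q_sub_inv_ne) (prodBefore_ne_zero h _ b)

/-- A submodule containing a combination of distinct basis vectors contains those which occur. -/
theorem IsFockAction.ket_mem_of_sum (h : Generic q d) (hρ : IsFockAction q d τ ρ)
    {U : Submodule ℂ FockSpace} (hU : ∀ x, ∀ u ∈ U, ρ x u ∈ U) {S : Finset Box} (r : Box → ℂ)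
    (s : Box → YoungDiagram) (hu : ∑ b ∈ S, r b • ket (s b) ∈ U) (hs : Set.InjOn s S) {b : Box}
    (hb : b ∈ S) (hr : r b ≠ 0) : ket (s b) ∈ U := by
  refine hρ.ket_mem h hU _ _ hu le_rfl _ ?_
  rw [Finsupp.mem_support_iff, Finsupp.finsetSum_apply, Finset.sum_eq_single_of_mem b hb]
  · simpa [ket] using hr
  · intro c hc hcb
    rw [Finsupp.smul_apply, ket, Finsupp.single_eq_of_ne, smul_zero]
    exact fun h0 => hcb (hs hb hc h0).symm

/-- A single mode of `E` produces all removable boxes of this color at once. The resulting diagrams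
are distinct and the coefficients nonzero, so each basis vector can be extracted. -/
theorem IsFockAction.ket_removeBox_mem (h : Generic q d) (hρ : IsFockAction q d τ ρ)
    {U : Submodule ℂ FockSpace} (hU : ∀ x, ∀ u ∈ U, ρ x u ∈ U) {lam : YoungDiagram} {b : Box}
    (hb : Removable lam b) (hlam : ket lam ∈ U) : ket (removeBox lam b) ∈ U := by
  have h1 := hU (E q d (color b) 0) _ hlam
  rw [hρ.E_ket] at h1
  refine hρ.ket_mem_of_sum h hU _ (removeBox lam) h1 ?_ (mem_convexBoxes.2 ⟨rfl, hb⟩) ?_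
  · intro c hc c' hc' heq
    have hc1 := (mem_convexBoxes.1 hc).2
    have hc2 := (mem_convexBoxes.1 hc').2
    have h2 : lam.cells.erase c = lam.cells.erase c' := by rw [← hc1.cells, ← hc2.cells, heq]
    by_contra hne
    exact Finset.notMem_erase c _ (h2 ▸ Finset.mem_erase.2 ⟨hne, hc1.1⟩)
  · simpa using coeffB_ne_zero h hb

theorem IsFockAction.ket_addBox_mem (h : Generic q d) (hρ : IsFockAction q d τ ρ)
    {U : Submodule ℂ FockSpace} (hU : ∀ x, ∀ u ∈ U, ρ x u ∈ U) {lam : YoungDiagram} {b : Box}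
    (hb : Addable lam b) (hlam : ket lam ∈ U) : ket (addBox lam b) ∈ U := by
  have h1 := hU (F q d (color b) 0) _ hlam
  rw [hρ.F_ket] at h1
  refine hρ.ket_mem_of_sum h hU _ (addBox lam) h1 ?_ (mem_concaveBoxes.2 ⟨rfl, hb⟩) ?_
  · intro c hc c' hc' heq
    have hc1 := (mem_concaveBoxes.1 hc).2
    have hc2 := (mem_concaveBoxes.1 hc').2
    have h2 : insert c lam.cells = insert c' lam.cells := by rw [← hc1.cells, ← hc2.cells, heq]
    have h3 : c ∈ insert c' lam.cells := h2 ▸ Finset.mem_insert_self _ _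
    exact (Finset.mem_insert.1 h3).resolve_right hc1.1
  · simpa using coeffA_ne_zero h hb

/-- A nonzero submodule contains a basis vector. Removing boxes leads to the empty diagram, and
adding them reaches every diagram. -/
theorem IsFockAction.isIrreducible (h : Generic q d) (hρ : IsFockAction q d τ ρ) :
    IsIrreducible ρ := by
  refine ⟨inferInstance, fun U hU => ?_⟩
  by_cases hbot : U = ⊥
  · exact Or.inl hbot
  right
  have hdown : ∀ (n : ℕ) (lam : YoungDiagram), lam.card = n → ket lam ∈ U → ket ⊥ ∈ U := by
    intro n
    induction n with
    | zero =>
      intro lam hn hlam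
      obtain rfl : lam = ⊥ := YoungDiagram.ext (by simpa using Finset.card_eq_zero.1 hn)
      exact hlam
    | succ n ih =>
      intro lam hn hlam
      obtain ⟨b, hb⟩ := exists_removable (lam := lam)
        (Finset.card_pos.1 (by change 0 < lam.card; omega))
      refine ih (removeBox lam b) ?_ (hρ.ket_removeBox_mem h hU hb hlam)
      rw [YoungDiagram.card, hb.cells, Finset.card_erase_of_mem hb.1]
      change lam.card - 1 = n
      omega
  have hup : ket ⊥ ∈ U → ∀ (n : ℕ) (lam : YoungDiagram), lam.card = n → ket lam ∈ U := by
    intro h0 n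
    induction n with
    | zero =>
      intro lam hn
      obtain rfl : lam = ⊥ := YoungDiagram.ext (by simpa using Finset.card_eq_zero.1 hn)
      exact h0
    | succ n ih =>
      intro lam hn
      obtain ⟨b, hb⟩ := exists_removable (lam := lam)
        (Finset.card_pos.1 (by change 0 < lam.card; omega))
      refine hb.addBox_removeBox ▸ hρ.ket_addBox_mem h hU hb.addable (ih _ ?_)
      rw [YoungDiagram.card, hb.cells, Finset.card_erase_of_mem hb.1]
      change lam.card - 1 = n
      omega
  obtain ⟨u, hu, hu0⟩ := U.exists_mem_ne_zero_of_ne_bot hbot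
  obtain ⟨lam, hlam⟩ := Finsupp.support_nonempty_iff.2 hu0
  have hempty := hdown _ lam rfl (hρ.ket_mem h hU _ u hu le_rfl lam hlam)
  rw [eq_top_iff]
  intro v _
  induction v using Finsupp.induction_linear with
  | zero => exact U.zero_mem
  | add v w hv hw => exact U.add_mem (hv trivial) (hw trivial)
  | single mu a =>
    have h1 : Finsupp.single mu a = a • ket mu := by simp [ket]
    rw [h1]
    exact U.smul_mem _ (hup hempty _ mu rfl)

theorem IsFockAction.isHighestLWeight (h : Generic q d) (hρ : IsFockAction q d τ ρ) :
    IsHighestLWeight ρ (Psi q) := by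
  have hphi : phi q d ⊥ = Psi q := by
    funext i
    simp [phi]
  refine ⟨ket ⊥, hphi ▸ hρ.cartan_ket ⊥, fun i k => ?_, fun w => ?_⟩
  · rw [hρ.E_ket, Finset.sum_eq_zero]
    intro b hb
    exact absurd (mem_convexBoxes.1 hb).2.1 (by simp)
  -- The cyclic submodule of the vacuum is nonzero, hence everything by irreducibility.
  · set U : Submodule ℂ FockSpace := LinearMap.range
      ((LinearMap.applyₗ (R := ℂ) (ket ⊥)).comp ρ.toLinearMap) with hUdef
    have hmem : ∀ v, v ∈ U ↔ ∃ x, ρ x (ket ⊥) = v := fun v => Iff.rfl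
    have hU : ∀ x, ∀ u ∈ U, ρ x u ∈ U := by
      intro x u hu
      obtain ⟨y, rfl⟩ := (hmem u).1 hu
      exact (hmem _).2 ⟨x * y, by rw [map_mul, Module.End.mul_apply]⟩
    have hket : ket ⊥ ∈ U := (hmem _).2 ⟨1, by rw [map_one, Module.End.one_apply]⟩
    rcases (hρ.isIrreducible h).2 U hU with h0 | h0
    · rw [h0, Submodule.mem_bot] at hket
      simp [ket] at hket
    · exact (hmem w).1 (h0 ▸ Submodule.mem_top)

end fock

end
end QTor

theorem mainTheorem7 (q d : ℂ) (hq : q ≠ 0) (hd : d ≠ 0)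
    (hgeneric : ∀ m n : ℤ, q ^ m * d ^ n = 1 → m = 0 ∧ n = 0)
    (τ : ℂ) (hτ : τ ≠ 0) :
    ∃ ρ : QTor.Toroidal q d →ₐ[ℂ] Module.End ℂ QTor.FockSpace,
      QTor.IsFockAction q d τ ρ ∧
      QTor.IsIrreducible ρ ∧
      QTor.IsTame ρ ∧
      QTor.IsHighestLWeight ρ (QTor.Psi q) ∧
      QTor.HasLevel ρ q := by
  have h : QTor.Generic q d := ⟨hq, hd, hgeneric⟩
  have hρ := QTor.isFockAction_fockRep h hτ
  exact ⟨QTor.fockRep h hτ, hρ, hρ.isIrreducible h, hρ.isTame h, hρ.isHighestLWeight h,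
    QTor.hasLevel_fockRep h hτ⟩
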